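/- Let $X$ be a smooth projective surface (integral) over $\mathbb{C}$. An *arrangement* on a smooth surface $S$ over $\mathbb{C}$ is a finite set $\mathcal{D}$ of distinct smooth irreducible curves on $S$ with simple normal crossings, and $\Omega^1_S(\log\mathcal{D})$ is the sheaf of $\mathcal{O}_S$-modules of rational $1$-forms that near each point $x\in S$ can be written $\omega+\sum_i u_i\,\frac{dz_i}{z_i}$, where $\omega$ is a regular $1$-form, the $u_i$ are regular functions and the $z_i$ are local equations of the members of $\mathcal{D}$ through $x$. An arrangement $\mathcal{D}$ on $S$ is a *Torelli arrangement* if it can be recovered from $\Omega^1_S(\log\mathcal{D})$: for every arrangement $\mathcal{D}'$ on $S$, if $\Omega^1_S(\log\mathcal{D}')\cong\Omega^1_S(\log\mathcal{D})$ as $\mathcal{O}_S$-modules, then $\mathcal{D}'=\mathcal{D}$. Let $Z=\{p_1,\dots,p_k\}\subset X$ be a finite set of distinct (closed) points, let $\eta:\widetilde{X}\to X$ be the blow-up of $X$ along $Z$, and let $E_j=\eta^{-1}(p_j)$. For an arrangement $\mathcal{D}=\{C_1,\dots,C_m\}$ on $X$ let $\widetilde{\mathcal{D}}=\{\widetilde{C}_1,\dots,\widetilde{C}_m\}$,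 where $\widetilde{C}_i$ is the strict transform of $C_i$, and let $\widetilde{\mathcal{D}}^{E}=\widetilde{\mathcal{D}}\cup\{E_1,\dots,E_k\}$. If $\mathcal{D}$ is a Torelli arrangement on $X$ and $Z\cap C_i=\emptyset$ for every $i$, then $\widetilde{\mathcal{D}}$ and $\widetilde{\mathcal{D}}^{E}$ are Torelli arrangements on $\widetilde{X}$. -/

import Mathlib

open AlgebraicGeometry CategoryTheory TopologicalSpace Opposite

noncomputable section

namespace LogTorelli

/-- The spectrum of the field of complex numbers. -/
abbrev SpecC : Scheme.{0} := Spec (CommRingCat.of ℂ)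

/-! ### Projective varieties -/

/-- The grading of a polynomial ring by degree. -/
instance (n : ℕ) : GradedAlgebra (MvPolynomial.homogeneousSubmodule (Fin (n + 1)) ℂ) :=
  MvPolynomial.gradedAlgebra

/-- Projective space of dimension `n` over `ℂ`, as `Proj ℂ[x₀, …, xₙ]`. -/
abbrev ProjectiveSpaceC (n : ℕ) : Scheme.{0} :=
  Proj (MvPolynomial.homogeneousSubmodule (Fin (n + 1)) ℂ)

/-- The structure morphism of projective space over `ℂ`. -/
def ProjectiveSpaceC.toSpecC (n : ℕ) : ProjectiveSpaceC n ⟶ SpecC :=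
  Proj.toSpecZero (MvPolynomial.homogeneousSubmodule (Fin (n + 1)) ℂ) ≫
    Spec.map (CommRingCat.ofHom
      (algebraMap ℂ (MvPolynomial.homogeneousSubmodule (Fin (n + 1)) ℂ 0)))

/-- A scheme over `ℂ` is projective if it is a closed subscheme of some projective space. -/
def IsProjective {X : Scheme.{0}} (p : X ⟶ SpecC) : Prop :=
  ∃ (n : ℕ) (i : X ⟶ ProjectiveSpaceC n),
    IsClosedImmersion i ∧ i ≫ ProjectiveSpaceC.toSpecC n = p

/-- The integral scheme `X` is a smooth projective surface over `ℂ` (with structure morphism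
`p`): it is smooth of relative dimension two and projective over `ℂ`. -/
structure IsSmoothProjectiveSurface {X : Scheme.{0}} [IsIntegral X] (p : X ⟶ SpecC) : Prop where
  smooth : SmoothOfRelativeDimension 2 p
  projective : IsProjective p

/-! ### Ideals of closed subsets, curves, simple normal crossings -/

/-- The stalk at `x`, inside the local ring `𝒪_{X,x}`, of an ideal sheaf. -/
def stalkIdeal {X : Scheme.{0}} (I : X.IdealSheafData) (x : X) : Ideal (X.presheaf.stalk x) :=
  ⨆ (U : X.affineOpens) (hx : x ∈ U.1), (I.ideal U).map (X.presheaf.germ U.1 x hx).hom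

/-- `f ∈ 𝒪_{X,x}` is a local equation at `x` of the closed subset `C` (with its reduced
structure): it generates the stalk at `x` of the ideal sheaf of `C`. -/
def IsLocalEquation {X : Scheme.{0}} (C : Closeds X) (x : X) (f : X.presheaf.stalk x) : Prop :=
  stalkIdeal (Scheme.IdealSheafData.vanishingIdeal C) x = Ideal.span {f}

/-- A smooth irreducible curve on `X`, given by its underlying closed subset: an irreducible
closed subset whose reduced induced subscheme is smooth of relative dimension one over `ℂ`. -/
structure IsSmoothCurve {X : Scheme.{0}} (p : X ⟶ SpecC) (C : Closeds X) : Prop where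
  irreducible : IsIrreducible (C : Set X)
  smooth : SmoothOfRelativeDimension 1
    ((Scheme.IdealSheafData.vanishingIdeal C).subschemeι ≫ p)

/-- The set `D` of curves on the smooth surface `X` has simple normal crossings: at every closed
point `x` there are local coordinates `z₀, z₁` (generators of the maximal ideal of the
two-dimensional local ring `𝒪_{X,x}`) such that every member of `D` through `x` is given near `x`
by the vanishing of one of the coordinates. (Distinct members through `x` have distinct ideals
in `𝒪_{X,x}`, so they are given by distinct coordinates.) -/
def HasSimpleNormalCrossings {X : Scheme.{0}} (D : Set (Closeds X)) : Prop :=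
  ∀ x : X, IsClosed ({x} : Set X) →
    ∃ z : Fin 2 → X.presheaf.stalk x,
      Ideal.span (Set.range z) = IsLocalRing.maximalIdeal (X.presheaf.stalk x) ∧
      ∀ C ∈ D, x ∈ C → ∃ j, IsLocalEquation C x (z j)

/-- An arrangement on the surface `X`: a finite set of smooth irreducible curves with simple
normal crossings. -/
structure IsArrangement {X : Scheme.{0}} (p : X ⟶ SpecC) (D : Set (Closeds X)) : Prop where
  finite : D.Finite
  isSmoothCurve : ∀ C ∈ D, IsSmoothCurve p C
  snc : HasSimpleNormalCrossings D

/-! ### Rational differential forms and the logarithmic sheaf -/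

section LogSheaf

variable {X : Scheme.{0}} [IsIntegral X] (p : X ⟶ SpecC)

/-- The `ℂ`-algebra structure on the function field given by the structure morphism. -/
abbrev algebraFunctionField : Algebra ℂ X.functionField :=
  RingHom.toAlgebra ((Scheme.ΓSpecIso (CommRingCat.of ℂ)).inv ≫ p.appTop ≫
    X.presheaf.germ ⊤ (genericPoint X) trivial).hom

/-- The rational differential one-forms on `X`: the Kähler differentials over `ℂ` of the
function field. -/
def RationalForms : Type :=
  @KaehlerDifferential ℂ X.functionField _ _ (algebraFunctionField p)

instance : AddCommGroup (RationalForms p) :=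
  inferInstanceAs
    (AddCommGroup (@KaehlerDifferential ℂ X.functionField _ _ (algebraFunctionField p)))

instance : Module X.functionField (RationalForms p) :=
  inferInstanceAs (Module X.functionField
    (@KaehlerDifferential ℂ X.functionField _ _ (algebraFunctionField p)))

instance (x : X) : Module (X.presheaf.stalk x) (RationalForms p) :=
  Module.compHom _ (algebraMap (X.presheaf.stalk x) X.functionField)

/-- The universal derivation `d` on the function field. -/
def ratD (a : X.functionField) : RationalForms p :=
  @KaehlerDifferential.D ℂ X.functionField _ _ (algebraFunctionField p) a

/-- The germs at `x` of one-forms with logarithmic poles along `D`, as rational forms: the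
`𝒪_{X,x}`-submodule generated by the differentials `da` of all `a ∈ 𝒪_{X,x}` and by the
logarithmic differentials `df / f`, where `f` is a local equation at `x` of a member of `D`
through `x`. -/
def logStalk (D : Set (Closeds X)) (x : X) :
    Submodule (X.presheaf.stalk x) (RationalForms p) :=
  Submodule.span _
    (Set.range (fun a : X.presheaf.stalk x => ratD p (algebraMap _ X.functionField a)) ∪
      {ω | ∃ C ∈ D, x ∈ C ∧ ∃ f : X.presheaf.stalk x, IsLocalEquation C x f ∧
        ω = (algebraMap _ X.functionField f)⁻¹ • ratD p (algebraMap _ X.functionField f)})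

/-- A function on the open set `U` with values in the rational forms is given by a logarithmic
form if it is constant, equal to a rational form all of whose germs on `U` are logarithmic. -/
def logPrelocal (D : Set (Closeds X)) :
    TopCat.PrelocalPredicate (fun _ : X => RationalForms p) where
  pred {U} s := ∃ ω : RationalForms p, ∀ x : U, s x = ω ∧ ω ∈ logStalk p D x.1
  res := by
    rintro V U i s ⟨ω, h⟩
    exact ⟨ω, fun x => h (i x)⟩

/-- Being locally given by a logarithmic form. (On a nonempty open set `U`, which is irreducible,
such a function is the same as a rational form whose germs on `U` are all logarithmic; on the
empty set there is only one function.) -/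
def logLocal (D : Set (Closeds X)) :
    TopCat.LocalPredicate (fun _ : X => RationalForms p) :=
  (logPrelocal p D).sheafify

/-- The sections over `U` of the logarithmic sheaf, as an additive group. -/
def logSections (D : Set (Closeds X)) (U : X.Opens) :
    AddSubgroup (U → RationalForms p) where
  carrier := {s | (logLocal p D).pred s}
  add_mem' := by
    rintro a b ha hb x
    obtain ⟨V, hV, iV, ω, h⟩ := ha x
    obtain ⟨W, hW, iW, ω', h'⟩ := hb x
    refine ⟨V ⊓ W, ⟨hV, hW⟩, Opens.infLELeft _ _ ≫ iV, ω + ω', fun y => ⟨?_, ?_⟩⟩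
    · exact congrArg₂ (· + ·) (h ⟨y.1, y.2.1⟩).1 (h' ⟨y.1, y.2.2⟩).1
    · exact add_mem (h ⟨y.1, y.2.1⟩).2 (h' ⟨y.1, y.2.2⟩).2
  zero_mem' x := ⟨U, x.2, 𝟙 _, 0, fun _ => ⟨rfl, zero_mem _⟩⟩
  neg_mem' := by
    rintro a ha x
    obtain ⟨V, hV, iV, ω, h⟩ := ha x
    exact ⟨V, hV, iV, -ω, fun y => ⟨congrArg Neg.neg (h y).1, neg_mem (h y).2⟩⟩

/-- Functions on `U` act on sections over `U` pointwise, through their germs. -/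
instance (D : Set (Closeds X)) (U : X.Opens) : SMul Γ(X, U) (logSections p D U) where
  smul r s := ⟨fun x => X.presheaf.germ U x.1 x.2 r • s.1 x, by
    intro x
    obtain ⟨V, hV, iV, ω, h⟩ := s.2 x
    have : Nonempty U := ⟨x⟩
    refine ⟨V, hV, iV, X.germToFunctionField U r • ω, fun y => ?_⟩
    have hy : X.presheaf.germ U y.1 (iV.le y.2) r • ω = X.germToFunctionField U r • ω := by
      rw [← Scheme.algebraMap_germ_eq_germToFunctionField X (iV.le y.2) r]
      rfl
    refine ⟨?_, ?_⟩
    · rw [← hy]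
      exact congrArg (X.presheaf.germ U y.1 (iV.le y.2) r • ·) (h y).1
    · rw [← hy]
      exact Submodule.smul_mem _ _ (h y).2⟩

instance (D : Set (Closeds X)) (U : X.Opens) : Module Γ(X, U) (logSections p D U) where
  one_smul s := Subtype.ext <| funext fun x => by
    change X.presheaf.germ U x.1 x.2 1 • s.1 x = s.1 x
    rw [map_one, one_smul]
  mul_smul r r' s := Subtype.ext <| funext fun x => by
    change X.presheaf.germ U x.1 x.2 (r * r') • s.1 x =
      X.presheaf.germ U x.1 x.2 r • X.presheaf.germ U x.1 x.2 r' • s.1 x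
    rw [map_mul, mul_smul]
  smul_zero r := Subtype.ext <| funext fun x => smul_zero (X.presheaf.germ U x.1 x.2 r)
  smul_add r s s' := Subtype.ext <| funext fun x =>
    smul_add (X.presheaf.germ U x.1 x.2 r) (s.1 x) (s'.1 x)
  add_smul r r' s := Subtype.ext <| funext fun x => by
    change X.presheaf.germ U x.1 x.2 (r + r') • s.1 x =
      X.presheaf.germ U x.1 x.2 r • s.1 x + X.presheaf.germ U x.1 x.2 r' • s.1 x
    rw [map_add, add_smul]
  zero_smul s := Subtype.ext <| funext fun x => by
    change X.presheaf.germ U x.1 x.2 0 • s.1 x = 0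
    rw [map_zero, zero_smul]

/-- The presheaf of abelian groups of logarithmic forms, with restriction of functions. -/
def logPresheaf (D : Set (Closeds X)) : TopCat.Presheaf Ab.{0} X where
  obj U := AddCommGrpCat.of (logSections p D U.unop)
  map {U V} i := AddCommGrpCat.ofHom
    { toFun := fun s => ⟨fun x => s.1 (i.unop x), (logLocal p D).res i.unop s.1 s.2⟩
      map_zero' := rfl
      map_add' := fun _ _ => rfl }

theorem logPresheaf_isSheaf (D : Set (Closeds X)) : (logPresheaf p D).IsSheaf :=
  (TopCat.Presheaf.isSheaf_iff_isSheaf_comp (forget Ab.{0}) (logPresheaf p D)).mpr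
    (TopCat.subsheafToTypes (logLocal p D)).property

instance (D : Set (Closeds X)) (U : (Opens X)ᵒᵖ) :
    Module (X.ringCatSheaf.obj.obj U) ((logPresheaf p D).obj U) :=
  inferInstanceAs (Module Γ(X, U.unop) (logSections p D U.unop))

/-- The logarithmic sheaf `Ω¹_X(log D)`, as a sheaf of `𝒪_X`-modules: the subsheaf of the constant
sheaf of rational one-forms consisting of the forms with logarithmic germs. -/
def logSheaf (D : Set (Closeds X)) : X.Modules where
  val := PresheafOfModules.ofPresheaf (logPresheaf p D) (by
    intro U V i r s
    refine Subtype.ext <| funext fun x => ?_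
    exact congrArg (· • s.1 (i.unop x))
      (X.presheaf.germ_res_apply i.unop x.1 x.2 r).symm)
  isSheaf := logPresheaf_isSheaf p D

/-- `D` is a Torelli arrangement on `X`: it is an arrangement, and it can be recovered from the
sheaf of `𝒪_X`-modules `Ω¹_X(log D)`, that is, it is the only arrangement whose logarithmic sheaf
is isomorphic to `Ω¹_X(log D)`. -/
def IsTorelliArrangement (D : Set (Closeds X)) : Prop :=
  IsArrangement p D ∧
    ∀ D' : Set (Closeds X), IsArrangement p D' →
      Nonempty (logSheaf p D' ≅ logSheaf p D) → D' = D

end LogSheaf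

/-! ### Blow-ups -/

/-- An ideal sheaf is invertible if it is locally generated by a nonzerodivisor. -/
def IsInvertibleIdeal {T : Scheme.{0}} (J : T.IdealSheafData) : Prop :=
  ∀ x : T, ∃ U : T.affineOpens, x ∈ U.1 ∧
    ∃ f ∈ nonZeroDivisors Γ(T, U.1), J.ideal U = Ideal.span {f}

/-- `η : X' ⟶ X` is the blow-up of `X` along the closed subscheme with ideal sheaf `I`: the
inverse image ideal sheaf of `I` on `X'` is invertible, and `η` is universal with this property. -/
structure IsBlowUp {X' X : Scheme.{0}} (η : X' ⟶ X) (I : X.IdealSheafData) : Prop where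
  isInvertible : IsInvertibleIdeal (I.comap η)
  existsUnique_lift : ∀ (T : Scheme.{0}) (f : T ⟶ X), IsInvertibleIdeal (I.comap f) →
    ∃! g : T ⟶ X', g ≫ η = f

variable {X' X : Scheme.{0}} (η : X' ⟶ X) (Z : Closeds X)

/-- The strict transform of `C` under `η`: the closure of the preimage of `C \ Z`. -/
def strictTransform (C : Closeds X) : Closeds X' :=
  Closeds.closure (η ⁻¹' ((C : Set X) \ Z))

/-- The arrangement of the strict transforms of the members of `D`. -/
def strictTransforms (D : Set (Closeds X)) : Set (Closeds X') :=
  strictTransform η Z '' D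

/-- The exceptional curves: the sets `η⁻¹(z)` for the points `z` of `Z`. -/
def exceptionalCurves : Set (Closeds X') :=
  {E | ∃ z ∈ Z, (E : Set X') = η ⁻¹' {z}}

end LogTorelli

end

/-! An isomorphism between the logarithmic sheaves of two arrangements `D'` and `T` on the blow-up
acts on generic stalks. It is therefore a linear automorphism `G` of the two-dimensional space of
rational forms that carries each logarithmic stalk of `D'` onto that of `T`
(`exists_linearEquiv_of_iso`). Here `T` lies between the strict transforms of `D` and the strict
transforms together with all exceptional curves. The task is to show `D' = T`.

The main tool is the determinant `δ` of `G`. At a closed point the logarithmic forms are free of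
rank two, and passing from regular to logarithmic frames divides the determinant by a product `e` of
local equations (`exists_logStalk_eq_span`). Hence `δ` compares the divisors of `D'` and `T`
(`exists_det_unit`). Let `E` be the exceptional curve over `z ∈ Z`. Over a small punctured
neighbourhood of `z` the arrangement `T` has no members, so `δ` is regular there, and by Hartogs
(`CoordNhd.exists_ratOf_eq`) it is the pull-back of a function `a` defined near `z`.

The order of `δ` along `E` then decides everything. If `E` is in `T` but not in `D'`, then `δ` has a
pole along `E`, which is impossible for a pull-back. If `E` is in `D'` but not in `T`, then `δ`
vanishes to order exactly one along `E`. This is excluded by `LogComparison.false_of_pole`: the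
matrix of `G` on the pulled-back coordinate forms has regular entries vanishing at `z`, which forces
the coefficients of `dδ` to vanish at `z`, whereas `δ = w x` with `w` a unit makes `dδ` nonzero
modulo `x`. In the two remaining cases `δ` is a unit along `E`, so `a(z) ≠ 0`, and no member of `D'`
other than `E` comes near `E` (`LogComparison.mem_iff_mem_and_exists`).

Consequently the nonexceptional members of `D'` are preimages of curves on `X` avoiding `Z`, and
these form an arrangement `D''`. The automorphism `G` descends to `X`, matches the logarithmic
stalks of `D''` and `D` off `Z`, and also at `Z` by Hartogs. The Torelli property of `D` gives `D''
= D`, hence `D' = T` (`eq_of_iso`).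

The geometry of the blow-up is extracted from its universal property: it is an isomorphism off `Z`,
and over coordinates `x, y` it is covered by two charts with rings `A[y/x]` and `A[x/y]`
(`IsBlowUp.bijective_chart`). Modulo `x` the first becomes a polynomial ring over `ℂ`, which gives
the smoothness and irreducibility of `E` and a frame `dx, dτ` with `τ = y/x`. -/

noncomputable section

namespace LogTorelli

/-! ### Determinants of pairs of vectors -/

section Wedge

variable {O K W : Type*} [CommRing O] [Field K] [AddCommGroup W] [Module K W]

/-- The determinant of two vectors with respect to a basis with two elements. -/
def wedge (β : Module.Basis (Fin 2) K W) (u v : W) : K :=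
  β.repr u 0 * β.repr v 1 - β.repr u 1 * β.repr v 0

theorem wedge_basis (β : Module.Basis (Fin 2) K W) : wedge β (β 0) (β 1) = 1 := by
  simp [wedge]

theorem wedge_add_smul (β : Module.Basis (Fin 2) K W) (u v : W) (a b c d : K) :
    wedge β (a • u + b • v) (c • u + d • v) = (a * d - b * c) * wedge β u v := by
  simp [wedge]; ring

theorem wedge_smul_smul (β : Module.Basis (Fin 2) K W) (u v : W) (a d : K) :
    wedge β (a • u) (d • v) = a * d * wedge β u v := by
  simp [wedge]; ring

theorem wedge_add_left (β : Module.Basis (Fin 2) K W) (u u' v : W) :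
    wedge β (u + u') v = wedge β u v + wedge β u' v := by
  simp [wedge]; ring

theorem wedge_add_right (β : Module.Basis (Fin 2) K W) (u v v' : W) :
    wedge β u (v + v') = wedge β u v + wedge β u v' := by
  simp [wedge]; ring

theorem wedge_smul_left (β : Module.Basis (Fin 2) K W) (u v : W) (a : K) :
    wedge β (a • u) v = a * wedge β u v := by
  simp [wedge]; ring

theorem wedge_smul_right (β : Module.Basis (Fin 2) K W) (u v : W) (a : K) :
    wedge β u (a • v) = a * wedge β u v := by
  simp [wedge]; ring

theorem wedge_self (β : Module.Basis (Fin 2) K W) (u : W) : wedge β u u = 0 := by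
  simp [wedge]; ring

theorem basis_expand (β : Module.Basis (Fin 2) K W) (u : W) :
    u = β.repr u 0 • β 0 + β.repr u 1 • β 1 := by
  rw [← Fin.sum_univ_two (fun i => β.repr u i • β i), β.sum_repr]

/-- A linear map acts on the top exterior power by its determinant, which is the first factor on the
right. -/
theorem wedge_map (β : Module.Basis (Fin 2) K W) (G : W →ₗ[K] W) (u v : W) :
    wedge β (G u) (G v) = wedge β (G (β 0)) (G (β 1)) * wedge β u v := by
  conv_lhs => rw [basis_expand β u, basis_expand β v]
  simp only [map_add, map_smul]
  rw [wedge_add_smul, wedge]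
  simp only [wedge]
  ring

variable [Algebra O K] [Module O W] [IsScalarTower O K W]

theorem exists_wedge_eq (β : Module.Basis (Fin 2) K W) {v₀ v₁ w₀ w₁ : W}
    (h₀ : v₀ ∈ Submodule.span O {w₀, w₁}) (h₁ : v₁ ∈ Submodule.span O {w₀, w₁}) :
    ∃ c : O, wedge β v₀ v₁ = algebraMap O K c * wedge β w₀ w₁ := by
  obtain ⟨a, b, rfl⟩ := Submodule.mem_span_pair.mp h₀
  obtain ⟨c, d, rfl⟩ := Submodule.mem_span_pair.mp h₁
  refine ⟨a * d - b * c, ?_⟩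
  rw [← algebraMap_smul K a, ← algebraMap_smul K b, ← algebraMap_smul K c, ← algebraMap_smul K d,
    wedge_add_smul]
  simp

/-- The transition determinants in the two directions lie in `O`, and they are mutually inverse
because `wedge β w₀ w₁` can be cancelled. -/
theorem exists_wedge_eq_unit [FaithfulSMul O K] (β : Module.Basis (Fin 2) K W) {v₀ v₁ w₀ w₁ : W}
    (h : Submodule.span O {v₀, v₁} = Submodule.span O {w₀, w₁}) (hw : wedge β w₀ w₁ ≠ 0) :
    ∃ c : Oˣ, wedge β v₀ v₁ = algebraMap O K c * wedge β w₀ w₁ := by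
  obtain ⟨c, hc⟩ := exists_wedge_eq (O := O) β (v₀ := v₀) (v₁ := v₁) (w₀ := w₀) (w₁ := w₁)
    (h ▸ Submodule.subset_span (by simp)) (h ▸ Submodule.subset_span (by simp))
  obtain ⟨d, hd⟩ := exists_wedge_eq (O := O) β (v₀ := w₀) (v₁ := w₁) (w₀ := v₀) (w₁ := v₁)
    (h ▸ Submodule.subset_span (by simp)) (h ▸ Submodule.subset_span (by simp))
  have hdc : d * c = 1 := by
    apply FaithfulSMul.algebraMap_injective O K
    rw [hc, ← mul_assoc] at hd
    rw [map_mul, map_one]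
    exact mul_right_cancel₀ hw (by rw [← hd, one_mul])
  exact ⟨⟨c, d, by rw [mul_comm, hdc], hdc⟩, hc⟩

/-- Coefficients with respect to two vectors with nonzero determinant are unique. -/
theorem eq_of_wedge_ne_zero (β : Module.Basis (Fin 2) K W) {u v : W} (h : wedge β u v ≠ 0)
    {a b c d : K} (e : a • u + b • v = c • u + d • v) : a = c ∧ b = d := by
  have h₁ := congrArg (wedge β · v) e
  have h₂ := congrArg (wedge β u) e
  simp only [wedge_add_left, wedge_add_right, wedge_smul_left, wedge_smul_right, wedge_self,
    mul_zero, add_zero, zero_add] at h₁ h₂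
  exact ⟨mul_right_cancel₀ h h₁, mul_right_cancel₀ h h₂⟩

end Wedge

/-! ### Local algebra of a plane blow-up -/

section Algebra

variable {A : Type*} [CommRing A]

/-- Powers of the second element may be peeled off one at a time: if `y` is a nonzerodivisor modulo
`x`, so is `y ^ m`. -/
theorem dvd_of_pow_mul {x y : A} (h : ∀ a b, y * a = x * b → x ∣ a) (m : ℕ) :
    ∀ a b, y ^ m * a = x * b → x ∣ a := by
  induction m with
  | zero => intro a b e; exact ⟨b, by simpa using e⟩
  | succ m ih =>
    intro a b e
    obtain ⟨c, hc⟩ := ih (y * a) b (by rw [← e]; ring)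
    exact h a c hc

/-- A fraction that is regular where one of two elements of a regular sequence is invertible is
regular. -/
theorem mem_range_of_regular_sequence {K : Type*} [Field K] [Algebra A K] [FaithfulSMul A K]
    {x y : A} (hx : x ≠ 0) (h : ∀ a b, y * a = x * b → x ∣ a) (c : K) (m : ℕ)
    (hm : ∃ b, algebraMap A K y ^ m * c = algebraMap A K b) (n : ℕ)
    (hn : ∃ a, algebraMap A K x ^ n * c = algebraMap A K a) : ∃ a, c = algebraMap A K a := by
  have inj := FaithfulSMul.algebraMap_injective A K
  have hx' : algebraMap A K x ≠ 0 := fun e => hx (inj (by simpa using e))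
  obtain ⟨b, hb⟩ := hm
  induction n with
  | zero => simpa using hn
  | succ n ih =>
    obtain ⟨a, ha⟩ := hn
    -- Here `a` is the numerator of `x ^ (n + 1) * c`. Multiplied by `y ^ m` it becomes a multiple
    -- of `x`, so `x` already divides it and one power of `x` drops out.
    obtain ⟨d, rfl⟩ := dvd_of_pow_mul h m a (x ^ n * b) (inj (by
      simp only [map_mul, map_pow, ← ha, ← hb]; ring))
    exact ih ⟨d, mul_left_cancel₀ hx' (by rw [← map_mul, ← ha]; ring)⟩

variable (x y : A)

open Polynomial in
/-- The affine chart `A[y/x]` of the blow-up of the ideal `(x, y)`, when `x, y` is a regular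
sequence. -/
abbrev BlowUpChart : Type _ := AdjoinRoot (C x * X - C y : A[X])

namespace BlowUpChart

open Polynomial

variable {x y}

theorem of_mul_root : AdjoinRoot.of (C x * X - C y : A[X]) x * AdjoinRoot.root _ =
    AdjoinRoot.of (C x * X - C y : A[X]) y := by
  have := AdjoinRoot.eval₂_root (C x * X - C y : A[X])
  simpa [sub_eq_zero] using this

/-- From `x g = (xX - y) k` one reads off that `y k` is a multiple of `x`, coefficient by
coefficient. Regularity makes `k` divisible by `x`, and cancelling `x` puts `g` in the ideal. -/
theorem eq_zero_of_mul_eq_zero (hx : x ∈ nonZeroDivisors A)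
    (h : ∀ a b, y * a = x * b → x ∣ a) (b : BlowUpChart x y)
    (hb : AdjoinRoot.of (C x * X - C y : A[X]) x * b = 0) : b = 0 := by
  induction b using AdjoinRoot.induction_on with
  | ih g =>
  rw [← AdjoinRoot.mk_C, ← map_mul, AdjoinRoot.mk_eq_zero] at hb
  obtain ⟨k, hk⟩ := hb
  have hd : C x ∣ k := by
    rw [C_dvd_iff_dvd_coeff]
    intro i
    have e : C y * k = C x * (X * k - g) := by linear_combination hk
    have := congrArg (coeff · i) e
    simp only [coeff_C_mul] at this
    exact h _ _ this
  obtain ⟨k, rfl⟩ := hd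
  rw [AdjoinRoot.mk_eq_zero]
  refine ⟨k, ?_⟩
  have : C x * (g - (C x * X - C y) * k) = 0 := by linear_combination hk
  ext i
  have := congrArg (coeff · i) this
  simp only [coeff_C_mul, coeff_zero] at this
  have := (mem_nonZeroDivisors_iff.mp hx).1 _ this
  simpa [sub_eq_zero] using this

/-- Since `x` times the root is `y`, a power of `x` clears the root from any polynomial in it.
Statements about the chart thereby reduce to `A`. -/
theorem exists_pow_mul_eq (b : BlowUpChart x y) :
    ∃ n a, AdjoinRoot.of (C x * X - C y : A[X]) x ^ n * b = AdjoinRoot.of _ a := by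
  induction b using AdjoinRoot.induction_on with
  | ih g =>
  induction g using Polynomial.induction_on with
  | C a => exact ⟨0, a, by simp⟩
  | add p q hp hq =>
    obtain ⟨n, a, ha⟩ := hp
    obtain ⟨m, b, hb⟩ := hq
    refine ⟨n + m, x ^ m * a + x ^ n * b, ?_⟩
    simp only [map_add, map_mul, map_pow, ← ha, ← hb]
    ring
  | monomial n a ih =>
    obtain ⟨m, b, hb⟩ := ih
    refine ⟨m + 1, y * b, ?_⟩
    simp only [map_mul, ← hb, ← of_mul_root, map_pow, AdjoinRoot.mk_X, pow_succ]
    ring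

/-- Sending the root to `y / x` maps the chart to the fraction field of `A`, compatibly with the
inclusion of `A`. -/
theorem of_injective [IsDomain A] (hx : x ≠ 0) :
    Function.Injective (AdjoinRoot.of (C x * X - C y : A[X])) := by
  let K := FractionRing A
  have hx' : algebraMap A K x ≠ 0 := by simpa using hx
  let f : BlowUpChart x y →+* K := AdjoinRoot.lift (algebraMap A K)
    (algebraMap A K y / algebraMap A K x) (by simp [mul_div_cancel₀ _ hx'])
  have hf : (f.comp (AdjoinRoot.of _) : A →+* K) = algebraMap A K := by
    ext a; simp [f]
  refine Function.Injective.of_comp (f := f) ?_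
  rw [← RingHom.coe_comp, hf]
  exact IsFractionRing.injective A K

theorem isDomain [IsDomain A] (hx : x ≠ 0) (h : ∀ a b, y * a = x * b → x ∣ a) :
    IsDomain (BlowUpChart x y) := by
  have hx' : x ∈ nonZeroDivisors A := mem_nonZeroDivisors_of_ne_zero hx
  have inj := of_injective (y := y) hx
  have hnt : Nontrivial (BlowUpChart x y) := inj.nontrivial
  set ι := AdjoinRoot.of (C x * X - C y : A[X]) with hι
  have cancel : ∀ n (b : BlowUpChart x y), ι x ^ n * b = 0 → b = 0 := by
    intro n
    induction n with
    | zero => simp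
    | succ n ih =>
      intro b hb
      exact ih b (eq_zero_of_mul_eq_zero hx' h _ (by rw [← hb]; ring))
  have : NoZeroDivisors (BlowUpChart x y) := ⟨by
    intro b c e
    obtain ⟨n, a, ha⟩ := exists_pow_mul_eq b
    obtain ⟨m, a', ha'⟩ := exists_pow_mul_eq c
    have : a * a' = 0 := by
      apply inj
      rw [map_mul, ← ha, ← ha', map_zero, mul_mul_mul_comm, e, mul_zero]
    rcases mul_eq_zero.mp this with rfl | rfl
    · exact Or.inl (cancel n _ (by simpa using ha))
    · exact Or.inr (cancel m _ (by simpa using ha'))⟩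
  exact NoZeroDivisors.to_isDomain _

variable {k : Type*} [CommRing k] (ev : A →+* k) (hev : RingHom.ker ev = Ideal.span {x, y})

/-- The reduction of the chart modulo `x`: a polynomial ring over the residue field. -/
def toPoly (hx : ev x = 0) (hy : ev y = 0) : BlowUpChart x y →+* k[X] :=
  AdjoinRoot.lift (C.comp ev) X (by simp [hx, hy])

-- A polynomial killed by the reduction has all its coefficients in `(x, y)`, and `y` is itself a
-- multiple of `x` in the chart.
include hev in
theorem ker_toPoly (hx : ev x = 0) (hy : ev y = 0) :
    RingHom.ker (toPoly ev hx hy) = Ideal.span {AdjoinRoot.of (C x * X - C y : A[X]) x} := by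
  apply le_antisymm
  · intro b hb
    induction b using AdjoinRoot.induction_on with
    | ih g =>
    have hg : g.map ev = 0 := by
      rw [RingHom.mem_ker, toPoly, AdjoinRoot.lift_mk, ← Polynomial.eval₂_map] at hb
      simpa using hb
    rw [g.as_sum_range_C_mul_X_pow, map_sum]
    refine Ideal.sum_mem _ fun i _ => ?_
    rw [map_mul]
    refine Ideal.mul_mem_right _ _ ?_
    have : g.coeff i ∈ Ideal.span {x, y} := by
      rw [← hev, RingHom.mem_ker]
      simpa using congrArg (coeff · i) hg
    obtain ⟨a, b, e⟩ := Ideal.mem_span_pair.mp this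
    rw [← e, AdjoinRoot.mk_C, map_add, map_mul, map_mul, ← of_mul_root]
    exact Ideal.mem_span_singleton.mpr ⟨AdjoinRoot.of _ a + AdjoinRoot.of _ b * AdjoinRoot.root _,
      by ring⟩
  · rw [Ideal.span_singleton_le_iff_mem, RingHom.mem_ker]
    simp [toPoly, hx]

theorem toPoly_surjective (hx : ev x = 0) (hy : ev y = 0) (hs : Function.Surjective ev) :
    Function.Surjective (toPoly (x := x) (y := y) ev hx hy) := by
  intro g
  obtain ⟨g, rfl⟩ := Polynomial.map_surjective ev hs g
  exact ⟨AdjoinRoot.mk _ g, by rw [toPoly, AdjoinRoot.lift_mk, ← Polynomial.eval₂_map]; simp⟩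

end BlowUpChart

end Algebra

/-! ### Local coordinates on smooth algebras -/

section Coordinates

open KaehlerDifferential TensorProduct

variable {A : Type} [CommRing A] [Algebra ℂ A]

/-- An algebra map inducing a bijection of bases of differentials is flat, for smooth targets. -/
theorem flat_of_basis_kaehler {k P A ι : Type*} [CommRing k] [CommRing P] [CommRing A]
    [Algebra k P] [Algebra k A] [Algebra P A] [IsScalarTower k P A] [Algebra.FiniteType k P]
    [Algebra.IsStandardSmooth k A] (b : Module.Basis ι P Ω[P⁄k]) (b' : Module.Basis ι A Ω[A⁄k])
    (h : ∀ i, map k k P A (b i) = b' i) : Module.Flat P A := by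
  let e : A ⊗[P] Ω[P⁄k] ≃ₗ[A] Ω[A⁄k] := (b.baseChange A).equiv b' (Equiv.refl _)
  have he : (e : A ⊗[P] Ω[P⁄k] →ₗ[A] Ω[A⁄k]) = mapBaseChange k P A := by
    apply (b.baseChange A).ext
    intro i
    have h1 : e ((b.baseChange A) i) = b' i := Module.Basis.equiv_apply _ i b' _
    rw [LinearEquiv.coe_coe, h1, Module.Basis.baseChange_apply, mapBaseChange_tmul, one_smul, h]
  have hbij : Function.Bijective (mapBaseChange k P A) := by
    rw [← he]; exact e.bijective
  -- Surjectivity of the base-changed map on differentials makes the relative differentials vanish.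
  have hΩ : Subsingleton Ω[A⁄P] := by
    refine subsingleton_of_forall_eq 0 fun w => ?_
    obtain ⟨v, rfl⟩ := map_surjective k P A w
    exact (exact_mapBaseChange_map k P A v).mpr (hbij.2 v)
  -- In the Jacobi–Zariski sequence the connecting map vanishes by injectivity of the map on
  -- differentials, and the preceding term is zero because `A` is smooth over `k`.
  have hH : Subsingleton (Algebra.H1Cotangent P A) := by
    refine subsingleton_of_forall_eq 0 fun w => ?_
    have h0 : Algebra.H1Cotangent.δ k P A w = 0 := hbij.1 (by
      rw [map_zero]
      exact (Algebra.H1Cotangent.exact_δ_mapBaseChange k P A _).mpr ⟨w, rfl⟩)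
    obtain ⟨v, rfl⟩ := (Algebra.H1Cotangent.exact_map_δ k P A w).mp h0
    rw [Subsingleton.elim v 0, map_zero]
  have hs : Algebra.FormallySmooth P A := by
    rw [Algebra.formallySmooth_iff]
    exact ⟨inferInstance, hH⟩
  have hf : Algebra.FinitePresentation P A :=
    Algebra.FinitePresentation.of_restrict_scalars_finitePresentation k P A
  have : Algebra.Smooth P A := ⟨hs, hf⟩
  infer_instance

omit [Algebra ℂ A] in
/-- The images of the coordinates under a flat map to the affine plane form a regular sequence. -/
theorem dvd_of_mul_eq_mul_of_flat [Algebra (MvPolynomial (Fin 2) ℂ) A]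
    [Module.Flat (MvPolynomial (Fin 2) ℂ) A] {x y : A}
    (hP0 : algebraMap (MvPolynomial (Fin 2) ℂ) A (.X 0) = x)
    (hP1 : algebraMap (MvPolynomial (Fin 2) ℂ) A (.X 1) = y) :
    ∀ a c, y * a = x * c → x ∣ a := by
  intro a c hac
  -- The equational criterion of flatness: the relation `y a - x c = 0` comes from polynomial
  -- relations between the two variables, where primality of `X 0` gives the divisibility.
  obtain ⟨κ, m, v, h1, h2⟩ := Module.Flat.isTrivialRelation_of_sum_smul_eq_zero
    (R := MvPolynomial (Fin 2) ℂ) (M := A) (f := ![.X 1, - .X 0]) (x := ![a, c]) (by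
      simp only [Fin.sum_univ_two, Algebra.smul_def]
      simp [hP0, hP1, hac])
  have h1' := h1 0
  simp only [Matrix.cons_val_zero] at h1'
  rw [h1']
  refine Finset.dvd_sum fun j _ => ?_
  have h2' := h2 j
  simp only [Fin.sum_univ_two, Matrix.cons_val_zero, Matrix.cons_val_one] at h2'
  have hd : (MvPolynomial.X 0 : MvPolynomial (Fin 2) ℂ) ∣ .X 1 * m 0 j :=
    ⟨m 1 j, by linear_combination h2'⟩
  have hp : Prime (MvPolynomial.X 0 : MvPolynomial (Fin 2) ℂ) := MvPolynomial.X_prime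
  rcases hp.dvd_or_dvd hd with h | h
  · exact absurd (MvPolynomial.X_dvd_X.mp h) (by simp)
  · obtain ⟨q, hq⟩ := h
    rw [hq, Algebra.smul_def, map_mul, hP0, mul_assoc]
    exact dvd_mul_right _ _

/-- Functions whose differentials form a basis define a flat map to the affine plane, so they form
a regular sequence. -/
theorem dvd_of_mul_eq_mul_of_basis [Algebra.IsStandardSmooth ℂ A] {x y : A}
    (b : Module.Basis (Fin 2) A Ω[A⁄ℂ]) (hx : b 0 = D ℂ A x) (hy : b 1 = D ℂ A y) :
    ∀ a c, y * a = x * c → x ∣ a := by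
  let f : MvPolynomial (Fin 2) ℂ →ₐ[ℂ] A := MvPolynomial.aeval ![x, y]
  let : Algebra (MvPolynomial (Fin 2) ℂ) A := f.toRingHom.toAlgebra
  have hP0 : algebraMap (MvPolynomial (Fin 2) ℂ) A (.X 0) = x := by
    simp [RingHom.algebraMap_toAlgebra, f]
  have hP1 : algebraMap (MvPolynomial (Fin 2) ℂ) A (.X 1) = y := by
    simp [RingHom.algebraMap_toAlgebra, f]
  have : IsScalarTower ℂ (MvPolynomial (Fin 2) ℂ) A := IsScalarTower.of_algHom f
  have : Module.Flat (MvPolynomial (Fin 2) ℂ) A := by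
    refine flat_of_basis_kaehler (k := ℂ) (mvPolynomialBasis ℂ (Fin 2)) b fun i => ?_
    rw [mvPolynomialBasis_apply, map_D]
    fin_cases i
    · exact (congrArg (D ℂ A) hP0).trans hx.symm
    · exact (congrArg (D ℂ A) hP1).trans hy.symm
  exact dvd_of_mul_eq_mul_of_flat hP0 hP1

/-- The ideal of a rational point where two functions with independent differentials vanish is
generated by these functions near the point. -/
theorem exists_mul_mem_span_of_basis [Algebra.FiniteType ℂ A] (ev : A →ₐ[ℂ] ℂ) {x y : A}
    (h : ∀ w : Ω[A⁄ℂ], ∃ a c : A, w = a • D ℂ A x + c • D ℂ A y) (hx : ev x = 0) (hy : ev y = 0) :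
    ∃ r, ev r = 1 ∧ ∀ a, ev a = 0 → r * a ∈ Ideal.span {x, y} := by
  let m : Ideal A := RingHom.ker ev.toRingHom
  have hm : ∀ a, a ∈ m ↔ ev a = 0 := fun a => Iff.rfl
  let sub : A →ₗ[ℂ] m :=
    { toFun := fun a => ⟨a - algebraMap ℂ A (ev a), by simp [hm]⟩
      map_add' := fun a b => Subtype.ext (by simp; ring)
      map_smul' := fun c a => Subtype.ext (by simp [Algebra.smul_def]; ring) }
  -- The map `a ↦ a - a(z)` modulo `m ^ 2` is a derivation; it lets relations between differentials
  -- be read in the cotangent space.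
  let d : Derivation ℂ A m.Cotangent := Derivation.mk'
    ((m.toCotangent.restrictScalars ℂ).comp sub) (by
      intro a b
      simp only [LinearMap.comp_apply, LinearMap.restrictScalars_apply, ← map_smul, ← map_add]
      rw [Ideal.toCotangent_eq]
      have : ((sub (a * b) : m) : A) - ((a • sub b + b • sub a : m) : A) =
          - ((a - algebraMap ℂ A (ev a)) * (b - algebraMap ℂ A (ev b))) := by
        simp [sub]; ring
      rw [this, pow_two]
      exact neg_mem (Ideal.mul_mem_mul (sub a).2 (sub b).2))
  have hN : IsNoetherianRing A := Algebra.FiniteType.isNoetherianRing ℂ A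
  -- Applying this derivation to `da = b dx + c dy` gives `a ≡ b x + c y` modulo `m ^ 2`.
  have hmem : ∀ a ∈ m, a ∈ Ideal.span {x, y} ⊔ m * m := by
    intro a ha
    obtain ⟨b, c, hbc⟩ := h (D ℂ A a)
    have e := congrArg d.liftKaehlerDifferential hbc
    simp only [map_add, map_smul, Derivation.liftKaehlerDifferential_comp_D] at e
    have hd : ∀ z, ev z = 0 → ∃ hz : z ∈ m, d z = m.toCotangent ⟨z, hz⟩ := by
      intro z hz
      refine ⟨hz, ?_⟩
      change m.toCotangent (sub z) = _
      congr 1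
      exact Subtype.ext (by simp [sub, hz])
    obtain ⟨ha', e1⟩ := hd a ha
    obtain ⟨hx', e2⟩ := hd x hx
    obtain ⟨hy', e3⟩ := hd y hy
    rw [e1, e2, e3, ← map_smul, ← map_smul, ← map_add, Ideal.toCotangent_eq] at e
    have : a = (b * x + c * y) + (a - (b * x + c * y)) := by ring
    rw [this]
    refine Submodule.add_mem_sup (Ideal.mem_span_pair.mpr ⟨b, c, rfl⟩) ?_
    rw [← pow_two]; exact e
  let q := (Ideal.span {x, y} : Ideal A).mkQ
  -- Nakayama for `m / (x, y)`: some `r ≡ 1` modulo `m` annihilates it.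
  obtain ⟨r, hr, hr'⟩ := Submodule.exists_sub_one_mem_and_smul_eq_zero_of_fg_of_le_smul m
    (Submodule.map q m) ((IsNoetherian.noetherian m).map _) (by
      rintro _ ⟨a, ha, rfl⟩
      obtain ⟨u, hu, v, hv, rfl⟩ := Submodule.mem_sup.mp (hmem a ha)
      rw [map_add, (Submodule.Quotient.mk_eq_zero _ (x := u)).mpr hu |> (id : _ → q u = 0),
        zero_add, ← Submodule.map_smul'']
      exact Submodule.mem_map_of_mem (by simpa using! hv))
  refine ⟨r, ?_, fun a ha => ?_⟩
  · have := (hm _).mp hr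
    rw [map_sub, map_one, sub_eq_zero] at this
    exact this
  · exact (Submodule.Quotient.mk_eq_zero _).mp (hr' (q a) ⟨a, ha, rfl⟩)

/-- A standard smooth algebra of dimension two has coordinates centered at any rational point. -/
theorem exists_basis_kaehler [Algebra.IsStandardSmoothOfRelativeDimension 2 ℂ A]
    (ev : A →ₐ[ℂ] ℂ) : ∃ x y : A, ev x = 0 ∧ ev y = 0 ∧
      ∃ b : Module.Basis (Fin 2) A Ω[A⁄ℂ], b 0 = D ℂ A x ∧ b 1 = D ℂ A y := by
  obtain ⟨ι, σ, _, _, P, hP⟩ :=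
    Algebra.IsStandardSmoothOfRelativeDimension.out (n := 2) (R := ℂ) (S := A)
  -- The differentials of the generators that are not paired with a relation form a basis, and their
  -- number is the relative dimension.
  have hc : Nat.card ↑(Set.range P.map)ᶜ = 2 := by
    rw [← hP, Algebra.Presentation.dimension, Nat.card_coe_set_eq, Set.ncard_compl,
      ← Nat.card_coe_set_eq, Nat.card_range_of_injective P.map_inj]
  let e : ↑(Set.range P.map)ᶜ ≃ Fin 2 := Finite.equivFinOfCardEq hc
  let b := P.basisKaehler.reindex e
  -- Subtracting the value at the point centers a coordinate without changing its differential.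
  have hb : ∀ i, b i = D ℂ A (P.val (e.symm i) - algebraMap ℂ A (ev (P.val (e.symm i)))) := by
    intro i
    simp [b]
  exact ⟨_, _, by simp, by simp, b, hb 0, hb 1⟩

end Coordinates

/-! ### Stalks of ideals of closed subsets -/

section StalkIdeal

variable {X : Scheme.{0}}

theorem germ_res' {U V : X.Opens} (h : V ≤ U) {x : X} (hx : x ∈ V) (s : Γ(X, U)) :
    X.presheaf.germ V x hx (X.presheaf.map (homOfLE h).op s) = X.presheaf.germ U x (h hx) s :=
  X.presheaf.germ_res_apply _ _ _ _

theorem mem_vanishingIdeal_ideal_iff (C : Closeds X) (U : X.affineOpens) (s : Γ(X, U.1)) :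
    s ∈ (Scheme.IdealSheafData.vanishingIdeal C).ideal U ↔
      ∀ y (hy : y ∈ U.1), y ∈ C → ¬ IsUnit (X.presheaf.germ U.1 y hy s) := by
  rw [Scheme.IdealSheafData.vanishingIdeal_ideal, PrimeSpectrum.mem_vanishingIdeal]
  constructor
  · intro h y hy hyC hu
    obtain ⟨q, rfl⟩ : y ∈ Set.range U.2.fromSpec := by rw [U.2.range_fromSpec]; exact hy
    have hq : q ∈ PrimeSpectrum.basicOpen s := by
      have := (Scheme.mem_basicOpen X s _ hy).mpr hu
      rw [← U.2.fromSpec_preimage_basicOpen]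
      exact this
    exact hq (h q hyC)
  · intro h q hq
    by_contra hs
    have hq' : q ∈ PrimeSpectrum.basicOpen s := hs
    rw [← U.2.fromSpec_preimage_basicOpen] at hq'
    have hy : U.2.fromSpec q ∈ U.1 := by
      rw [← SetLike.mem_coe, ← U.2.range_fromSpec]; exact ⟨q, rfl⟩
    exact h _ hy hq ((Scheme.mem_basicOpen X s _ hy).mp hq')

theorem exists_affineOpen_le {U : X.Opens} {x : X} (hx : x ∈ U) :
    ∃ V : X.affineOpens, x ∈ V.1 ∧ V.1 ≤ U := by
  obtain ⟨_, ⟨V, hV, rfl⟩, hxV, hVU⟩ := X.isBasis_affineOpens.exists_subset_of_mem_open hx U.isOpen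
  exact ⟨⟨V, hV⟩, hxV, hVU⟩

/-- The supremum over all affine neighbourhoods is attained by each of them, because any two are
compared on a third inside their intersection. -/
theorem stalkIdeal_eq_map (I : X.IdealSheafData) (U : X.affineOpens) {x : X} (hx : x ∈ U.1) :
    stalkIdeal I x = (I.ideal U).map (X.presheaf.germ U.1 x hx).hom := by
  have key : ∀ (V W : X.affineOpens) (hV : x ∈ V.1) (hW : x ∈ W.1), V ≤ W →
      (I.ideal W).map (X.presheaf.germ W.1 x hW).hom =
        (I.ideal V).map (X.presheaf.germ V.1 x hV).hom := by
    intro V W hV hW h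
    rw [← I.map_ideal h, Ideal.map_map]
    congr 1
    ext s
    exact (germ_res' h hV s).symm
  apply le_antisymm
  · refine iSup₂_le fun W hW => ?_
    obtain ⟨V, hV, hVUW⟩ := exists_affineOpen_le (U := U.1 ⊓ W.1) ⟨hx, hW⟩
    rw [key V W hV hW (hVUW.trans inf_le_right), key V U hV hx (hVUW.trans inf_le_left)]
  · exact le_iSup₂_of_le U hx le_rfl

/-- Germs of functions vanishing on `C` near `x` are closed under addition because nonunits of a
local ring are. This removes affine opens from the description. -/
theorem mem_stalkIdeal_vanishingIdeal_iff (C : Closeds X) (x : X) (f : X.presheaf.stalk x) :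
    f ∈ stalkIdeal (Scheme.IdealSheafData.vanishingIdeal C) x ↔
      ∃ (U : X.Opens) (hx : x ∈ U) (s : Γ(X, U)), X.presheaf.germ U x hx s = f ∧
        ∀ y (hy : y ∈ U), y ∈ C → ¬ IsUnit (X.presheaf.germ U y hy s) := by
  constructor
  · intro hf
    obtain ⟨U, hx, -⟩ := exists_affineOpen_le (U := (⊤ : X.Opens)) (x := x) trivial
    rw [stalkIdeal_eq_map _ U hx] at hf
    refine Submodule.span_induction (p := fun f _ => ∃ (U : X.Opens) (hx : x ∈ U) (s : Γ(X, U)),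
      X.presheaf.germ U x hx s = f ∧
        ∀ y (hy : y ∈ U), y ∈ C → ¬ IsUnit (X.presheaf.germ U y hy s)) ?_ ?_ ?_ ?_ hf
    · rintro _ ⟨s, hs, rfl⟩
      exact ⟨U.1, hx, s, rfl, (mem_vanishingIdeal_ideal_iff C U s).mp hs⟩
    · exact ⟨⊤, trivial, 0, by simp, fun y hy _ h => by simp at h⟩
    · rintro _ _ - - ⟨U, hU, s, rfl, hs⟩ ⟨V, hV, t, rfl, ht⟩
      refine ⟨U ⊓ V, Opens.mem_inf.mpr ⟨hU, hV⟩, X.presheaf.map (homOfLE inf_le_left).op s +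
        X.presheaf.map (homOfLE inf_le_right).op t, ?_, ?_⟩
      · rw [map_add, germ_res', germ_res']
      · intro y hy hyC hu
        rw [map_add, germ_res', germ_res'] at hu
        rcases IsLocalRing.isUnit_or_isUnit_of_isUnit_add hu with h | h
        · exact hs y hy.1 hyC h
        · exact ht y hy.2 hyC h
    · rintro a _ - ⟨U, hU, s, rfl, hs⟩
      obtain ⟨V, hV, t, rfl⟩ := X.presheaf.exists_germ_eq a
      refine ⟨U ⊓ V, Opens.mem_inf.mpr ⟨hU, hV⟩, X.presheaf.map (homOfLE inf_le_right).op t *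
        X.presheaf.map (homOfLE inf_le_left).op s, ?_, ?_⟩
      · rw [map_mul, germ_res', germ_res', smul_eq_mul]
      · intro y hy hyC hu
        rw [map_mul, germ_res', germ_res'] at hu
        exact hs y hy.1 hyC (isUnit_of_mul_isUnit_right hu)
  · rintro ⟨U, hx, s, rfl, hs⟩
    obtain ⟨V, hV, hVU⟩ := exists_affineOpen_le hx
    rw [stalkIdeal_eq_map _ V hV, ← X.presheaf.germ_res_apply (homOfLE hVU) x hV]
    refine Ideal.mem_map_of_mem _ ((mem_vanishingIdeal_ideal_iff C V _).mpr fun y hy hyC => ?_)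
    rw [X.presheaf.germ_res_apply]
    exact hs y _ hyC

theorem stalkIdeal_eq_top_of_notMem {C : Closeds X} {x : X} (hx : x ∉ C) :
    stalkIdeal (Scheme.IdealSheafData.vanishingIdeal C) x = ⊤ := by
  rw [Ideal.eq_top_iff_one, mem_stalkIdeal_vanishingIdeal_iff]
  exact ⟨⟨(C : Set X)ᶜ, C.isClosed.isOpen_compl⟩, hx, 1, by simp, fun y hy hyC => absurd hyC hy⟩

theorem stalkIdeal_le_maximalIdeal {C : Closeds X} {x : X} (hx : x ∈ C) :
    stalkIdeal (Scheme.IdealSheafData.vanishingIdeal C) x ≤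
      IsLocalRing.maximalIdeal (X.presheaf.stalk x) := by
  intro f hf
  obtain ⟨U, hU, s, rfl, hs⟩ := (mem_stalkIdeal_vanishingIdeal_iff C x f).mp hf
  exact (IsLocalRing.mem_maximalIdeal _).mpr (hs x hU hx)

/-- Comparison of closed subsets by their ideals at a point. -/
theorem le_of_stalkIdeal_le {C C' : Closeds X} (hC' : IsIrreducible (C' : Set X)) {x : X}
    (hx : x ∈ C') (h : stalkIdeal (Scheme.IdealSheafData.vanishingIdeal C) x ≤
      stalkIdeal (Scheme.IdealSheafData.vanishingIdeal C') x) : C' ≤ C := by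
  obtain ⟨ξ, hξ⟩ := QuasiSober.sober hC' C'.isClosed
  have hsp : ξ ⤳ x := hξ.specializes hx
  -- Were the generic point `ξ` of `C'` outside `C`, some function in the ideal of `C` would be
  -- invertible at `ξ`. Its germ at `x` lies in the ideal of `C'`, so it would have to vanish at
  -- `ξ`.
  have hξC : ξ ∈ C := by
    by_contra hn
    obtain ⟨U, hxU, -⟩ := exists_affineOpen_le (U := (⊤ : X.Opens)) (x := x) trivial
    have hξU : ξ ∈ U.1 := hsp.mem_open U.1.isOpen hxU
    have htop := stalkIdeal_eq_top_of_notMem hn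
    rw [stalkIdeal_eq_map _ U hξU] at htop
    have hex : ∃ s ∈ (Scheme.IdealSheafData.vanishingIdeal C).ideal U,
        IsUnit (X.presheaf.germ U.1 ξ hξU s) := by
      by_contra hcon
      push Not at hcon
      have : ((Scheme.IdealSheafData.vanishingIdeal C).ideal U).map
          (X.presheaf.germ U.1 ξ hξU).hom ≤ IsLocalRing.maximalIdeal _ := by
        rw [Ideal.map_le_iff_le_comap]
        exact fun s hs => (IsLocalRing.mem_maximalIdeal _).mpr (hcon s hs)
      rw [htop, top_le_iff] at this
      exact (IsLocalRing.maximalIdeal.isMaximal _).ne_top this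
    obtain ⟨s, hs, hu⟩ := hex
    have hmem : X.presheaf.germ U.1 x hxU s ∈
        stalkIdeal (Scheme.IdealSheafData.vanishingIdeal C') x := by
      apply h
      rw [stalkIdeal_eq_map _ U hxU]
      exact Ideal.mem_map_of_mem _ hs
    obtain ⟨V, hV, t, ht, hvan⟩ := (mem_stalkIdeal_vanishingIdeal_iff C' x _).mp hmem
    have hξV : ξ ∈ V := hsp.mem_open V.isOpen hV
    refine hvan ξ hξV (hξ.mem) ?_
    have e := congrArg (X.presheaf.stalkSpecializes hsp) ht
    rw [TopCat.Presheaf.germ_stalkSpecializes_apply,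
      TopCat.Presheaf.germ_stalkSpecializes_apply] at e
    rw [e]; exact hu
  intro y hy
  exact (hξ.specializes hy).mem_closed C.isClosed hξC

/-- The ideal of an irreducible closed subset at one of its points is prime. -/
theorem isPrime_stalkIdeal {C : Closeds X} (hC : IsIrreducible (C : Set X)) {x : X} (hx : x ∈ C) :
    (stalkIdeal (Scheme.IdealSheafData.vanishingIdeal C) x).IsPrime := by
  obtain ⟨ξ, hξ⟩ := QuasiSober.sober hC C.isClosed
  have hsp : ξ ⤳ x := hξ.specializes hx
  -- The ideal is the contraction of the maximal ideal at the generic point of `C`: vanishing there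
  -- means vanishing on all of `C`.
  have : stalkIdeal (Scheme.IdealSheafData.vanishingIdeal C) x =
      (IsLocalRing.maximalIdeal (X.presheaf.stalk ξ)).comap
        (X.presheaf.stalkSpecializes hsp).hom := by
    ext f
    rw [Ideal.mem_comap, IsLocalRing.mem_maximalIdeal, mem_stalkIdeal_vanishingIdeal_iff,
      mem_nonunits_iff]
    constructor
    · rintro ⟨U, hU, s, rfl, hs⟩
      rw [TopCat.Presheaf.germ_stalkSpecializes_apply]
      exact hs ξ _ hξ.mem
    · intro hf
      obtain ⟨U, hU, s, rfl⟩ := X.presheaf.exists_germ_eq f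
      rw [TopCat.Presheaf.germ_stalkSpecializes_apply] at hf
      refine ⟨U, hU, s, rfl, fun y hy hyC hu => hf ?_⟩
      have hspy : ξ ⤳ y := hξ.specializes hyC
      have := hu.map (X.presheaf.stalkSpecializes hspy).hom
      rw [TopCat.Presheaf.germ_stalkSpecializes_apply] at this
      exact this
  rw [this]
  exact Ideal.IsPrime.comap _

theorem IsLocalEquation.mul_unit {C : Closeds X} {x : X} {f g : X.presheaf.stalk x}
    (hf : IsLocalEquation C x f) (hg : IsLocalEquation C x g) [IsDomain (X.presheaf.stalk x)] :
    ∃ u : (X.presheaf.stalk x)ˣ, f * u = g := by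
  have : Ideal.span {f} = Ideal.span {g} := hf.symm.trans hg
  exact Ideal.span_singleton_eq_span_singleton.mp this

/-- Divisibility of germs is an open condition, since the equation expressing it holds on a
neighbourhood. -/
theorem exists_mem_span_germ {U : X.Opens} {x : X} (hx : x ∈ U) (s t : Γ(X, U))
    (h : X.presheaf.germ U x hx t ∈ Ideal.span {X.presheaf.germ U x hx s}) :
    ∃ V : X.Opens, x ∈ V ∧ V ≤ U ∧ ∀ y (_ : y ∈ V) (hy : y ∈ U),
      X.presheaf.germ U y hy t ∈ Ideal.span {X.presheaf.germ U y hy s} := by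
  rw [Ideal.mem_span_singleton'] at h
  obtain ⟨a, ha⟩ := h
  obtain ⟨V, hV, c, rfl⟩ := X.presheaf.exists_germ_eq a
  have hVU : x ∈ V ⊓ U := Opens.mem_inf.mpr ⟨hV, hx⟩
  have e : X.presheaf.germ (V ⊓ U) x hVU (X.presheaf.map (homOfLE inf_le_right).op t) =
      X.presheaf.germ (V ⊓ U) x hVU (X.presheaf.map (homOfLE inf_le_left).op c *
        X.presheaf.map (homOfLE inf_le_right).op s) := by
    rw [map_mul, germ_res', germ_res', germ_res']
    exact ha.symm
  obtain ⟨W, hW, i₁, i₂, e⟩ := X.presheaf.germ_eq x _ _ _ _ e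
  refine ⟨W, hW, i₁.le.trans inf_le_right, fun y hyW hy => ?_⟩
  have e' := congrArg (X.presheaf.germ W y hyW) e
  simp only [map_mul, TopCat.Presheaf.germ_res_apply] at e'
  exact Ideal.mem_span_singleton'.mpr ⟨_, e'.symm⟩

/-- A local equation is a local equation near the point. -/
theorem IsLocalEquation.exists_section [IsLocallyNoetherian X] {C : Closeds X} {x : X}
    {f : X.presheaf.stalk x} (hf : IsLocalEquation C x f) :
    ∃ (U : X.Opens) (hx : x ∈ U) (s : Γ(X, U)), X.presheaf.germ U x hx s = f ∧
      ∀ y (hy : y ∈ U), IsLocalEquation C y (X.presheaf.germ U y hy s) := by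
  have hf' : f ∈ stalkIdeal (Scheme.IdealSheafData.vanishingIdeal C) x :=
    hf.symm ▸ Ideal.mem_span_singleton_self f
  obtain ⟨U₀, hx₀, s₀, rfl, hs₀⟩ := (mem_stalkIdeal_vanishingIdeal_iff C x f).mp hf'
  obtain ⟨U, hx, hUU₀⟩ := exists_affineOpen_le hx₀
  let s := X.presheaf.map (homOfLE hUU₀).op s₀
  have hs : ∀ y (hy : y ∈ U.1), X.presheaf.germ U.1 y hy s = X.presheaf.germ U₀ y (hUU₀ hy) s₀ :=
    fun y hy => germ_res' hUU₀ hy s₀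
  rw [← hs x hx] at hf
  set I := Scheme.IdealSheafData.vanishingIdeal C
  have hN : IsNoetherianRing Γ(X, U.1) := IsLocallyNoetherian.component_noetherian U
  -- The ideal is finitely generated on an affine neighbourhood; each generator is divisible by the
  -- equation near the point, and finitely many neighbourhoods intersect in an open one.
  obtain ⟨T, hT⟩ := (inferInstance : IsNoetherian Γ(X, U.1) Γ(X, U.1)).noetherian (I.ideal U)
  have hmem : ∀ t : T, ∃ V : X.Opens, x ∈ V ∧ V ≤ U.1 ∧ ∀ y (_ : y ∈ V) (hy : y ∈ U.1),
      X.presheaf.germ U.1 y hy t.1 ∈ Ideal.span {X.presheaf.germ U.1 y hy s} := by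
    rintro ⟨t, ht⟩
    refine exists_mem_span_germ hx s t ?_
    rw [← hf, stalkIdeal_eq_map _ U hx]
    exact Ideal.mem_map_of_mem _ (by rw [← hT]; exact Submodule.subset_span ht)
  choose V hxV hVU c using hmem
  have hW : ∀ y, y ∈ (⨅ t, V t) ⊓ U.1 ↔ (∀ t, y ∈ V t) ∧ y ∈ U.1 := by
    intro y
    rw [Opens.mem_inf, ← SetLike.mem_coe, Opens.coe_iInf]
    simp
  refine ⟨(⨅ t, V t) ⊓ U.1, (hW x).mpr ⟨hxV, hx⟩, X.presheaf.map (homOfLE inf_le_right).op s, ?_,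
    fun y hy => ?_⟩
  · rw [germ_res', hs]
  · obtain ⟨hyV, hyU⟩ := (hW y).mp hy
    rw [germ_res', IsLocalEquation]
    apply le_antisymm
    · rw [stalkIdeal_eq_map _ U hyU, ← hT]
      change Ideal.map _ (Ideal.span _) ≤ _
      rw [Ideal.map_span, Ideal.span_le]
      rintro _ ⟨t, ht, rfl⟩
      exact c ⟨t, ht⟩ y (hyV _) hyU
    · rw [Ideal.span_singleton_le_iff_mem, mem_stalkIdeal_vanishingIdeal_iff]
      exact ⟨U₀, hUU₀ hyU, s₀, (hs y hyU).symm, hs₀⟩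

theorem IsLocalEquation.isUnit {C : Closeds X} {x : X} {f : X.presheaf.stalk x}
    (hf : IsLocalEquation C x f) (hx : x ∉ C) : IsUnit f := by
  rw [← Ideal.span_singleton_eq_top, ← hf, stalkIdeal_eq_top_of_notMem hx]

end StalkIdeal

/-! ### Isomorphisms of logarithmic sheaves and linear automorphisms of rational forms -/

section LogSheafIso

variable {X : Scheme.{0}} [IsIntegral X] (p : X ⟶ SpecC)

theorem genericPoint_mem {U : X.Opens} (h : ∃ x, x ∈ U) : genericPoint X ∈ U := by
  obtain ⟨x, hx⟩ := h
  exact ((genericPoint_spec X).specializes trivial).mem_open U.isOpen hx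

theorem stalk_smul_def {x : X} (a : X.presheaf.stalk x) (ω : RationalForms p) :
    a • ω = algebraMap _ X.functionField a • ω := rfl

instance (x : X) : IsScalarTower (X.presheaf.stalk x) X.functionField (RationalForms p) where
  smul_assoc a b ω := by
    rw [stalk_smul_def, Algebra.smul_def, mul_smul]

theorem algebraMap_germ_eq {U : X.Opens} {x y : X} (hx : x ∈ U) (hy : y ∈ U) (s : Γ(X, U)) :
    algebraMap (X.presheaf.stalk x) X.functionField (X.presheaf.germ U x hx s) =
      algebraMap (X.presheaf.stalk y) X.functionField (X.presheaf.germ U y hy s) := by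
  have : Nonempty U := ⟨⟨x, hx⟩⟩
  rw [Scheme.algebraMap_germ_eq_germToFunctionField, Scheme.algebraMap_germ_eq_germToFunctionField]

theorem algebraMap_genericPoint (a : X.functionField) :
    @algebraMap _ _ _ _ (stalkFunctionFieldAlgebra X (genericPoint X)) a = a := by
  simp [RingHom.algebraMap_toAlgebra]

theorem ratD_add (a b : X.functionField) : ratD p (a + b) = ratD p a + ratD p b :=
  letI := algebraFunctionField p
  map_add (KaehlerDifferential.D ℂ X.functionField) a b

theorem ratD_mul (a b : X.functionField) : ratD p (a * b) = a • ratD p b + b • ratD p a :=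
  letI := algebraFunctionField p
  (KaehlerDifferential.D ℂ X.functionField).leibniz a b

theorem mem_span_ratD (ω : RationalForms p) :
    ω ∈ Submodule.span X.functionField (Set.range (ratD p)) :=
  letI := algebraFunctionField p
  (KaehlerDifferential.span_range_derivation ℂ X.functionField).ge (Submodule.mem_top (x := ω))

variable {p}

theorem ratD_mem_logStalk (D : Set (Closeds X)) (x : X) (a : X.presheaf.stalk x) :
    ratD p (algebraMap _ X.functionField a) ∈ logStalk p D x :=
  Submodule.subset_span (Or.inl ⟨a, rfl⟩)

/-- The local ring at the generic point is the function field, over which the differentials of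
functions span all rational forms. -/
theorem mem_logStalk_genericPoint (D : Set (Closeds X)) (ω : RationalForms p) :
    ω ∈ logStalk p D (genericPoint X) := by
  induction mem_span_ratD p ω using Submodule.span_induction with
  | mem ω h =>
    obtain ⟨a, rfl⟩ := h
    have := ratD_mem_logStalk (p := p) D (genericPoint X) a
    rwa [algebraMap_genericPoint] at this
  | zero => exact zero_mem _
  | add _ _ _ _ h₁ h₂ => exact add_mem h₁ h₂
  | smul a ω _ h =>
    have := Submodule.smul_mem _ (a : X.presheaf.stalk (genericPoint X)) h
    rwa [stalk_smul_def, algebraMap_genericPoint] at this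

/-- A local equation `f` of `C` at a point remains one nearby; at neighbouring points off `C` it is
a unit, and `df / f` is regular there. -/
theorem exists_open_of_mem_logStalk [IsLocallyNoetherian X] {D : Set (Closeds X)} {x : X}
    {ω : RationalForms p} (h : ω ∈ logStalk p D x) :
    ∃ U : X.Opens, x ∈ U ∧ ∀ y ∈ U, ω ∈ logStalk p D y := by
  induction h using Submodule.span_induction with
  | mem ω h =>
    rcases h with ⟨a, rfl⟩ | ⟨C, hC, hxC, f, hf, rfl⟩
    · obtain ⟨U, hU, s, rfl⟩ := X.presheaf.exists_germ_eq a
      refine ⟨U, hU, fun y hy => ?_⟩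
      dsimp only
      rw [algebraMap_germ_eq hU hy]
      exact ratD_mem_logStalk _ _ _
    · obtain ⟨U, hU, s, rfl, hs⟩ := hf.exists_section
      refine ⟨U, hU, fun y hy => ?_⟩
      rw [algebraMap_germ_eq hU hy]
      by_cases hyC : y ∈ C
      · exact Submodule.subset_span (Or.inr ⟨C, hC, hyC, _, hs y hy, rfl⟩)
      · obtain ⟨u, hu⟩ := (hs y hy).isUnit hyC
        rw [← hu]
        have h1 : (algebraMap (X.presheaf.stalk y) X.functionField u)⁻¹ =
            algebraMap (X.presheaf.stalk y) X.functionField (u⁻¹ : (X.presheaf.stalk y)ˣ) := by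
          rw [inv_eq_of_mul_eq_one_right]
          rw [← map_mul, Units.mul_inv, map_one]
        rw [h1, ← stalk_smul_def]
        exact Submodule.smul_mem _ _ (ratD_mem_logStalk _ _ _)
  | zero => exact ⟨⊤, trivial, fun y _ => zero_mem _⟩
  | add _ _ _ _ h₁ h₂ =>
    obtain ⟨U, hU, h₁⟩ := h₁
    obtain ⟨V, hV, h₂⟩ := h₂
    exact ⟨U ⊓ V, Opens.mem_inf.mpr ⟨hU, hV⟩, fun y hy => add_mem (h₁ y hy.1) (h₂ y hy.2)⟩
  | smul a ω _ h =>
    obtain ⟨U, hU, h⟩ := h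
    obtain ⟨V, hV, s, rfl⟩ := X.presheaf.exists_germ_eq a
    refine ⟨U ⊓ V, Opens.mem_inf.mpr ⟨hU, hV⟩, fun y hy => ?_⟩
    rw [stalk_smul_def, algebraMap_germ_eq hV hy.2, ← stalk_smul_def]
    exact Submodule.smul_mem _ _ (h y hy.1)

/-- Sections of the logarithmic sheaf are constant. -/
theorem logSections_eq {D : Set (Closeds X)} {U : X.Opens} (s : logSections p D U) (x y : U) :
    s.1 x = s.1 y := by
  suffices ∀ x : U, s.1 x = s.1 ⟨genericPoint X, genericPoint_mem ⟨x.1, x.2⟩⟩ by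
    rw [this x, this y]
  intro x
  obtain ⟨V, hV, iV, ω, h⟩ := s.2 x
  exact (h ⟨x.1, hV⟩).1.trans (h ⟨genericPoint X, genericPoint_mem ⟨x.1, hV⟩⟩).1.symm

theorem logSections_mem {D : Set (Closeds X)} {U : X.Opens} (s : logSections p D U) (x y : U) :
    s.1 x ∈ logStalk p D y.1 := by
  obtain ⟨V, hV, iV, ω, h⟩ := s.2 y
  have := h ⟨y.1, hV⟩
  rw [logSections_eq s x y]
  rw [show s.1 y = ω from this.1]; exact this.2

/-- The section given by a rational form with logarithmic germs. -/
def constSection (D : Set (Closeds X)) (U : X.Opens) (ω : RationalForms p)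
    (h : ∀ x ∈ U, ω ∈ logStalk p D x) : logSections p D U :=
  ⟨fun _ => ω, fun x => ⟨U, x.2, 𝟙 U, ω, fun y => ⟨rfl, h y.1 y.2⟩⟩⟩

variable {D D' : Set (Closeds X)}

/-- The action of a morphism of logarithmic sheaves on sections. -/
def sectionsMap (φ : logSheaf p D' ⟶ logSheaf p D) (U : X.Opens) :
    logSections p D' U →+ logSections p D U :=
  (φ.app U).hom

theorem sectionsMap_smul (φ : logSheaf p D' ⟶ logSheaf p D) (U : X.Opens) (r : Γ(X, U))
    (s : logSections p D' U) : sectionsMap φ U (r • s) = r • sectionsMap φ U s :=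
  Scheme.Modules.Hom.app_smul φ r (x := s)

theorem sectionsMap_res (φ : logSheaf p D' ⟶ logSheaf p D) {U V : X.Opens} (h : V ≤ U)
    (s : logSections p D' U) (t : logSections p D' V) (hst : ∀ x : V, t.1 x = s.1 ⟨x.1, h x.2⟩)
    (x : V) : (sectionsMap φ V t).1 x = (sectionsMap φ U s).1 ⟨x.1, h x.2⟩ := by
  have ht : t = (logSheaf p D').presheaf.map (homOfLE h).op s := Subtype.ext (funext hst)
  have := CategoryTheory.congr_fun ((Scheme.Modules.Hom.mapPresheaf φ).naturality (homOfLE h).op) s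
  have e : sectionsMap φ V t = (logSheaf p D).presheaf.map (homOfLE h).op (sectionsMap φ U s) := by
    rw [ht]; exact this
  exact congrFun (congrArg Subtype.val e) x

variable [IsLocallyNoetherian X]

theorem exists_open_of_form (D : Set (Closeds X)) (ω : RationalForms p) :
    ∃ U : X.Opens, genericPoint X ∈ U ∧ ∀ y ∈ U, ω ∈ logStalk p D y :=
  exists_open_of_mem_logStalk (mem_logStalk_genericPoint D ω)

/-- The action of a morphism of logarithmic sheaves on rational forms. -/
def formMapAux (φ : logSheaf p D' ⟶ logSheaf p D) (ω : RationalForms p) : RationalForms p :=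
  (sectionsMap φ _ (constSection D' _ ω (exists_open_of_form D' ω).choose_spec.2)).1
    ⟨genericPoint X, (exists_open_of_form D' ω).choose_spec.1⟩

/-- Independence of the chosen open set: two choices are compared on their intersection, which
contains the generic point. -/
theorem formMapAux_eq (φ : logSheaf p D' ⟶ logSheaf p D) (ω : RationalForms p) {U : X.Opens}
    (h : ∀ y ∈ U, ω ∈ logStalk p D' y) (x : U) :
    (sectionsMap φ U (constSection D' U ω h)).1 x = formMapAux φ ω := by
  let V := (exists_open_of_form D' ω).choose
  have hV := (exists_open_of_form D' ω).choose_spec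
  have hU : genericPoint X ∈ U := genericPoint_mem ⟨x.1, x.2⟩
  have hUV : genericPoint X ∈ U ⊓ V := Opens.mem_inf.mpr ⟨hU, hV.1⟩
  let t := constSection D' (U ⊓ V) ω (fun y hy => h y hy.1)
  rw [logSections_eq _ x ⟨genericPoint X, hU⟩]
  have h₁ := sectionsMap_res φ (U := U) (V := U ⊓ V) inf_le_left (constSection D' U ω h) t
    (fun _ => rfl) ⟨_, hUV⟩
  have h₂ := sectionsMap_res φ (U := V) (V := U ⊓ V) inf_le_right (constSection D' V ω hV.2) t
    (fun _ => rfl) ⟨_, hUV⟩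
  exact h₁.symm.trans h₂

theorem formMapAux_mem (φ : logSheaf p D' ⟶ logSheaf p D) {ω : RationalForms p} {x : X}
    (h : ω ∈ logStalk p D' x) : formMapAux φ ω ∈ logStalk p D x := by
  obtain ⟨U, hU, h⟩ := exists_open_of_mem_logStalk h
  rw [← formMapAux_eq φ ω h ⟨x, hU⟩]
  exact logSections_mem _ _ ⟨x, hU⟩

/-- The linear map on rational forms given by a morphism of logarithmic sheaves. -/
def formMap (φ : logSheaf p D' ⟶ logSheaf p D) :
    RationalForms p →ₗ[X.functionField] RationalForms p where
  toFun := formMapAux φ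
  map_add' ω ω' := by
    obtain ⟨U, hU, h⟩ := exists_open_of_form D' ω
    obtain ⟨V, hV, h'⟩ := exists_open_of_form D' ω'
    have hUV : genericPoint X ∈ U ⊓ V := Opens.mem_inf.mpr ⟨hU, hV⟩
    rw [← formMapAux_eq φ ω (U := U ⊓ V) (fun y hy => h y hy.1) ⟨_, hUV⟩,
      ← formMapAux_eq φ ω' (U := U ⊓ V) (fun y hy => h' y hy.2) ⟨_, hUV⟩,
      ← formMapAux_eq φ (ω + ω') (U := U ⊓ V)
        (fun y hy => add_mem (h y hy.1) (h' y hy.2)) ⟨_, hUV⟩]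
    exact congrFun (congrArg Subtype.val ((sectionsMap φ (U ⊓ V)).map_add
      (constSection D' (U ⊓ V) ω (fun y hy => h y hy.1))
      (constSection D' (U ⊓ V) ω' (fun y hy => h' y hy.2)))) ⟨_, hUV⟩
  map_smul' k ω := by
    obtain ⟨U, hU, h⟩ := exists_open_of_form D' ω
    obtain ⟨V, hV, r, rfl⟩ := X.presheaf.exists_germ_eq (x := genericPoint X) k
    have hUV : genericPoint X ∈ U ⊓ V := Opens.mem_inf.mpr ⟨hU, hV⟩
    let r' : Γ(X, U ⊓ V) := X.presheaf.map (homOfLE inf_le_right).op r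
    have hr : ∀ y (hy : y ∈ U ⊓ V) (ω : RationalForms p),
        X.presheaf.germ (U ⊓ V) y hy r' • ω =
          (X.presheaf.germ V (genericPoint X) hV r : X.functionField) • ω := by
      intro y hy ω
      rw [germ_res', stalk_smul_def, algebraMap_germ_eq _ hV, algebraMap_genericPoint]
    have hkω : ∀ y ∈ U ⊓ V, (X.presheaf.germ V (genericPoint X) hV r : X.functionField) • ω ∈
        logStalk p D' y := fun y hy => by
      rw [← hr y hy]; exact Submodule.smul_mem _ _ (h y hy.1)
    have e : constSection D' (U ⊓ V)
        ((X.presheaf.germ V (genericPoint X) hV r : X.functionField) • ω) hkω =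
        r' • constSection D' (U ⊓ V) ω (fun y hy => h y hy.1) :=
      Subtype.ext (funext fun y => (hr y.1 y.2 ω).symm)
    rw [← formMapAux_eq φ ω (U := U ⊓ V) (fun y hy => h y hy.1) ⟨_, hUV⟩,
      ← formMapAux_eq φ _ (U := U ⊓ V) hkω ⟨_, hUV⟩, e, sectionsMap_smul]
    exact hr _ hUV _

theorem formMap_comp (φ : logSheaf p D' ⟶ logSheaf p D) (ψ : logSheaf p D ⟶ logSheaf p D')
    (h : φ ≫ ψ = 𝟙 _) (ω : RationalForms p) : formMap ψ (formMap φ ω) = ω := by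
  obtain ⟨U, hU, hω⟩ := exists_open_of_form D' ω
  have hω' : ∀ y ∈ U, formMapAux φ ω ∈ logStalk p D y := fun y hy => formMapAux_mem φ (hω y hy)
  have e : constSection D U (formMapAux φ ω) hω' = sectionsMap φ U (constSection D' U ω hω) :=
    Subtype.ext (funext fun y => (formMapAux_eq φ ω hω y).symm)
  have e' : sectionsMap ψ U (sectionsMap φ U (constSection D' U ω hω)) =
      constSection D' U ω hω := by
    have := congrArg (fun χ => sectionsMap χ U (constSection D' U ω hω)) h
    exact this
  change formMapAux ψ (formMapAux φ ω) = ω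
  rw [← formMapAux_eq ψ _ hω' ⟨_, hU⟩, e, e']
  rfl

/-- An isomorphism of logarithmic sheaves is given by a linear automorphism of the rational
forms. -/
theorem exists_linearEquiv_of_iso (e : logSheaf p D' ≅ logSheaf p D) :
    ∃ G : RationalForms p ≃ₗ[X.functionField] RationalForms p,
      ∀ x ω, ω ∈ logStalk p D' x ↔ G ω ∈ logStalk p D x := by
  refine ⟨LinearEquiv.ofLinearMap (formMap e.hom) (formMap e.inv)
    (LinearMap.ext fun ω => formMap_comp _ _ e.inv_hom_id ω)
    (LinearMap.ext fun ω => formMap_comp _ _ e.hom_inv_id ω), fun x ω =>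
      ⟨fun h => formMapAux_mem e.hom h, fun h => ?_⟩⟩
  have := formMapAux_mem e.inv h
  have e' : formMapAux e.inv (formMapAux e.hom ω) = ω := formMap_comp _ _ e.hom_inv_id ω
  exact e' ▸ this

omit [IsLocallyNoetherian X] in
theorem map_mem_logSections (G : RationalForms p →ₗ[X.functionField] RationalForms p)
    (h : ∀ x, ∀ ω ∈ logStalk p D' x, G ω ∈ logStalk p D x) {U : X.Opens}
    (s : logSections p D' U) : (fun x => G (s.1 x)) ∈ logSections p D U := by
  intro x
  obtain ⟨V, hV, iV, ω, hω⟩ := s.2 x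
  exact ⟨V, hV, iV, G ω, fun y => ⟨congrArg G (hω y).1, h _ _ (hω y).2⟩⟩

/-- The morphism of logarithmic sheaves given by a linear map on rational forms. -/
def logSheafHom (G : RationalForms p →ₗ[X.functionField] RationalForms p)
    (h : ∀ x, ∀ ω ∈ logStalk p D' x, G ω ∈ logStalk p D x) : logSheaf p D' ⟶ logSheaf p D where
  val :=
  { app := fun U => ModuleCat.ofHom (X := (logPresheaf p D').obj U) (Y := (logPresheaf p D).obj U)
      { toFun := fun s => ⟨fun x => G (s.1 x), map_mem_logSections G h s⟩
        map_add' := fun s t => Subtype.ext (funext fun x => G.map_add (s.1 x) (t.1 x))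
        map_smul' := fun r s => Subtype.ext (funext fun x => by
          exact G.map_smul (algebraMap _ X.functionField (X.presheaf.germ U.unop x.1 x.2 r))
            (s.1 x)) }
    naturality := fun f => rfl }

omit [IsLocallyNoetherian X] in
theorem nonempty_iso_of_linearEquiv (G : RationalForms p ≃ₗ[X.functionField] RationalForms p)
    (h : ∀ x ω, ω ∈ logStalk p D' x ↔ G ω ∈ logStalk p D x) :
    Nonempty (logSheaf p D' ≅ logSheaf p D) := by
  refine ⟨⟨logSheafHom G.toLinearMap fun x ω hω => (h x ω).mp hω,
    logSheafHom G.symm.toLinearMap fun x ω hω => (h x _).mpr (by simpa using hω), ?_, ?_⟩⟩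
  · ext U s
    exact Subtype.ext (funext fun x => G.symm_apply_apply (s.1 x))
  · ext U s
    exact Subtype.ext (funext fun x => G.apply_symm_apply (s.1 x))

end LogSheafIso

/-! ### Inverse images of ideal sheaves -/

section Comap

variable {X Y : Scheme.{0}}

/-! ### Kernels of morphisms from spectra, and inverse image ideals computed on affine opens. -/

theorem fromSpec_appLE_top {U : X.Opens} (hU : IsAffineOpen U) :
    hU.fromSpec.appLE U ⊤ hU.fromSpec_preimage_self.ge = (Scheme.ΓSpecIso Γ(X, U)).inv := by
  rw [Scheme.Hom.appLE, hU.fromSpec_app_self, Category.assoc, ← Functor.map_comp]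
  convert Category.comp_id _
  exact (Spec _).presheaf.map_id _

theorem le_preimage_SpecMap_fromSpec {U : X.Opens} (hU : IsAffineOpen U) {R : CommRingCat.{0}}
    (φ : Γ(X, U) ⟶ R) : ⊤ ≤ (Spec.map φ ≫ hU.fromSpec) ⁻¹ᵁ U := by
  rw [Scheme.Hom.comp_preimage, hU.fromSpec_preimage_self]; rfl

theorem SpecMap_fromSpec_appLE {U : X.Opens} (hU : IsAffineOpen U) {R : CommRingCat.{0}}
    (φ : Γ(X, U) ⟶ R) :
    (Spec.map φ ≫ hU.fromSpec).appLE U ⊤ (le_preimage_SpecMap_fromSpec hU φ) =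
      φ ≫ (Scheme.ΓSpecIso R).inv := by
  rw [← Scheme.Hom.appLE_comp_appLE (Spec.map φ) hU.fromSpec U ⊤ ⊤
    hU.fromSpec_preimage_self.ge le_top, fromSpec_appLE_top, Scheme.ΓSpecIso_inv_naturality]
  simp [Scheme.Hom.appLE]
  exact Category.comp_id _

theorem ker_SpecMap_fromSpec {U : X.affineOpens} (hU : IsAffineOpen U.1)
    {R : CommRingCat.{0}} (φ : Γ(X, U.1) ⟶ R) :
    (Spec.map φ ≫ hU.fromSpec).ker.ideal U ≤ RingHom.ker φ.hom := by
  refine (Scheme.Hom.ideal_ker_le _ U).trans fun s hs => ?_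
  have h := congrArg (fun f => f.hom s) (SpecMap_fromSpec_appLE hU φ)
  simp only [Scheme.Hom.appLE, CommRingCat.hom_comp, RingHom.comp_apply] at h
  rw [RingHom.mem_ker.mp hs, map_zero] at h
  rw [RingHom.mem_ker]
  apply (Scheme.ΓSpecIso R).symm.commRingCatIsoToRingEquiv.injective
  rw [map_zero]
  exact h.symm

/-- When `φ` kills the ideal, the morphism from `Spec R` factors through the closed subscheme of
`I`. -/
theorem le_ker_SpecMap_fromSpec (I : X.IdealSheafData) (U : X.affineOpens) (hU : IsAffineOpen U.1)
    {R : CommRingCat.{0}} (φ : Γ(X, U.1) ⟶ R) (h : I.ideal U ≤ RingHom.ker φ.hom) :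
    I ≤ (Spec.map φ ≫ hU.fromSpec).ker := by
  let ψ : CommRingCat.of (Γ(X, U.1) ⧸ I.ideal U) ⟶ R :=
    CommRingCat.ofHom (Ideal.Quotient.lift (I.ideal U) φ.hom h)
  have e : CommRingCat.ofHom (Ideal.Quotient.mk (I.ideal U)) ≫ ψ = φ := by ext s; rfl
  let c : Spec (CommRingCat.of (Γ(X, U.1) ⧸ I.ideal U)) ⟶ I.subscheme := I.subschemeCover.f U
  have hc : c ≫ I.subschemeι =
      Spec.map (CommRingCat.ofHom (Ideal.Quotient.mk (I.ideal U))) ≫ hU.fromSpec :=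
    (I.subschemeCover_map_subschemeι U).trans (I.glueDataObjι_ι U)
  have e' : Spec.map φ ≫ hU.fromSpec = (Spec.map ψ ≫ c) ≫ I.subschemeι := by
    rw [Category.assoc, hc, ← Category.assoc, ← Spec.map_comp, e]
  rw [e']
  exact I.ker_subschemeι.ge.trans (Scheme.Hom.le_ker_comp _ _)

theorem app_map_eq_zero (f : X ⟶ Y) {U V : Y.Opens} (h : U ≤ V) (s : Γ(Y, V))
    (hs : f.app V s = 0) : f.app U (Y.presheaf.map (homOfLE h).op s) = 0 := by
  have := CategoryTheory.congr_fun (f.naturality (homOfLE h).op) s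
  refine this.trans ?_
  rw [CommRingCat.comp_apply]
  rw [hs, map_zero]

/-- The inverse image of an ideal sheaf on affine open subsets. -/
theorem ideal_comap_eq_map (f : X ⟶ Y) (I : Y.IdealSheafData) (U : X.affineOpens)
    (V : Y.affineOpens) (h : U.1 ≤ f ⁻¹ᵁ V.1) :
    (I.comap f).ideal U = (I.ideal V).map (f.appLE V.1 U.1 h).hom := by
  apply le_antisymm
  · let φ : Γ(X, U.1) ⟶ CommRingCat.of (Γ(X, U.1) ⧸ (I.ideal V).map (f.appLE V.1 U.1 h).hom) :=
      CommRingCat.ofHom (Ideal.Quotient.mk _)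
    have hle : I.comap f ≤ (Spec.map φ ≫ U.2.fromSpec).ker := by
      rw [← Scheme.IdealSheafData.le_map_iff_comap_le, Scheme.IdealSheafData.map_ker,
        Category.assoc, ← IsAffineOpen.SpecMap_appLE_fromSpec f V.2 U.2 h, ← Category.assoc,
        ← Spec.map_comp]
      refine le_ker_SpecMap_fromSpec I V V.2 _ fun s hs => ?_
      exact Ideal.Quotient.eq_zero_iff_mem.mpr (Ideal.mem_map_of_mem _ hs)
    refine (hle U).trans ((ker_SpecMap_fromSpec U.2 φ).trans ?_)
    exact (Ideal.mk_ker).le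
  · rw [Ideal.map_le_iff_le_comap]
    intro s hs
    -- Conversely, sections of `I` pull back to zero on the closed subscheme cut out by the inverse
    -- image ideal.
    have h1 := (I.le_map_comap f) V hs
    have h2 : ((I.comap f).subschemeι.app (f ⁻¹ᵁ V.1)).hom ((f.app V.1).hom s) = 0 := by
      have := RingHom.mem_ker.mp (Scheme.Hom.ideal_ker_le _ V h1)
      rw [Scheme.Hom.comp_app] at this
      exact this
    rw [Ideal.mem_comap]
    have h3 := (I.comap f).ker_subschemeι_app U
    rw [← h3, RingHom.mem_ker]
    have h4 : f.appLE V.1 U.1 h s = X.presheaf.map (homOfLE h).op (f.app V.1 s) := rfl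
    have h5 := app_map_eq_zero (I.comap f).subschemeι h (f.app V.1 s) h2
    exact h5

theorem stalkIdeal_comap (f : X ⟶ Y) (I : Y.IdealSheafData) (x : X) :
    stalkIdeal (I.comap f) x = (stalkIdeal I (f x)).map (f.stalkMap x).hom := by
  obtain ⟨V, hV, -⟩ := exists_affineOpen_le (U := (⊤ : Y.Opens)) (x := f x) trivial
  obtain ⟨U, hU, hUV⟩ := exists_affineOpen_le (U := f ⁻¹ᵁ V.1) (x := x) hV
  rw [stalkIdeal_eq_map _ U hU, stalkIdeal_eq_map _ V hV, ideal_comap_eq_map f I U V hUV,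
    Ideal.map_map, Ideal.map_map, ← CommRingCat.hom_comp, ← CommRingCat.hom_comp]
  congr 2
  rw [Scheme.Hom.germ_stalkMap, Scheme.Hom.appLE, Category.assoc, X.presheaf.germ_res]

end Comap

/-! ### Invertible ideals -/

section Invertible

variable {X Y : Scheme.{0}}

theorem germ_appLE (f : X ⟶ Y) {U : X.Opens} {V : Y.Opens} (h : U ≤ f ⁻¹ᵁ V) {x : X} (hx : x ∈ U)
    (s : Γ(Y, V)) : X.presheaf.germ U x hx (f.appLE V U h s) =
      f.stalkMap x (Y.presheaf.germ V (f x) (show f x ∈ V from h hx) s) := by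
  have hV : f x ∈ V := h hx
  have e : Y.presheaf.germ V (f x) hV ≫ f.stalkMap x =
      f.appLE V U h ≫ X.presheaf.germ U x hx := by
    rw [Scheme.Hom.germ_stalkMap, Scheme.Hom.appLE, Category.assoc, X.presheaf.germ_res]
  exact (CategoryTheory.congr_fun e s).symm

theorem germ_mem_nonZeroDivisors {W : X.Opens} (hW : IsAffineOpen W) {f : Γ(X, W)}
    (hf : f ∈ nonZeroDivisors Γ(X, W)) {x : X} (hx : x ∈ W) :
    X.presheaf.germ W x hx f ∈ nonZeroDivisors (X.presheaf.stalk x) := by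
  let : Algebra Γ(X, W) (X.presheaf.stalk x) := (X.presheaf.germ W x hx).hom.toAlgebra
  have : IsLocalization.AtPrime (X.presheaf.stalk x) (hW.primeIdealOf ⟨x, hx⟩).asIdeal :=
    hW.isLocalization_stalk ⟨x, hx⟩
  exact IsLocalization.nonZeroDivisors_le_comap (hW.primeIdealOf ⟨x, hx⟩).asIdeal.primeCompl
    (X.presheaf.stalk x) hf

theorem section_ext {U : X.Opens} {s t : Γ(X, U)}
    (h : ∀ x (hx : x ∈ U), X.presheaf.germ U x hx s = X.presheaf.germ U x hx t) : s = t :=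
  TopCat.Presheaf.section_ext X.sheaf U s t h

theorem mem_nonZeroDivisors_of_germ {U : X.Opens} {f : Γ(X, U)}
    (h : ∀ x (hx : x ∈ U), X.presheaf.germ U x hx f ∈ nonZeroDivisors (X.presheaf.stalk x)) :
    f ∈ nonZeroDivisors Γ(X, U) := by
  rw [mem_nonZeroDivisors_iff_right]
  intro s hs
  refine section_ext fun x hx => ?_
  rw [map_zero]
  refine (mem_nonZeroDivisors_iff_right.mp (h x hx)) _ ?_
  rw [← map_mul, hs, map_zero]

theorem IsInvertibleIdeal.exists_le {J : X.IdealSheafData} (hJ : IsInvertibleIdeal J) {U : X.Opens}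
    {x : X} (hx : x ∈ U) : ∃ W : X.affineOpens, x ∈ W.1 ∧ W.1 ≤ U ∧
      ∃ f ∈ nonZeroDivisors Γ(X, W.1), J.ideal W = Ideal.span {f} := by
  obtain ⟨W', hxW', f, hf, hJf⟩ := hJ x
  obtain ⟨W, hxW, hW⟩ := exists_affineOpen_le (U := U ⊓ W'.1) (Opens.mem_inf.mpr ⟨hx, hxW'⟩)
  have hWW' : W.1 ≤ W'.1 := hW.trans inf_le_right
  refine ⟨W, hxW, hW.trans inf_le_left, X.presheaf.map (homOfLE hWW').op f,
    mem_nonZeroDivisors_of_germ fun y hy => ?_, ?_⟩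
  · rw [germ_res']
    exact germ_mem_nonZeroDivisors W'.2 hf _
  · rw [← J.map_ideal (show W ≤ W' from hWW'), hJf, Ideal.map_span, Set.image_singleton]
    rfl

theorem IsInvertibleIdeal.exists_stalk {J : X.IdealSheafData} (hJ : IsInvertibleIdeal J) (x : X) :
    ∃ f ∈ nonZeroDivisors (X.presheaf.stalk x), stalkIdeal J x = Ideal.span {f} := by
  obtain ⟨W, hxW, f, hf, hJf⟩ := hJ x
  refine ⟨_, germ_mem_nonZeroDivisors W.2 hf hxW, ?_⟩
  rw [stalkIdeal_eq_map J W hxW, hJf, Ideal.map_span, Set.image_singleton]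

theorem IsInvertibleIdeal.comap {J : X.IdealSheafData} (hJ : IsInvertibleIdeal J) (j : Y ⟶ X)
    [IsOpenImmersion j] : IsInvertibleIdeal (J.comap j) := by
  intro y
  obtain ⟨W, hW, f, hf, hJf⟩ := hJ (j y)
  obtain ⟨U, hU, hUW⟩ := exists_affineOpen_le (U := j ⁻¹ᵁ W.1) (x := y) hW
  refine ⟨U, hU, j.appLE W.1 U.1 hUW f, mem_nonZeroDivisors_of_germ fun z hz => ?_, ?_⟩
  · rw [germ_appLE]
    have h := germ_mem_nonZeroDivisors W.2 hf (hUW hz)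
    rw [← MulEquivClass.map_nonZeroDivisors (asIso (j.stalkMap z)).commRingCatIsoToRingEquiv]
    exact ⟨_, h, rfl⟩
  · rw [ideal_comap_eq_map j J U W hUW, hJf, Ideal.map_span, Set.image_singleton]

theorem isInvertibleIdeal_top : IsInvertibleIdeal (⊤ : X.IdealSheafData) := by
  intro x
  obtain ⟨U, hU, -⟩ := exists_affineOpen_le (U := (⊤ : X.Opens)) (x := x) trivial
  exact ⟨U, hU, 1, one_mem _, by simp⟩

theorem stalkIdeal_eq_top_iff {J : X.IdealSheafData} {x : X} :
    stalkIdeal J x = ⊤ ↔ x ∉ J.support := by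
  obtain ⟨U, hU, -⟩ := exists_affineOpen_le (U := (⊤ : X.Opens)) (x := x) trivial
  rw [Scheme.IdealSheafData.mem_support_iff_of_mem hU, stalkIdeal_eq_map J U hU,
    Scheme.mem_zeroLocus_iff]
  push Not
  constructor
  · intro h
    by_contra hcon
    push Not at hcon
    have : (J.ideal U).map (X.presheaf.germ U.1 x hU).hom ≤ IsLocalRing.maximalIdeal _ := by
      rw [Ideal.map_le_iff_le_comap]
      exact fun s hs => (IsLocalRing.mem_maximalIdeal _).mpr fun hu =>
        hcon s hs ((Scheme.mem_basicOpen X s _ hU).mpr hu)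
    rw [h, top_le_iff] at this
    exact (IsLocalRing.maximalIdeal.isMaximal _).ne_top this
  · rintro ⟨s, hs, h⟩
    exact Ideal.eq_top_of_isUnit_mem _ (Ideal.mem_map_of_mem _ hs)
      ((Scheme.mem_basicOpen X s _ hU).mp h)

theorem support_comap_vanishingIdeal (f : X ⟶ Y) (C : Closeds Y) (x : X) :
    x ∈ ((Scheme.IdealSheafData.vanishingIdeal C).comap f).support ↔ f x ∈ C := by
  rw [Scheme.IdealSheafData.support_comap]
  change f x ∈ ((Scheme.IdealSheafData.vanishingIdeal C).support : Set Y) ↔ _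
  rw [Scheme.IdealSheafData.coe_support_vanishingIdeal]
  rfl

theorem comap_vanishingIdeal_eq_top {f : X ⟶ Y} {C : Closeds Y} (h : ∀ x, f x ∉ C) :
    (Scheme.IdealSheafData.vanishingIdeal C).comap f = ⊤ := by
  rw [← Scheme.IdealSheafData.support_eq_bot_iff, ← SetLike.coe_set_eq]
  exact Set.eq_empty_of_forall_notMem fun x hx => h x ((support_comap_vanishingIdeal f C x).mp hx)

end Invertible

/-! ### Blow-ups away from the center, and integrality -/

section BlowUp

variable {X X' : Scheme.{0}} {η : X' ⟶ X} {Z : Closeds X}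

theorem IsBlowUp.hom_ext {I : X.IdealSheafData} (hη : IsBlowUp η I) {T : Scheme.{0}}
    {g₁ g₂ : T ⟶ X'} (h : IsInvertibleIdeal (I.comap (g₁ ≫ η))) (e : g₁ ≫ η = g₂ ≫ η) : g₁ = g₂ :=
  (hη.existsUnique_lift T _ h).unique rfl e.symm

/-- The complement of a closed subset. -/
def complOpens (Z : Closeds X) : X.Opens := ⟨(Z : Set X)ᶜ, Z.isClosed.isOpen_compl⟩

/-- Off `Z` the ideal is the unit ideal, hence invertible. The universal property supplies a section
over the complement, and its uniqueness clause makes that section a two-sided inverse. -/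
theorem IsBlowUp.isIso_restrict (hη : IsBlowUp η (Scheme.IdealSheafData.vanishingIdeal Z)) :
    IsIso (η ∣_ complOpens Z) := by
  set U := complOpens Z
  have h1 : IsInvertibleIdeal ((Scheme.IdealSheafData.vanishingIdeal Z).comap U.ι) := by
    rw [comap_vanishingIdeal_eq_top (f := U.ι) fun x => x.2]
    exact isInvertibleIdeal_top
  have h2 : IsInvertibleIdeal
      ((Scheme.IdealSheafData.vanishingIdeal Z).comap ((η ⁻¹ᵁ U).ι ≫ η)) := by
    rw [comap_vanishingIdeal_eq_top (fun x => ?_)]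
    · exact isInvertibleIdeal_top
    · rw [Scheme.Hom.comp_apply]
      exact x.2
  obtain ⟨g, hg, -⟩ := hη.existsUnique_lift _ U.ι h1
  have hr : Set.range g ⊆ Set.range (η ⁻¹ᵁ U).ι := by
    rintro _ ⟨x, rfl⟩
    rw [Scheme.Opens.range_ι]
    change η (g x) ∈ U
    rw [← Scheme.Hom.comp_apply, hg]
    exact x.2
  let g' : U.toScheme ⟶ (η ⁻¹ᵁ U).toScheme := IsOpenImmersion.lift (η ⁻¹ᵁ U).ι g hr
  have hg' : g' ≫ (η ⁻¹ᵁ U).ι = g := IsOpenImmersion.lift_fac _ _ _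
  refine ⟨g', ?_, ?_⟩
  · rw [← cancel_mono (η ⁻¹ᵁ U).ι, Category.assoc, hg', Category.id_comp]
    refine (hη.hom_ext h2 ?_).symm
    rw [Category.assoc, hg, morphismRestrict_ι]
  · rw [← cancel_mono U.ι, Category.assoc, morphismRestrict_ι, ← Category.assoc, hg', hg,
      Category.id_comp]

theorem isIso_stalkMap_of_restrict (U : X.Opens) [IsIso (η ∣_ U)] {x : X'} (hx : η x ∈ U) :
    IsIso (η.stalkMap x) := by
  have key (x : (η ⁻¹ᵁ U).toScheme) : IsIso ((η ∣_ U).stalkMap x) := inferInstance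
  exact ((MorphismProperty.isomorphisms CommRingCat).arrow_mk_iso_iff
    (morphismRestrictStalkMap η U ⟨x, hx⟩)).mp (key _)

theorem isDomain_section [IsIntegral X] (U : X.Opens) [IsIso (η ∣_ U)] {W : X'.Opens}
    (hW : W ≤ η ⁻¹ᵁ U) [Nonempty W] : IsDomain Γ(X', W) := by
  have : Nonempty W.toScheme := ‹Nonempty W›
  have : IsIntegral W.toScheme :=
    isIntegral_of_isOpenImmersion (X'.homOfLE hW ≫ (η ∣_ U) ≫ U.ι)
  exact (W.topIso.commRingCatIsoToRingEquiv).symm.toMulEquiv.isDomain _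

/-- The inverse image ideal is locally generated by a nonzerodivisor, so restriction of sections to
the complement of the exceptional locus is injective. That complement is isomorphic to an open
subset of `X`, hence integral. -/
theorem IsBlowUp.isIntegral [IsIntegral X]
    (hη : IsBlowUp η (Scheme.IdealSheafData.vanishingIdeal Z)) (hZ : ∃ x, x ∉ Z) :
    IsIntegral X' := by
  have := hη.isIso_restrict
  set U := complOpens Z
  have inj : ∀ (W : X'.Opens) (s : Γ(X', W)),
      X'.presheaf.map (homOfLE (inf_le_left : W ⊓ η ⁻¹ᵁ U ≤ W)).op s = 0 → s = 0 := by
    intro W s hs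
    refine section_ext fun x hx => ?_
    rw [map_zero]
    obtain ⟨V, hxV, hVW, f, hf, hJf⟩ := hη.isInvertible.exists_le hx
    -- Where `f` is invertible the inverse image ideal is trivial, so the image point is off `Z`.
    have hVf : X'.basicOpen f ≤ W ⊓ η ⁻¹ᵁ U := by
      intro y hy
      have hyV : y ∈ V.1 := X'.basicOpen_le f hy
      refine Opens.mem_inf.mpr ⟨hVW hyV, fun hyZ => ?_⟩
      refine (support_comap_vanishingIdeal η Z y).not.mp (stalkIdeal_eq_top_iff.mp ?_) hyZ
      rw [stalkIdeal_eq_map _ V hyV, hJf]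
      exact Ideal.eq_top_of_isUnit_mem _ (Ideal.mem_map_of_mem _ (Ideal.mem_span_singleton_self f))
        ((Scheme.mem_basicOpen X' f _ hyV).mp hy)
    obtain ⟨n, hn⟩ := exists_pow_mul_eq_zero_of_res_basicOpen_eq_zero_of_isCompact X'
      V.2.isCompact (X'.presheaf.map (homOfLE hVW).op s) f (by
        refine section_ext fun y hy => ?_
        have := congrArg (X'.presheaf.germ _ y (hVf hy)) hs
        rw [germ_res', map_zero] at this
        rw [map_zero, ← this]
        simp only [TopCat.Presheaf.restrictOpen, TopCat.Presheaf.restrict]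
        rw [TopCat.Presheaf.germ_res_apply, germ_res'])
    have := (mem_nonZeroDivisors_iff.mp (pow_mem hf n)).1 _ hn
    rw [← germ_res' hVW hxV, this, map_zero]
  -- A nonempty open set inside the exceptional locus would satisfy `1 = 0` by the injectivity just
  -- shown.
  have hne : ∀ W : X'.Opens, Nonempty W → Nonempty (W ⊓ η ⁻¹ᵁ U : X'.Opens) := by
    rintro W ⟨x, hx⟩
    by_contra hcon
    have hbot : W ⊓ η ⁻¹ᵁ U = ⊥ := by
      ext y
      simp only [Opens.coe_bot, Set.mem_empty_iff_false, iff_false]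
      exact fun hy => hcon ⟨⟨y, hy⟩⟩
    have h1 : (1 : Γ(X', W)) = 0 := by
      apply inj
      have : Subsingleton Γ(X', W ⊓ η ⁻¹ᵁ U) := by rw [hbot]; infer_instance
      exact Subsingleton.elim _ _
    have := congrArg (X'.presheaf.germ W x hx) h1
    rw [map_one, map_zero] at this
    exact one_ne_zero this
  obtain ⟨x, hx⟩ := hZ
  refine ⟨⟨(inv (η ∣_ U) ⟨x, hx⟩).1⟩, fun W hW => ?_⟩
  have := hne W hW
  have := isDomain_section (η := η) U (W := W ⊓ η ⁻¹ᵁ U) inf_le_right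
  exact Function.Injective.isDomain (X'.presheaf.map (homOfLE inf_le_left).op).hom
    ((injective_iff_map_eq_zero _).mpr (inj W))

end BlowUp

/-! ### Gluing rational functions that are regular at every point of an open set. -/

section Sections

variable {X : Scheme.{0}} [IsIntegral X]

theorem algebraMap_stalk_injective (x : X) :
    Function.Injective (algebraMap (X.presheaf.stalk x) X.functionField) :=
  IsFractionRing.injective _ _

/-- A rational function that is regular at every point of an open set is given by a section. -/
theorem exists_section_of_forall_mem_range (U : X.Opens) (c : X.functionField)
    (h : ∀ x ∈ U, ∃ a : X.presheaf.stalk x, c = algebraMap _ X.functionField a) :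
    ∃ s : Γ(X, U), ∀ x (hx : x ∈ U),
      algebraMap (X.presheaf.stalk x) X.functionField (X.presheaf.germ U x hx s) = c := by
  have key : ∀ x : U, ∃ (V : X.Opens) (hx : x.1 ∈ V) (_ : V ≤ U) (s : Γ(X, V)),
      algebraMap (X.presheaf.stalk x.1) X.functionField (X.presheaf.germ V x.1 hx s) = c := by
    intro x
    obtain ⟨a, ha⟩ := h x.1 x.2
    obtain ⟨V, hV, s, rfl⟩ := X.presheaf.exists_germ_eq a
    exact ⟨V ⊓ U, Opens.mem_inf.mpr ⟨hV, x.2⟩, inf_le_right,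
      X.presheaf.map (homOfLE inf_le_left).op s, by rw [germ_res', ha]⟩
  choose V hxV hVU s hs using key
  have hsy : ∀ (i : U) (y : X) (hy : y ∈ V i),
      algebraMap (X.presheaf.stalk y) X.functionField (X.presheaf.germ (V i) y hy (s i)) = c :=
    fun i y hy => (algebraMap_germ_eq hy (hxV i) (s i)).trans (hs i)
  have hcomp : TopCat.Presheaf.IsCompatible X.sheaf.obj V s := by
    intro i j
    refine section_ext fun y hy => algebraMap_stalk_injective y ?_
    have h1 := TopCat.Presheaf.germ_res_apply X.presheaf (Opens.infLELeft (V i) (V j)) y hy (s i)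
    have h2 := TopCat.Presheaf.germ_res_apply X.presheaf (Opens.infLERight (V i) (V j)) y hy (s j)
    exact ((congrArg _ h1).trans (hsy i y hy.1)).trans ((congrArg _ h2).trans (hsy j y hy.2)).symm
  obtain ⟨t, ht⟩ : ∃ t : Γ(X, iSup V), TopCat.Presheaf.IsGluing X.sheaf.obj V s t :=
    (TopCat.Sheaf.existsUnique_gluing X.sheaf V s hcomp).exists
  have hU : U ≤ iSup V := fun x hx => Opens.mem_iSup.mpr ⟨⟨x, hx⟩, hxV ⟨x, hx⟩⟩
  refine ⟨X.presheaf.map (homOfLE hU).op t, fun x hx => ?_⟩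
  rw [germ_res', ← hs ⟨x, hx⟩, ← ht ⟨x, hx⟩]
  congr 1
  exact (TopCat.Presheaf.germ_res_apply X.presheaf (Opens.leSupr V ⟨x, hx⟩) x _ t).symm

end Sections

/-! ### The affine charts of a blow-up, derived from the universal property. -/

section Chart

variable {X X' : Scheme.{0}} {η : X' ⟶ X}

theorem germ_app (f : X' ⟶ X) {V : X.Opens} {x : X'} (hx : x ∈ f ⁻¹ᵁ V) (s : Γ(X, V)) :
    X'.presheaf.germ (f ⁻¹ᵁ V) x hx (f.app V s) =
      f.stalkMap x (X.presheaf.germ V (f x) (show f x ∈ V from hx) s) := by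
  rw [← germ_appLE f le_rfl hx, Scheme.Hom.app_eq_appLE]

theorem stalkIdeal_comap_of_span {I : X.IdealSheafData} {V : X.affineOpens} {x y : Γ(X, V.1)}
    (hI : I.ideal V = Ideal.span {x, y}) {x' : X'} (hx' : x' ∈ η ⁻¹ᵁ V.1) :
    stalkIdeal (I.comap η) x' = Ideal.span {X'.presheaf.germ (η ⁻¹ᵁ V.1) x' hx' (η.app V.1 x),
      X'.presheaf.germ (η ⁻¹ᵁ V.1) x' hx' (η.app V.1 y)} := by
  have hV : η x' ∈ V.1 := hx'
  rw [stalkIdeal_comap, stalkIdeal_eq_map I V hV, hI, Ideal.map_span, Ideal.map_span,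
    Set.image_pair, Set.image_pair, germ_app, germ_app]

/-- The open subset of the blow-up of an ideal `(x, y)` where `x` divides `y`. -/
def chartOpen (η : X' ⟶ X) {V : X.Opens} (x y : Γ(X, V)) : X'.Opens where
  carrier := {x' | ∃ hx' : x' ∈ η ⁻¹ᵁ V, X'.presheaf.germ (η ⁻¹ᵁ V) x' hx' (η.app V y) ∈
    Ideal.span {X'.presheaf.germ (η ⁻¹ᵁ V) x' hx' (η.app V x)}}
  is_open' := by
    rw [isOpen_iff_forall_mem_open]
    rintro x' ⟨hx', h⟩
    obtain ⟨W, hW, hWV, h⟩ := exists_mem_span_germ hx' _ _ h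
    exact ⟨W, fun y' hy' => ⟨hWV hy', h y' hy' _⟩, W.isOpen, hW⟩

theorem chartOpen_le (η : X' ⟶ X) {V : X.Opens} (x y : Γ(X, V)) : chartOpen η x y ≤ η ⁻¹ᵁ V :=
  fun _ h => h.1

theorem mem_chartOpen {V : X.Opens} {x y : Γ(X, V)} {x' : X'} (hx' : x' ∈ η ⁻¹ᵁ V) :
    x' ∈ chartOpen η x y ↔ X'.presheaf.germ (η ⁻¹ᵁ V) x' hx' (η.app V y) ∈
      Ideal.span {X'.presheaf.germ (η ⁻¹ᵁ V) x' hx' (η.app V x)} :=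
  ⟨fun h => h.2, fun h => ⟨hx', h⟩⟩

variable {I : X.IdealSheafData} {V : X.affineOpens} {x y : Γ(X, V.1)}

/-- The stalk of the inverse image ideal is generated by a nonzerodivisor `f`. With `a = c f`, `b =
d f` and `f = r a + s b`, cancellation gives `r c + s d = 1`, so `c` or `d` is a unit of the local
ring. -/
theorem mem_chartOpen_or (hη : IsInvertibleIdeal (I.comap η))
    (hI : I.ideal V = Ideal.span {x, y}) {x' : X'} (hx' : x' ∈ η ⁻¹ᵁ V.1) :
    x' ∈ chartOpen η x y ∨ x' ∈ chartOpen η y x := by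
  obtain ⟨f, hf, hJ⟩ := hη.exists_stalk x'
  rw [stalkIdeal_comap_of_span hI hx'] at hJ
  rw [mem_chartOpen hx', mem_chartOpen hx']
  set a := X'.presheaf.germ (η ⁻¹ᵁ V.1) x' hx' (η.app V.1 x)
  set b := X'.presheaf.germ (η ⁻¹ᵁ V.1) x' hx' (η.app V.1 y)
  obtain ⟨c, hc⟩ := Ideal.mem_span_singleton'.mp (hJ ▸ Ideal.subset_span (by simp) :
    a ∈ Ideal.span {f})
  obtain ⟨d, hd⟩ := Ideal.mem_span_singleton'.mp (hJ ▸ Ideal.subset_span (by simp) :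
    b ∈ Ideal.span {f})
  obtain ⟨r, s, hrs⟩ := Ideal.mem_span_pair.mp
    (hJ ▸ Ideal.mem_span_singleton_self f : f ∈ Ideal.span {a, b})
  have h1 : r * c + s * d = 1 := by
    have : (r * c + s * d - 1) * f = 0 := by
      rw [← hc, ← hd] at hrs; linear_combination hrs
    exact sub_eq_zero.mp ((mem_nonZeroDivisors_iff.mp hf).2 _ this)
  rcases IsLocalRing.isUnit_or_isUnit_of_add_one h1 with h | h
  · left
    obtain ⟨u, hu⟩ := isUnit_of_mul_isUnit_right h
    refine Ideal.mem_span_singleton'.mpr ⟨d * ↑u⁻¹, ?_⟩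
    rw [← hc, ← hd, ← hu]
    linear_combination d * f * u.inv_mul
  · right
    obtain ⟨u, hu⟩ := isUnit_of_mul_isUnit_right h
    refine Ideal.mem_span_singleton'.mpr ⟨c * ↑u⁻¹, ?_⟩
    rw [← hc, ← hd, ← hu]
    linear_combination c * f * u.inv_mul

theorem germ_ne_zero_of_mem_chartOpen (hη : IsInvertibleIdeal (I.comap η))
    (hI : I.ideal V = Ideal.span {x, y}) {x' : X'} (hx' : x' ∈ chartOpen η x y) :
    X'.presheaf.germ (η ⁻¹ᵁ V.1) x' (chartOpen_le η x y hx') (η.app V.1 x) ≠ 0 := by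
  intro h0
  obtain ⟨f, hf, hJ⟩ := hη.exists_stalk x'
  rw [stalkIdeal_comap_of_span hI (chartOpen_le η x y hx')] at hJ
  have h1 := hx'.2
  rw [h0] at hJ h1
  rw [Ideal.mem_span_singleton, zero_dvd_iff] at h1
  rw [h1] at hJ
  have : f ∈ Ideal.span {0, 0} := hJ ▸ Ideal.mem_span_singleton_self f
  simp only [Set.pair_eq_singleton, Ideal.mem_span_singleton, zero_dvd_iff] at this
  exact nonZeroDivisors.ne_zero hf this

theorem stalkIdeal_comap_of_mem_chartOpen 
    (hI : I.ideal V = Ideal.span {x, y}) {x' : X'} (hx' : x' ∈ chartOpen η x y) :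
    stalkIdeal (I.comap η) x' = Ideal.span
      {X'.presheaf.germ (η ⁻¹ᵁ V.1) x' (chartOpen_le η x y hx') (η.app V.1 x)} := by
  rw [stalkIdeal_comap_of_span hI (chartOpen_le η x y hx'), Ideal.span_pair_comm]
  apply le_antisymm
  · rw [Ideal.span_le]
    rintro _ (rfl | rfl)
    · exact hx'.2
    · exact Ideal.mem_span_singleton_self _
  · exact Ideal.span_mono (by simp)

/-- The rational function `y / x` is regular at every point where `x` divides `y`, so it is given by
a section. -/
theorem exists_mul_eq_on_chartOpen [IsIntegral X'] (hη : IsInvertibleIdeal (I.comap η))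
    (hI : I.ideal V = Ideal.span {x, y}) : ∃ τ : Γ(X', chartOpen η x y),
    η.appLE V.1 _ (chartOpen_le η x y) x * τ = η.appLE V.1 _ (chartOpen_le η x y) y := by
  by_cases hne : ∃ x', x' ∈ chartOpen η x y
  · obtain ⟨ξ, hmem⟩ := hne
    set a := algebraMap _ X'.functionField
      (X'.presheaf.germ (η ⁻¹ᵁ V.1) ξ (chartOpen_le η x y hmem) (η.app V.1 x)) with ha
    set b := algebraMap _ X'.functionField
      (X'.presheaf.germ (η ⁻¹ᵁ V.1) ξ (chartOpen_le η x y hmem) (η.app V.1 y)) with hb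
    have ha0 : a ≠ 0 := fun h => germ_ne_zero_of_mem_chartOpen hη hI hmem
      (algebraMap_stalk_injective ξ (by rw [map_zero]; exact h))
    obtain ⟨τ, hτ⟩ := exists_section_of_forall_mem_range (chartOpen η x y) (b / a) (by
      intro x' hx'
      obtain ⟨c, hc⟩ := Ideal.mem_span_singleton'.mp hx'.2
      refine ⟨c, (div_eq_iff ha0).mpr ?_⟩
      rw [ha, hb, algebraMap_germ_eq (chartOpen_le η x y hmem) hx'.1 (η.app V.1 y),
        algebraMap_germ_eq (chartOpen_le η x y hmem) hx'.1 (η.app V.1 x), ← map_mul, hc])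
    refine ⟨τ, section_ext fun x' hx' => algebraMap_stalk_injective x' ?_⟩
    rw [map_mul, map_mul, hτ, germ_appLE, germ_appLE, ← germ_app η hx'.1, ← germ_app η hx'.1,
      algebraMap_germ_eq (chartOpen_le η x y hx') (chartOpen_le η x y hmem),
      algebraMap_germ_eq (chartOpen_le η x y hx') (chartOpen_le η x y hmem)]
    exact mul_div_cancel₀ _ ha0
  · exact ⟨0, section_ext fun x' hx' => absurd ⟨x', hx'⟩ hne⟩

open Polynomial in
/-- The chart of the blow-up of an ideal generated by a regular sequence. -/
theorem IsBlowUp.bijective_chart [IsDomain Γ(X, V.1)] (hη : IsBlowUp η I)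
    (hI : I.ideal V = Ideal.span {x, y}) (hx : x ≠ 0) (h : ∀ a b, y * a = x * b → x ∣ a)
    {U : X'.Opens} (hU : chartOpen η x y ≤ U) (hle : U ≤ η ⁻¹ᵁ V.1) (τ : Γ(X', U))
    (hτ : (η.appLE V.1 U hle).hom x * τ = (η.appLE V.1 U hle).hom y) :
    IsAffineOpen U ∧ Function.Bijective (AdjoinRoot.lift
      (η.appLE V.1 U hle).hom τ (by simpa [sub_eq_zero] using hτ) :
        BlowUpChart x y →+* Γ(X', U)) := by
  have hV : IsAffineOpen V.1 := V.2
  let B := CommRingCat.of (BlowUpChart x y)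
  let ι : Γ(X, V.1) ⟶ B := CommRingCat.ofHom (AdjoinRoot.of _)
  have hr : (C x * Polynomial.X - C y).eval₂ (η.appLE V.1 U hle).hom τ = 0 := by
    simpa [sub_eq_zero] using hτ
  let ψ : B ⟶ Γ(X', U) := CommRingCat.ofHom (AdjoinRoot.lift (η.appLE V.1 U hle).hom τ hr)
  have hψof : ∀ a, ψ.hom (AdjoinRoot.of _ a) = (η.appLE V.1 U hle).hom a :=
    fun a => AdjoinRoot.lift_of hr
  have hψroot : ψ.hom (AdjoinRoot.root _) = τ := AdjoinRoot.lift_root hr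
  have hdom : IsDomain B := BlowUpChart.isDomain hx h
  have hιx : ι.hom x ≠ 0 := fun h0 => hx (BlowUpChart.of_injective (y := y) hx (by
    rw [map_zero]; exact h0))
  have hιy : ι.hom x * AdjoinRoot.root _ = ι.hom y := BlowUpChart.of_mul_root
  have hψι : ι ≫ ψ = η.appLE V.1 U hle := by
    ext a
    exact hψof a
  let q : Spec B ⟶ X := Spec.map ι ≫ hV.fromSpec
  have hqV : ⊤ ≤ q ⁻¹ᵁ V.1 := le_preimage_SpecMap_fromSpec hV ι
  have hqapp : q.appLE V.1 ⊤ hqV = ι ≫ (Scheme.ΓSpecIso B).inv := SpecMap_fromSpec_appLE hV ι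
  have hnzd : (Scheme.ΓSpecIso B).inv.hom (ι.hom x) ∈ nonZeroDivisors Γ(Spec B, ⊤) := by
    rw [← MulEquivClass.map_nonZeroDivisors (Scheme.ΓSpecIso B).symm.commRingCatIsoToRingEquiv]
    exact ⟨_, mem_nonZeroDivisors_of_ne_zero hιx, rfl⟩
  -- In `A[y/x]` the extended ideal is generated by the nonzerodivisor `x`, so `Spec B` maps to the
  -- blow-up.
  have hq : IsInvertibleIdeal (I.comap q) := by
    intro z
    refine ⟨⟨⊤, isAffineOpen_top _⟩, trivial, (Scheme.ΓSpecIso B).inv.hom (ι.hom x), hnzd, ?_⟩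
    rw [ideal_comap_eq_map q I ⟨⊤, isAffineOpen_top _⟩ V hqV, hI, hqapp, Ideal.map_span,
      Set.image_pair]
    refine le_antisymm (Ideal.span_le.mpr ?_) (Ideal.span_mono (by
      rintro _ rfl; exact Set.mem_insert _ _))
    rintro _ (rfl | rfl)
    · exact Ideal.mem_span_singleton_self _
    · refine Ideal.mem_span_singleton.mpr ⟨(Scheme.ΓSpecIso B).inv.hom (AdjoinRoot.root _), ?_⟩
      rw [← map_mul, hιy]
      rfl
  obtain ⟨g, hg, -⟩ := hη.existsUnique_lift _ q hq
  have hgapp : ∀ (h' : ⊤ ≤ (g ≫ η) ⁻¹ᵁ V.1) a, (g ≫ η).appLE V.1 ⊤ h' a =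
      (Scheme.ΓSpecIso B).inv.hom (ι.hom a) := by
    rw [hg]
    intro h' a
    exact congrArg (fun f => f.hom a) hqapp
  have hgV' : ⊤ ≤ (g ≫ η) ⁻¹ᵁ V.1 := by rw [hg]; exact hqV
  have hgV : ∀ z, g z ∈ η ⁻¹ᵁ V.1 := fun z => hgV' (show z ∈ ⊤ from trivial)
  have hgerm : ∀ z a, g.stalkMap z (X'.presheaf.germ (η ⁻¹ᵁ V.1) (g z) (hgV z) (η.app V.1 a)) =
      (Spec B).presheaf.germ ⊤ z (Opens.mem_top z) ((Scheme.ΓSpecIso B).inv.hom (ι.hom a)) := by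
    intro z a
    rw [← hgapp hgV', germ_appLE, germ_app, Scheme.Hom.stalkMap_comp]
    rfl
  -- The lift lands in the chart. At a point where `x = e y`, pulling back gives `x = e (y/x) x`;
  -- cancelling `x` makes the pull-back of `e` a unit. Stalk maps are local, so `e` is a unit and
  -- `x` divides `y` as well.
  have hgU : Set.range g ⊆ Set.range U.ι := by
    rw [Scheme.Opens.range_ι]
    rintro _ ⟨z, rfl⟩
    apply hU
    rcases mem_chartOpen_or hη.isInvertible hI (hgV z) with h1 | h1
    · exact h1
    · rw [mem_chartOpen (hgV z)] at h1 ⊢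
      obtain ⟨e, he⟩ := Ideal.mem_span_singleton'.mp h1
      have he' := congrArg (g.stalkMap z) he
      rw [map_mul, hgerm, hgerm, ← hιy, map_mul, map_mul] at he'
      set a := (Spec B).presheaf.germ ⊤ z (Opens.mem_top z)
          ((Scheme.ΓSpecIso B).inv.hom (ι.hom x)) with ha
      have hanz := germ_mem_nonZeroDivisors (isAffineOpen_top _) hnzd (Opens.mem_top z)
      have hunit : IsUnit (g.stalkMap z e) := by
        refine IsUnit.of_mul_eq_one ((Spec B).presheaf.germ ⊤ z (Opens.mem_top z)
          ((Scheme.ΓSpecIso B).inv.hom (AdjoinRoot.root _))) ?_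
        refine sub_eq_zero.mp ((mem_nonZeroDivisors_iff.mp hanz).2 _ ?_)
        rw [← ha]
        linear_combination he'
      obtain ⟨u, rfl⟩ := isUnit_of_map_unit (g.stalkMap z).hom e hunit
      exact Ideal.mem_span_singleton'.mpr ⟨↑u⁻¹, by rw [← he, u.inv_mul_cancel_left]⟩
  let g' : Spec B ⟶ U := IsOpenImmersion.lift U.ι g hgU
  have hg' : g' ≫ U.ι = g := IsOpenImmersion.lift_fac _ _ _
  let k : U.toScheme ⟶ Spec B := U.toSpecΓ ≫ Spec.map ψ
  have hkq : k ≫ q = U.ι ≫ η := by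
    simp only [k, q, Category.assoc]
    rw [← Category.assoc (Spec.map ψ), ← Spec.map_comp, hψι, ← Category.assoc,
      Scheme.Opens.toSpecΓ_SpecMap_appLE, Category.assoc, IsAffineOpen.toSpecΓ_fromSpec,
      Scheme.Hom.resLE_comp_ι]
  -- Both sides agree after `η`, and uniqueness of lifts to the blow-up identifies them.
  have hkg : k ≫ g = U.ι := by
    refine hη.hom_ext ?_ ?_
    · rw [Category.assoc, hg, hkq, Scheme.IdealSheafData.comap_comp]
      exact hη.isInvertible.comap _
    · rw [Category.assoc, hg, hkq]
  obtain ⟨θ, hθ⟩ : ∃ θ : Γ(X', U) ⟶ B, Spec.map θ = g' ≫ U.toSpecΓ :=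
    ⟨Spec.preimage _, Spec.map_preimage _⟩
  have hθι : η.appLE V.1 U hle ≫ θ = ι := by
    apply Spec.map_injective
    rw [← cancel_mono hV.fromSpec, Spec.map_comp, hθ]
    simp only [Category.assoc]
    rw [← Category.assoc U.toSpecΓ, Scheme.Opens.toSpecΓ_SpecMap_appLE, Category.assoc,
      IsAffineOpen.toSpecΓ_fromSpec, Scheme.Hom.resLE_comp_ι, ← Category.assoc, hg', hg]
  have hθι' : ∀ a, θ.hom ((η.appLE V.1 U hle).hom a) = ι.hom a :=
    fun a => congrArg (fun f => f.hom a) hθι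
  -- The relation `x τ = y` determines `τ`, because `x` can be cancelled in the domain `B`.
  have hθτ : θ.hom τ = AdjoinRoot.root _ := by
    refine mul_left_cancel₀ hιx ?_
    rw [hιy, ← hθι', ← hθι', ← hτ, map_mul]
  have hψθ : ψ ≫ θ = 𝟙 B := by
    apply CommRingCat.hom_ext
    refine AdjoinRoot.ringHom_ext (RingHom.ext fun a => ?_) ?_
    · change θ.hom (ψ.hom (AdjoinRoot.of _ a)) = _
      rw [hψof, hθι']; rfl
    · change θ.hom (ψ.hom (AdjoinRoot.root _)) = _
      rw [hψroot, hθτ]; rfl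
  have hkg' : k ≫ g' = 𝟙 _ := by
    rw [← cancel_mono U.ι, Category.assoc, hg', hkg, Category.id_comp]
  have hg'k : g' ≫ k = 𝟙 _ := by
    simp only [k]
    rw [← Category.assoc, ← hθ, ← Spec.map_comp, hψθ, Spec.map_id]
  have : IsIso k := ⟨g', hkg', hg'k⟩
  have hUaff : IsAffineOpen U := IsAffine.of_isIso k
  refine ⟨hUaff, ?_⟩
  have : IsIso U.toSpecΓ := inferInstanceAs (IsIso hUaff.isoSpec.hom)
  have : IsIso (Spec.map ψ) := IsIso.of_isIso_comp_left U.toSpecΓ (Spec.map ψ)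
  have : IsIso (Scheme.Spec.map ψ.op) := this
  have : IsIso ψ.op := isIso_of_reflects_iso ψ.op Scheme.Spec
  have : IsIso ψ := (isIso_op_iff ψ).mp this
  exact ConcreteCategory.bijective_of_isIso ψ

end Chart

/-! ### Rational functions and forms under birational morphisms -/

section RatOf

variable {X : Scheme.{0}} [IsIntegral X]

/-- The rational function given by a section. -/
def ratOf {U : X.Opens} {x : X} (hx : x ∈ U) : Γ(X, U) →+* X.functionField :=
  (algebraMap (X.presheaf.stalk x) X.functionField).comp (X.presheaf.germ U x hx).hom

theorem ratOf_apply {U : X.Opens} {x : X} (hx : x ∈ U) (s : Γ(X, U)) :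
    ratOf hx s = algebraMap (X.presheaf.stalk x) X.functionField (X.presheaf.germ U x hx s) := rfl

theorem ratOf_eq {U : X.Opens} {x y : X} (hx : x ∈ U) (hy : y ∈ U) (s : Γ(X, U)) :
    ratOf hx s = ratOf hy s := algebraMap_germ_eq hx hy s

theorem ratOf_injective {U : X.Opens} {x : X} (hx : x ∈ U) :
    Function.Injective (ratOf (X := X) hx) := by
  intro s t h
  refine section_ext fun y hy => algebraMap_stalk_injective y ?_
  rw [← ratOf_apply, ← ratOf_apply, ratOf_eq hy hx, h, ratOf_eq hx hy]

theorem ratOf_map {U V : X.Opens} (h : V ≤ U) {x : X} (hx : x ∈ V) (s : Γ(X, U)) :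
    ratOf hx (X.presheaf.map (homOfLE h).op s) = ratOf (h hx) s := by
  rw [ratOf_apply, germ_res']; rfl

end RatOf

/-! ### Functoriality of differentials for isomorphisms of algebras. -/

section KaehlerMap

open KaehlerDifferential

variable {R K K' : Type*} [CommRing R] [CommRing K] [CommRing K'] [Algebra R K] [Algebra R K']

/-- The additive map on differentials induced by a homomorphism of algebras. -/
def kaehlerMap (φ : K →ₐ[R] K') : Ω[K⁄R] →+ Ω[K'⁄R] :=
  letI := φ.toRingHom.toAlgebra
  haveI : IsScalarTower R K K' := IsScalarTower.of_algebraMap_eq fun r => (φ.commutes r).symm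
  (KaehlerDifferential.map R R K K').toAddMonoidHom

theorem kaehlerMap_D (φ : K →ₐ[R] K') (a : K) : kaehlerMap φ (D R K a) = D R K' (φ a) :=
  letI := φ.toRingHom.toAlgebra
  haveI : IsScalarTower R K K' := IsScalarTower.of_algebraMap_eq fun r => (φ.commutes r).symm
  KaehlerDifferential.map_D R R K K' a

theorem kaehlerMap_smul (φ : K →ₐ[R] K') (a : K) (ω : Ω[K⁄R]) :
    kaehlerMap φ (a • ω) = φ a • kaehlerMap φ ω :=
  letI := φ.toRingHom.toAlgebra
  haveI : IsScalarTower R K K' := IsScalarTower.of_algebraMap_eq fun r => (φ.commutes r).symm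
  (KaehlerDifferential.map R R K K').map_smul a ω

theorem kaehlerMap_kaehlerMap (φ : K →ₐ[R] K') (ψ : K' →ₐ[R] K) (h : ∀ a, ψ (φ a) = a)
    (ω : Ω[K⁄R]) : kaehlerMap ψ (kaehlerMap φ ω) = ω := by
  induction (span_range_derivation R K).ge (Submodule.mem_top (x := ω))
    using Submodule.span_induction with
  | mem ω h' => obtain ⟨a, rfl⟩ := h'; rw [kaehlerMap_D, kaehlerMap_D, h]
  | zero => simp
  | add ω ω' _ _ h₁ h₂ => rw [map_add, map_add, h₁, h₂]
  | smul a ω _ h' => rw [kaehlerMap_smul, kaehlerMap_smul, h, h']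

/-- The additive isomorphism of differentials induced by an isomorphism of algebras. -/
def kaehlerEquiv (φ : K ≃ₐ[R] K') : Ω[K⁄R] ≃+ Ω[K'⁄R] :=
  { kaehlerMap φ.toAlgHom with
    invFun := kaehlerMap φ.symm.toAlgHom
    left_inv := kaehlerMap_kaehlerMap _ _ φ.symm_apply_apply
    right_inv := kaehlerMap_kaehlerMap _ _ φ.apply_symm_apply }

end KaehlerMap

/-! ### Function fields and rational forms under a birational morphism. -/

section Transport

variable {X X' : Scheme.{0}} [IsIntegral X] [IsIntegral X'] (η : X' ⟶ X)

/-- The isomorphism of function fields given by a birational morphism. -/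
def fieldEquiv [IsIso (η.stalkMap (genericPoint X'))] : X.functionField ≃+* X'.functionField :=
  IsFractionRing.ringEquivOfRingEquiv (A := X.presheaf.stalk (η (genericPoint X')))
    (B := X'.presheaf.stalk (genericPoint X'))
    (asIso (η.stalkMap (genericPoint X'))).commRingCatIsoToRingEquiv

variable [IsIso (η.stalkMap (genericPoint X'))]

theorem fieldEquiv_algebraMap (y : X') (a : X.presheaf.stalk (η y)) :
    fieldEquiv η (algebraMap _ _ a) = algebraMap (X'.presheaf.stalk y) _ (η.stalkMap y a) := by
  obtain ⟨V, hV, s, rfl⟩ := X.presheaf.exists_germ_eq a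
  have hy : y ∈ η ⁻¹ᵁ V := hV
  have hg : genericPoint X' ∈ η ⁻¹ᵁ V := genericPoint_mem ⟨y, hy⟩
  have hg' : η (genericPoint X') ∈ V := hg
  rw [← germ_app η hy, algebraMap_germ_eq hy hg, algebraMap_germ_eq hV hg', germ_app]
  rw [algebraMap_genericPoint]
  exact IsFractionRing.ringEquivOfRingEquiv_algebraMap (A := X.presheaf.stalk (η (genericPoint X')))
    (B := X'.presheaf.stalk (genericPoint X')) (K := X.functionField) (L := X'.functionField) _ _

theorem fieldEquiv_ratOf {V : X.Opens} {y : X'} (hy : η y ∈ V) (s : Γ(X, V)) :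
    fieldEquiv η (ratOf hy s) = ratOf (show y ∈ η ⁻¹ᵁ V from hy) (η.app V s) := by
  rw [ratOf_apply, fieldEquiv_algebraMap, ratOf_apply, germ_app]

variable (p : X ⟶ SpecC)

theorem fieldEquiv_algebraMap_complex (c : ℂ) :
    fieldEquiv η ((algebraFunctionField p).algebraMap c) =
      (algebraFunctionField (η ≫ p)).algebraMap c := by
  have h : ∀ (Y : Scheme.{0}) [IsIntegral Y] (q : Y ⟶ SpecC) (y : Y),
      (algebraFunctionField q).algebraMap c =
        ratOf (Opens.mem_top y)
          (q.appTop.hom ((Scheme.ΓSpecIso (CommRingCat.of ℂ)).inv.hom c)) := by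
    intro Y _ q y
    rw [ratOf_eq _ (Opens.mem_top (genericPoint Y)), ratOf_apply, algebraMap_genericPoint]
    rfl
  rw [h X p (η (genericPoint X')), h X' (η ≫ p) (genericPoint X'), fieldEquiv_ratOf]
  rfl

/-- The isomorphism of function fields, as an isomorphism of algebras. -/
def fieldAlgEquiv : letI := algebraFunctionField p; letI := algebraFunctionField (η ≫ p)
    X.functionField ≃ₐ[ℂ] X'.functionField :=
  letI := algebraFunctionField p
  letI := algebraFunctionField (η ≫ p)
  AlgEquiv.ofRingEquiv (f := fieldEquiv η) (fieldEquiv_algebraMap_complex η p)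

/-- The isomorphism of spaces of rational forms given by a birational morphism. -/
def formsEquiv : RationalForms p ≃+ RationalForms (η ≫ p) :=
  letI := algebraFunctionField p
  letI := algebraFunctionField (η ≫ p)
  kaehlerEquiv (fieldAlgEquiv η p)

theorem formsEquiv_ratD (a : X.functionField) :
    formsEquiv η p (ratD p a) = ratD (η ≫ p) (fieldEquiv η a) :=
  letI := algebraFunctionField p
  letI := algebraFunctionField (η ≫ p)
  kaehlerMap_D (fieldAlgEquiv η p).toAlgHom a

theorem formsEquiv_smul (a : X.functionField) (ω : RationalForms p) :
    formsEquiv η p (a • ω) = fieldEquiv η a • formsEquiv η p ω :=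
  letI := algebraFunctionField p
  letI := algebraFunctionField (η ≫ p)
  kaehlerMap_smul (fieldAlgEquiv η p).toAlgHom a ω

end Transport

/-! ### Local equations and logarithmic forms off the center -/

section Restrict

variable {X X' : Scheme.{0}} {η : X' ⟶ X} {U : X.Opens} [IsIso (η ∣_ U)]

variable (η U) in
theorem isOpenImmersion_ι_comp : IsOpenImmersion ((η ⁻¹ᵁ U).ι ≫ η) := by
  rw [← morphismRestrict_ι]; infer_instance

theorem eq_of_map_eq {y z : X'} (hy : η y ∈ U) (h : η y = η z) : y = z := by
  have := isOpenImmersion_ι_comp η U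
  have hz : η z ∈ U := h ▸ hy
  have := ((η ⁻¹ᵁ U).ι ≫ η).isOpenEmbedding.injective (a₁ := ⟨y, hy⟩) (a₂ := ⟨z, hz⟩) h
  exact congrArg Subtype.val this

theorem exists_open_preimage {W : X'.Opens} {y : X'} (hy : y ∈ W) (hyU : η y ∈ U) :
    ∃ V : X.Opens, η y ∈ V ∧ V ≤ U ∧ η ⁻¹ᵁ V ≤ W := by
  have := isOpenImmersion_ι_comp η U
  refine ⟨⟨((η ⁻¹ᵁ U).ι ≫ η) '' ((η ⁻¹ᵁ U).ι ⁻¹ᵁ W),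
    ((η ⁻¹ᵁ U).ι ≫ η).isOpenEmbedding.isOpenMap _ ((η ⁻¹ᵁ U).ι ⁻¹ᵁ W).isOpen⟩,
    ⟨⟨y, hyU⟩, hy, rfl⟩, ?_, ?_⟩
  · rintro _ ⟨z, -, rfl⟩
    exact z.2
  · rintro z ⟨w, hw, h⟩
    rw [← eq_of_map_eq (U := U) (show η w.1 ∈ U from w.2) h]
    exact hw

theorem exists_eq_of_mem {x : X} (hx : x ∈ U) : ∃ y, η y = x := by
  obtain ⟨y, hy⟩ := (η ∣_ U).surjective ⟨x, hx⟩
  refine ⟨y.1, ?_⟩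
  rw [← morphismRestrict_base_coe, hy]

/-- Local equations of closed subsets that correspond to each other over an open subset over which
a morphism is an isomorphism. -/
theorem stalkIdeal_eq_map_of_restrict {C : Closeds X} {C' : Closeds X'}
    (h : ∀ y, η y ∈ U → (y ∈ C' ↔ η y ∈ C)) {y : X'} (hy : η y ∈ U) :
    stalkIdeal (Scheme.IdealSheafData.vanishingIdeal C') y =
      (stalkIdeal (Scheme.IdealSheafData.vanishingIdeal C) (η y)).map (η.stalkMap y).hom := by
  have := isIso_stalkMap_of_restrict U hy
  apply le_antisymm
  · intro f' hf'
    obtain ⟨f, rfl⟩ := (ConcreteCategory.bijective_of_isIso (η.stalkMap y)).2 f'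
    refine Ideal.mem_map_of_mem (η.stalkMap y).hom ?_
    obtain ⟨W, hW, s', hs', hvan⟩ := (mem_stalkIdeal_vanishingIdeal_iff C' y _).mp hf'
    obtain ⟨V, hV, s, rfl⟩ := X.presheaf.exists_germ_eq f
    have hVy : y ∈ η ⁻¹ᵁ V := hV
    rw [← germ_app η hVy] at hs'
    obtain ⟨W', hyW', i, j, e⟩ := X'.presheaf.germ_eq y _ _ _ _ hs'
    -- Each point of `V'` is the image of a point of `X'` at which the two sections agree, so a
    -- section invertible at a point of `C` below would be invertible at a point of `C'` above.
    obtain ⟨V', hyV', hV'U, hV'W⟩ := exists_open_preimage (η := η) (U := U) hyW' hy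
    rw [mem_stalkIdeal_vanishingIdeal_iff]
    refine ⟨V ⊓ V', Opens.mem_inf.mpr ⟨hV, hyV'⟩, X.presheaf.map (homOfLE inf_le_left).op s,
      germ_res' _ _ _, ?_⟩
    intro x hx hxC hu
    obtain ⟨z, rfl⟩ := exists_eq_of_mem (η := η) (hV'U hx.2)
    rw [germ_res'] at hu
    have hu' := hu.map (η.stalkMap z).hom
    have hzV : z ∈ η ⁻¹ᵁ V := hx.1
    have hzW : z ∈ W' := hV'W hx.2
    have e' := congrArg (X'.presheaf.germ W' z hzW) e
    rw [TopCat.Presheaf.germ_res_apply, TopCat.Presheaf.germ_res_apply, germ_app η hzV] at e'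
    refine hvan z (i.le hzW) ((h z (hV'U hx.2)).mpr hxC) ?_
    rw [e']
    exact hu'
  · rw [Ideal.map_le_iff_le_comap]
    intro f hf
    obtain ⟨V, hV, s, rfl, hvan⟩ := (mem_stalkIdeal_vanishingIdeal_iff C _ f).mp hf
    have hVy : y ∈ η ⁻¹ᵁ V := hV
    rw [Ideal.mem_comap, mem_stalkIdeal_vanishingIdeal_iff]
    have hyVU : y ∈ η ⁻¹ᵁ (V ⊓ U) := Opens.mem_inf.mpr ⟨hV, hy⟩
    refine ⟨η ⁻¹ᵁ (V ⊓ U), hyVU, η.app _ (X.presheaf.map (homOfLE inf_le_left).op s), ?_, ?_⟩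
    · rw [germ_app η hyVU, germ_res']
    · intro z hz hzC hu
      rw [germ_app η hz] at hu
      have hu' := isUnit_of_map_unit (η.stalkMap z).hom _ hu
      rw [germ_res'] at hu'
      exact hvan _ hz.1 ((h z hz.2).mp hzC) hu'

theorem isLocalEquation_stalkMap_iff {C : Closeds X} {C' : Closeds X'}
    (h : ∀ y, η y ∈ U → (y ∈ C' ↔ η y ∈ C)) {y : X'} (hy : η y ∈ U) (f : X.presheaf.stalk (η y)) :
    IsLocalEquation C' y (η.stalkMap y f) ↔ IsLocalEquation C (η y) f := by
  have := isIso_stalkMap_of_restrict U hy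
  rw [IsLocalEquation, IsLocalEquation, stalkIdeal_eq_map_of_restrict h hy]
  have e : Ideal.span {η.stalkMap y f} = (Ideal.span {f}).map (η.stalkMap y).hom := by
    rw [Ideal.map_span, Set.image_singleton]
  rw [e]
  constructor
  · intro h'
    have := congrArg (Ideal.comap (η.stalkMap y).hom) h'
    rwa [Ideal.comap_map_of_bijective _ (ConcreteCategory.bijective_of_isIso (η.stalkMap y)),
      Ideal.comap_map_of_bijective _ (ConcreteCategory.bijective_of_isIso (η.stalkMap y))] at this
  · exact congrArg _

variable [IsIntegral X] [IsIntegral X'] [IsIso (η.stalkMap (genericPoint X'))] {p : X ⟶ SpecC}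

/-- Where `η` is an isomorphism the local rings, local equations and differentials all correspond.
Only members through the point have to be matched, and only over `U`, so exceptional curves play no
role. -/
theorem mem_logStalk_iff_of_restrict {D : Set (Closeds X)} {D' : Set (Closeds X')} {y : X'}
    (hy : η y ∈ U)
    (h : ∀ C ∈ D, η y ∈ C → ∃ C' ∈ D', ∀ y, η y ∈ U → (y ∈ C' ↔ η y ∈ C))
    (h' : ∀ C' ∈ D', y ∈ C' → ∃ C ∈ D, ∀ y, η y ∈ U → (y ∈ C' ↔ η y ∈ C))
    (ω : RationalForms p) :
    formsEquiv η p ω ∈ logStalk (η ≫ p) D' y ↔ ω ∈ logStalk p D (η y) := by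
  have := isIso_stalkMap_of_restrict U hy
  constructor
  · suffices ∀ ω' ∈ logStalk (η ≫ p) D' y, (formsEquiv η p).symm ω' ∈ logStalk p D (η y) by
      intro hω; simpa using this _ hω
    intro ω' hω'
    induction hω' using Submodule.span_induction with
    | mem ω' h₁ =>
      rcases h₁ with ⟨a', rfl⟩ | ⟨C', hC', hyC', f', hf', rfl⟩
      · obtain ⟨a, rfl⟩ := (ConcreteCategory.bijective_of_isIso (η.stalkMap y)).2 a'
        simp only
        rw [← fieldEquiv_algebraMap, ← formsEquiv_ratD, AddEquiv.symm_apply_apply]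
        exact ratD_mem_logStalk D _ a
      · obtain ⟨f, rfl⟩ := (ConcreteCategory.bijective_of_isIso (η.stalkMap y)).2 f'
        obtain ⟨C, hC, hCC'⟩ := h' C' hC' hyC'
        rw [← fieldEquiv_algebraMap, ← formsEquiv_ratD, ← map_inv₀, ← formsEquiv_smul,
          AddEquiv.symm_apply_apply]
        exact Submodule.subset_span (Or.inr ⟨C, hC, (hCC' y hy).mp hyC', f,
          (isLocalEquation_stalkMap_iff hCC' hy f).mp hf', rfl⟩)
    | zero => rw [map_zero]; exact zero_mem _
    | add _ _ _ _ h₁ h₂ => rw [map_add]; exact add_mem h₁ h₂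
    | smul a' ω' _ ih =>
      obtain ⟨a, rfl⟩ := (ConcreteCategory.bijective_of_isIso (η.stalkMap y)).2 a'
      have := Submodule.smul_mem _ a ih
      rw [stalk_smul_def] at this ⊢
      rwa [← fieldEquiv_algebraMap, ← AddEquiv.apply_symm_apply (formsEquiv η p) ω',
        ← formsEquiv_smul, AddEquiv.symm_apply_apply]
  · intro hω
    induction hω using Submodule.span_induction with
    | mem ω h₁ =>
      rcases h₁ with ⟨a, rfl⟩ | ⟨C, hC, hyC, f, hf, rfl⟩
      · rw [formsEquiv_ratD, fieldEquiv_algebraMap]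
        exact ratD_mem_logStalk D' _ _
      · obtain ⟨C', hC', hCC'⟩ := h C hC hyC
        rw [formsEquiv_smul, formsEquiv_ratD, map_inv₀, fieldEquiv_algebraMap]
        exact Submodule.subset_span (Or.inr ⟨C', hC', (hCC' y hy).mpr hyC, _,
          (isLocalEquation_stalkMap_iff hCC' hy f).mpr hf, rfl⟩)
    | zero => rw [map_zero]; exact zero_mem _
    | add _ _ _ _ h₁ h₂ => rw [map_add]; exact add_mem h₁ h₂
    | smul a ω _ ih =>
      rw [stalk_smul_def, formsEquiv_smul, fieldEquiv_algebraMap]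
      exact Submodule.smul_mem _ _ ih

end Restrict

/-! ### Curves off the center -/

section Curves

open Limits

variable {X X' : Scheme.{0}} {η : X' ⟶ X} {U : X.Opens}

/-- Otherwise the ideal of functions multiplying `s` into `J` lies in a maximal ideal, and the local
condition at that point yields a multiplier outside it. -/
theorem mem_ideal_of_stalkIdeal (J : X.IdealSheafData) (W : X.affineOpens) (s : Γ(X, W.1))
    (h : ∀ x (hx : x ∈ W.1), X.presheaf.germ W.1 x hx s ∈ stalkIdeal J x) : s ∈ J.ideal W := by
  have hW : IsAffineOpen W.1 := W.2
  suffices hK : (J.ideal W).colon {s} = ⊤ by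
    have := (Ideal.eq_top_iff_one _).mp hK
    simpa [Submodule.mem_colon_singleton] using this
  by_contra hK
  obtain ⟨m, hm, hKm⟩ := Ideal.exists_le_maximal _ hK
  let q : PrimeSpectrum Γ(X, W.1) := ⟨m, hm.isPrime⟩
  have hx : hW.fromSpec q ∈ W.1 := by
    rw [← SetLike.mem_coe, ← hW.range_fromSpec]; exact ⟨q, rfl⟩
  have hmem := h _ hx
  rw [stalkIdeal_eq_map J W hx] at hmem
  let : Algebra Γ(X, W.1) (X.presheaf.stalk (hW.fromSpec q)) :=
    (X.presheaf.germ W.1 _ hx).hom.toAlgebra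
  have : IsLocalization.AtPrime (X.presheaf.stalk (hW.fromSpec q)) q.asIdeal :=
    hW.isLocalization_stalk' q hx
  obtain ⟨⟨a, r⟩, har⟩ := (IsLocalization.mem_map_algebraMap_iff q.asIdeal.primeCompl
    (X.presheaf.stalk (hW.fromSpec q))).mp hmem
  change algebraMap _ (X.presheaf.stalk (hW.fromSpec q)) s *
    algebraMap _ (X.presheaf.stalk (hW.fromSpec q)) r.1 =
      algebraMap _ (X.presheaf.stalk (hW.fromSpec q)) a.1 at har
  rw [← map_mul] at har
  obtain ⟨c, hc⟩ := (IsLocalization.eq_iff_exists q.asIdeal.primeCompl _).mp har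
  refine (c * r).2 (hKm ?_)
  rw [Submodule.mem_colon_singleton, smul_eq_mul]
  have : (c * r : Γ(X, W.1)) * s = c * a := by rw [← hc]; ring
  rw [Submonoid.coe_mul, this]
  exact Ideal.mul_mem_left _ _ a.2

theorem idealSheafData_eq_of_stalkIdeal {J J' : X.IdealSheafData}
    (h : ∀ x, stalkIdeal J x = stalkIdeal J' x) : J = J' := by
  have key : ∀ {J J' : X.IdealSheafData}, (∀ x, stalkIdeal J x = stalkIdeal J' x) → J ≤ J' := by
    intro J J' h W s hs
    refine mem_ideal_of_stalkIdeal J' W s fun x hx => ?_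
    rw [← h, stalkIdeal_eq_map J W hx]
    exact Ideal.mem_map_of_mem _ hs
  exact le_antisymm (key h) (key fun x => (h x).symm)

theorem respectsIso_smoothOfRelativeDimension (n : ℕ) :
    (show MorphismProperty Scheme.{0} from @SmoothOfRelativeDimension n).RespectsIso := by
  have : IsZariskiLocalAtTarget
    (show MorphismProperty Scheme.{0} from @SmoothOfRelativeDimension n) := inferInstance
  infer_instance

variable [IsIso (η ∣_ U)]

theorem vanishingIdeal_comap_of_restrict {C : Closeds X} {C' : Closeds X'} (hC : ∀ x ∈ C, x ∈ U)
    (h : ∀ y, y ∈ C' ↔ η y ∈ C) : (Scheme.IdealSheafData.vanishingIdeal C).comap η =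
      Scheme.IdealSheafData.vanishingIdeal C' := by
  refine idealSheafData_eq_of_stalkIdeal fun y => ?_
  by_cases hy : y ∈ C'
  · rw [stalkIdeal_comap, stalkIdeal_eq_map_of_restrict (U := U) (fun y _ => h y)
      (hC _ ((h y).mp hy))]
  · rw [stalkIdeal_eq_top_of_notMem hy, stalkIdeal_eq_top_iff, support_comap_vanishingIdeal, ← h]
    exact hy

-- As `i` factors through `U`, its base change is a base change of the isomorphism over `U`.
variable (U) in
theorem isIso_pullback_snd {P : Scheme.{0}} (i : P ⟶ X) (hi : ∀ z, i z ∈ U) :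
    IsIso (pullback.snd η i) := by
  let l : P ⟶ U.toScheme := IsOpenImmersion.lift U.ι i (by
    rw [Scheme.Opens.range_ι]; rintro _ ⟨z, rfl⟩; exact hi z)
  have hl : l ≫ U.ι = i := IsOpenImmersion.lift_fac _ _ _
  have h1 : IsPullback (𝟙 P) (l ≫ inv (η ∣_ U)) l (η ∣_ U) := IsPullback.of_horiz_isIso ⟨by simp⟩
  have h2 := (h1.paste_vert (isPullback_morphismRestrict η U)).flip
  rw [hl] at h2
  have h3 : pullback.snd η i = h2.isoPullback.inv := by
    rw [← Category.comp_id h2.isoPullback.inv, Iso.eq_inv_comp]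
    exact h2.isoPullback_hom_snd
  rw [h3]
  infer_instance

/-- The reduced subscheme of `C'` is the base change of that of `C`, hence isomorphic to it, since
`C` lies where `η` is an isomorphism. Irreducibility is transported by image and preimage. -/
theorem isSmoothCurve_iff_of_restrict (p : X ⟶ SpecC) {C : Closeds X} {C' : Closeds X'}
    (hC : ∀ x ∈ C, x ∈ U) (h : ∀ y, y ∈ C' ↔ η y ∈ C) :
    IsSmoothCurve (η ≫ p) C' ↔ IsSmoothCurve p C := by
  have hirr : IsIrreducible (C' : Set X') ↔ IsIrreducible (C : Set X) := by
    constructor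
    · intro h'
      have := h'.image η η.continuous.continuousOn
      convert this
      ext x
      constructor
      · intro hx
        obtain ⟨y, rfl⟩ := exists_eq_of_mem (η := η) (hC x hx)
        exact ⟨y, (h y).mpr hx, rfl⟩
      · rintro ⟨y, hy, rfl⟩
        exact (h y).mp hy
    · intro h'
      have := isOpenImmersion_ι_comp η U
      obtain ⟨x, hx⟩ := h'.1
      obtain ⟨y, rfl⟩ := exists_eq_of_mem (η := η) (hC x hx)
      refine ⟨⟨y, (h y).mpr hx⟩, ?_⟩
      have h1 := h'.2.preimage ((η ⁻¹ᵁ U).ι ≫ η).isOpenEmbedding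
      have h2 := h1.image (η ⁻¹ᵁ U).ι (η ⁻¹ᵁ U).ι.continuous.continuousOn
      convert h2
      ext z
      constructor
      · intro hz
        exact ⟨⟨z, hC _ ((h z).mp hz)⟩, (h z).mp hz, rfl⟩
      · rintro ⟨w, hw, rfl⟩
        exact (h _).mpr hw
  set I := Scheme.IdealSheafData.vanishingIdeal C with hI
  have hsm : SmoothOfRelativeDimension 1
      ((Scheme.IdealSheafData.vanishingIdeal C').subschemeι ≫ η ≫ p) ↔
      SmoothOfRelativeDimension 1 (I.subschemeι ≫ p) := by
    rw [← vanishingIdeal_comap_of_restrict hC h]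
    have := isIso_pullback_snd U (η := η) I.subschemeι (fun z => hC _ (by
      have : I.subschemeι z ∈ (I.support : Set X) := by
        rw [← Scheme.IdealSheafData.range_subschemeι]; exact ⟨z, rfl⟩
      exact (Scheme.IdealSheafData.coe_support_vanishingIdeal C).le this))
    have := respectsIso_smoothOfRelativeDimension 1
    have e : (I.comap η).subschemeι ≫ η ≫ p =
        ((I.comapIso η).hom ≫ pullback.snd η I.subschemeι) ≫ I.subschemeι ≫ p := by
      rw [← Scheme.IdealSheafData.comapIso_hom_fst, Category.assoc, pullback.condition_assoc,
        Category.assoc]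
    rw [e]
    exact MorphismProperty.cancel_left_of_respectsIso (@SmoothOfRelativeDimension 1) _ _
  exact ⟨fun h' => ⟨hirr.mp h'.1, hsm.mp h'.2⟩, fun h' => ⟨hirr.mpr h'.1, hsm.mpr h'.2⟩⟩

end Curves

/-! ### Coordinates at closed points of smooth surfaces -/

section CoordinatesAlgebra

open KaehlerDifferential

/-- The Nullstellensatz: the residue field is a finite extension of `ℂ`, hence equal to it. -/
theorem exists_algHom_ker_eq {A : Type} [CommRing A] [Algebra ℂ A] [Algebra.FiniteType ℂ A]
    (m : Ideal A) [m.IsMaximal] : ∃ ev : A →ₐ[ℂ] ℂ, ∀ a, ev a = 0 ↔ a ∈ m := by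
  let := Ideal.Quotient.field m
  have : Algebra.FiniteType ℂ (A ⧸ m) :=
    Algebra.FiniteType.of_surjective (Ideal.Quotient.mkₐ ℂ m) (Ideal.Quotient.mkₐ_surjective ℂ m)
  have := finite_of_finite_type_of_isJacobsonRing ℂ (A ⧸ m)
  have hbij := IsAlgClosed.algebraMap_bijective_of_isIntegral (k := ℂ) (K := A ⧸ m)
  let e : ℂ ≃ₐ[ℂ] A ⧸ m := AlgEquiv.ofBijective (Algebra.ofId ℂ (A ⧸ m)) hbij
  refine ⟨e.symm.toAlgHom.comp (Ideal.Quotient.mkₐ ℂ m), fun a => ?_⟩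
  rw [← Ideal.Quotient.eq_zero_iff_mem]
  exact EmbeddingLike.map_eq_zero_iff (f := e.symm)

theorem exists_basis_of_isFractionRing {A K : Type} [CommRing A] [Field K] [Algebra ℂ A]
    [Algebra ℂ K] [Algebra A K] [IsScalarTower ℂ A K] [IsFractionRing A K] {x y : A}
    (b : Module.Basis (Fin 2) A Ω[A⁄ℂ]) (hx : b 0 = D ℂ A x) (hy : b 1 = D ℂ A y) :
    ∃ β : Module.Basis (Fin 2) K Ω[K⁄ℂ], β 0 = D ℂ K (algebraMap A K x) ∧
      β 1 = D ℂ K (algebraMap A K y) ∧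
      ∀ a : A, ∃ c d : A, D ℂ K (algebraMap A K a) =
        algebraMap A K c • β 0 + algebraMap A K d • β 1 := by
  have := KaehlerDifferential.isLocalizedModule_map ℂ A K (nonZeroDivisors A)
  let β := b.ofIsLocalizedModule K (nonZeroDivisors A) (KaehlerDifferential.map ℂ ℂ A K)
  have hβ : ∀ i, β i = KaehlerDifferential.map ℂ ℂ A K (b i) :=
    fun i => b.ofIsLocalizedModule_apply K (nonZeroDivisors A) (KaehlerDifferential.map ℂ ℂ A K) i
  refine ⟨β, by rw [hβ, hx, map_D], by rw [hβ, hy, map_D], fun a => ⟨b.repr (D ℂ A a) 0,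
    b.repr (D ℂ A a) 1, ?_⟩⟩
  have h := congrArg (KaehlerDifferential.map ℂ ℂ A K) (b.sum_repr (D ℂ A a))
  rw [Fin.sum_univ_two, map_add, map_smul, map_smul, ← hβ, ← hβ, map_D] at h
  rw [← h, algebraMap_smul, algebraMap_smul]

theorem dvd_of_isLocalization {A B : Type} [CommRing A] [IsDomain A] [CommRing B] [Algebra A B]
    {r : A} [IsLocalization.Away r B] {x y : A} (h : ∀ a c, y * a = x * c → x ∣ a) (hr : r ≠ 0) :
    ∀ a c, algebraMap A B y * a = algebraMap A B x * c → algebraMap A B x ∣ a := by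
  intro a c e
  have inj : Function.Injective (algebraMap A B) := IsLocalization.injective B
    (M := Submonoid.powers r) (powers_le_nonZeroDivisors_of_noZeroDivisors hr)
  obtain ⟨n, a', ha⟩ := IsLocalization.Away.surj r a
  obtain ⟨m, c', hc⟩ := IsLocalization.Away.surj r c
  have e' : y * (a' * r ^ m) = x * (c' * r ^ n) := by
    apply inj
    simp only [map_mul, map_pow, ← ha, ← hc]
    linear_combination (algebraMap A B r ^ n * algebraMap A B r ^ m) * e
  obtain ⟨d, hd⟩ := h _ _ e'
  have hu : IsUnit (algebraMap A B r ^ n * algebraMap A B r ^ m) :=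
    ((IsLocalization.Away.algebraMap_isUnit r).pow n).mul
      ((IsLocalization.Away.algebraMap_isUnit r).pow m)
  rw [← hu.dvd_mul_right]
  refine ⟨algebraMap A B d, ?_⟩
  rw [← map_mul, ← hd, map_mul, map_pow, ← ha]
  ring

end CoordinatesAlgebra

/-! ### The structure map on sections, and frames of regular forms from sections on an affine open.
-/

section StructMap

variable {X X' : Scheme.{0}} (p : X ⟶ SpecC)

/-- The structure map of the ring of sections over an open subset. -/
def structMap (U : X.Opens) : ℂ →+* Γ(X, U) :=
  ((Scheme.ΓSpecIso (CommRingCat.of ℂ)).inv ≫ p.appLE ⊤ U le_top).hom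

theorem map_structMap {U V : X.Opens} (h : V ≤ U) (c : ℂ) :
    X.presheaf.map (homOfLE h).op (structMap p U c) = structMap p V c := by
  have := p.appLE_map (U := ⊤) (V := U) le_top (homOfLE h).op
  exact congrArg (fun f => f.hom ((Scheme.ΓSpecIso (CommRingCat.of ℂ)).inv.hom c)) this

theorem algebraMap_complex_eq [IsIntegral X] {U : X.Opens} {x : X} (hx : x ∈ U) (c : ℂ) :
    (algebraFunctionField p).algebraMap c = ratOf hx (structMap p U c) := by
  rw [ratOf_eq hx (genericPoint_mem ⟨x, hx⟩), ← map_structMap p (le_top : U ≤ ⊤), ratOf_map,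
    ratOf_apply, algebraMap_genericPoint]
  simp [structMap, Scheme.Hom.appLE, RingHom.algebraMap_toAlgebra]
  rfl

/-- Germs are fractions of sections, and the quotient rule expresses their differentials through
those of numerator and denominator. -/
theorem mem_span_ratD_of_section [IsIntegral X] {V : X.Opens} (hV : IsAffineOpen V)
    {u v : RationalForms p} {q : X} (hq : q ∈ V)
    (h : ∀ s : Γ(X, V), ratD p (ratOf hq s) ∈ Submodule.span (X.presheaf.stalk q) {u, v})
    (a : X.presheaf.stalk q) :
    ratD p (algebraMap _ X.functionField a) ∈ Submodule.span (X.presheaf.stalk q) {u, v} := by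
  let : Algebra Γ(X, V) (X.presheaf.stalk q) := (X.presheaf.germ V q hq).hom.toAlgebra
  have : IsLocalization.AtPrime (X.presheaf.stalk q) (hV.primeIdealOf ⟨q, hq⟩).asIdeal :=
    hV.isLocalization_stalk ⟨q, hq⟩
  obtain ⟨⟨s, t⟩, hst⟩ := IsLocalization.surj (hV.primeIdealOf ⟨q, hq⟩).asIdeal.primeCompl a
  obtain ⟨w, hw⟩ := IsLocalization.map_units (X.presheaf.stalk q) t
  have e : algebraMap _ X.functionField a * ratOf hq t.1 = ratOf hq s := by
    rw [ratOf_apply, ratOf_apply, ← map_mul]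
    exact congrArg _ hst
  have e' := congrArg (ratD p) e
  rw [ratD_mul] at e'
  have h3 : (w : X.presheaf.stalk q) • ratD p (algebraMap _ X.functionField a) =
      ratD p (ratOf hq s) - a • ratD p (ratOf hq t.1) := by
    rw [← e', stalk_smul_def, stalk_smul_def, hw]
    simp only [ratOf_apply]
    exact (add_sub_cancel_left _ _).symm
  have h4 : ratD p (algebraMap _ X.functionField a) = (↑w⁻¹ : X.presheaf.stalk q) •
      (ratD p (ratOf hq s) - a • ratD p (ratOf hq t.1)) := by
    rw [← h3, smul_smul, Units.inv_mul, one_smul]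
  rw [h4]
  exact Submodule.smul_mem _ _ (sub_mem (h s) (Submodule.smul_mem _ _ (h t.1)))

theorem logStalk_empty_eq_span [IsIntegral X] {V : X.Opens} (hV : IsAffineOpen V)
    {u v : RationalForms p} {q : X} (hq : q ∈ V) (hu : u ∈ logStalk p ∅ q)
    (hv : v ∈ logStalk p ∅ q)
    (h : ∀ s : Γ(X, V), ratD p (ratOf hq s) ∈ Submodule.span (X.presheaf.stalk q) {u, v}) :
    logStalk p ∅ q = Submodule.span (X.presheaf.stalk q) {u, v} := by
  apply le_antisymm
  · refine Submodule.span_le.mpr ?_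
    rintro _ (⟨a, rfl⟩ | ⟨C, hC, -⟩)
    · exact mem_span_ratD_of_section p hV hq h a
    · exact absurd hC (Set.notMem_empty C)
  · rw [Submodule.span_le]
    rintro _ (rfl | rfl)
    exacts [hu, hv]

end StructMap

/-! ### Coordinate neighbourhoods of closed points. -/

section CoordNhd

variable {X : Scheme.{0}} [IsIntegral X]

/-- An affine neighbourhood of a closed point with local coordinates. -/
structure CoordNhd (p : X ⟶ SpecC) (z : X) where
  V : X.affineOpens
  mem : z ∈ V.1
  x : Γ(X, V.1)
  y : Γ(X, V.1)
  ev : Γ(X, V.1) →+* ℂ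
  ev_structMap : ∀ c, ev (structMap p V.1 c) = c
  ev_eq_zero_iff : ∀ a, ev a = 0 ↔ a ∈ Ideal.span {x, y}
  isUnit_germ_iff : ∀ a, IsUnit (X.presheaf.germ V.1 z mem a) ↔ ev a ≠ 0
  dvd : ∀ a b, y * a = x * b → x ∣ a
  dvd' : ∀ a b, x * a = y * b → y ∣ a
  β : Module.Basis (Fin 2) X.functionField (RationalForms p)
  β_zero : β 0 = ratD p (ratOf mem x)
  β_one : β 1 = ratD p (ratOf mem y)
  logStalk_empty : ∀ q ∈ V.1, logStalk p ∅ q = Submodule.span (X.presheaf.stalk q) {β 0, β 1}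

/-- Exchanging the coordinates. -/
def CoordNhd.swap {p : X ⟶ SpecC} {z : X} (c : CoordNhd p z) : CoordNhd p z where
  V := c.V
  mem := c.mem
  x := c.y
  y := c.x
  ev := c.ev
  ev_structMap := c.ev_structMap
  ev_eq_zero_iff a := by rw [c.ev_eq_zero_iff, Ideal.span_pair_comm]
  isUnit_germ_iff := c.isUnit_germ_iff
  dvd := c.dvd'
  dvd' := c.dvd
  β := c.β.reindex (Equiv.swap 0 1)
  β_zero := by simpa using c.β_one
  β_one := by simpa using c.β_zero
  logStalk_empty q hq := by simp [c.logStalk_empty q hq, Set.pair_comm]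

end CoordNhd

/-! ### Existence of coordinate neighbourhoods on smooth surfaces. -/

section StandardSmooth

variable {X : Scheme.{0}} (p : X ⟶ SpecC)

theorem isStandardSmooth_basicOpen {V : X.Opens} (hV : IsAffineOpen V)
    (h : (structMap p V).IsStandardSmoothOfRelativeDimension 2) (f : Γ(X, V)) :
    (structMap p (X.basicOpen f)).IsStandardSmoothOfRelativeDimension 2 := by
  have hle : X.basicOpen f ≤ V := X.basicOpen_le f
  let : Algebra Γ(X, V) Γ(X, X.basicOpen f) := (X.presheaf.map (homOfLE hle).op).hom.toAlgebra
  have : IsLocalization.Away f Γ(X, X.basicOpen f) :=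
    hV.isLocalization_of_eq_basicOpen f (homOfLE hle) rfl
  have h1 := (RingHom.isStandardSmoothOfRelativeDimension_stableUnderCompositionWithLocalizationAway
    2).2 Γ(X, X.basicOpen f) f _ h
  convert h1 using 1
  exact RingHom.ext fun c => (map_structMap p hle c).symm

theorem exists_isStandardSmooth [SmoothOfRelativeDimension 2 p] {z : X} {N : X.Opens}
    (hz : z ∈ N) : ∃ V : X.affineOpens, z ∈ V.1 ∧ V.1 ≤ N ∧
      (structMap p V.1).IsStandardSmoothOfRelativeDimension 2 := by
  obtain ⟨U₀, -, V₀, hV₀, hzV₀, e, h⟩ :=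
    SmoothOfRelativeDimension.exists_isStandardSmoothOfRelativeDimension (n := 2) (f := p) z
  -- `Spec ℂ` has a single point.
  obtain rfl : U₀ = ⊤ := by
    refine top_unique fun q _ => ?_
    have hq : q = p z := Subsingleton.elim (α := PrimeSpectrum ℂ) _ _
    rw [hq]
    exact e hzV₀
  obtain ⟨f, hfN, hzf⟩ := hV₀.exists_basicOpen_le (V := N) ⟨z, hz⟩ hzV₀
  refine ⟨⟨X.basicOpen f, hV₀.basicOpen f⟩, hzf, hfN, isStandardSmooth_basicOpen p hV₀ ?_ f⟩
  exact (RingHom.isStandardSmoothOfRelativeDimension_respectsIso).2 _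
    (Scheme.ΓSpecIso (CommRingCat.of ℂ)).symm.commRingCatIsoToRingEquiv h

theorem exists_ev {z : X} (hz : IsClosed {z}) {V : X.Opens} (hV : IsAffineOpen V)
    (hzV : z ∈ V) (hft : (structMap p V).FiniteType) : ∃ ev : Γ(X, V) →+* ℂ,
      (∀ c, ev (structMap p V c) = c) ∧ ∀ a, IsUnit (X.presheaf.germ V z hzV a) ↔ ev a ≠ 0 := by
  let : Algebra ℂ Γ(X, V) := (structMap p V).toAlgebra
  have : Algebra.FiniteType ℂ Γ(X, V) := hft
  have := hV.primeIdealOf_isMaximal_of_isClosed ⟨z, hzV⟩ hz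
  obtain ⟨ev, hev⟩ := exists_algHom_ker_eq (hV.primeIdealOf ⟨z, hzV⟩).asIdeal
  refine ⟨ev.toRingHom, ev.commutes, fun a => ?_⟩
  let : Algebra Γ(X, V) (X.presheaf.stalk z) := (X.presheaf.germ V z hzV).hom.toAlgebra
  have : IsLocalization.AtPrime (X.presheaf.stalk z) (hV.primeIdealOf ⟨z, hzV⟩).asIdeal :=
    hV.isLocalization_stalk ⟨z, hzV⟩
  exact (IsLocalization.AtPrime.isUnit_to_map_iff (X.presheaf.stalk z)
    (hV.primeIdealOf ⟨z, hzV⟩).asIdeal a).trans (hev a).not.symm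

theorem finiteType_of_isStandardSmooth {A B : Type} [CommRing A] [CommRing B] {f : A →+* B} {n : ℕ}
    (h : f.IsStandardSmoothOfRelativeDimension n) : f.FiniteType := by
  let := f.toAlgebra
  have : Algebra.IsStandardSmoothOfRelativeDimension n A B := h
  have := Algebra.IsStandardSmoothOfRelativeDimension.isStandardSmooth n (R := A) (S := B)
  exact (inferInstance : Algebra.FiniteType A B)

theorem exists_coordNhd [IsIntegral X] [SmoothOfRelativeDimension 2 p] {z : X}
    (hz : IsClosed {z}) {N : X.Opens} (hzN : z ∈ N) : ∃ c : CoordNhd p z, c.V.1 ≤ N := by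
  obtain ⟨⟨V, hV⟩, hzV, hVN, h⟩ := exists_isStandardSmooth p hzN
  have hV : IsAffineOpen V := hV
  change z ∈ V at hzV
  change V ≤ N at hVN
  change (structMap p V).IsStandardSmoothOfRelativeDimension 2 at h
  obtain ⟨ev₁, ev₁_map, hev₁⟩ := exists_ev p hz hV hzV (finiteType_of_isStandardSmooth h)
  have : Nonempty V := ⟨⟨z, hzV⟩⟩
  let : Algebra ℂ Γ(X, V) := (structMap p V).toAlgebra
  have h' : Algebra.IsStandardSmoothOfRelativeDimension 2 ℂ Γ(X, V) := h
  have := Algebra.IsStandardSmoothOfRelativeDimension.isStandardSmooth 2 (R := ℂ) (S := Γ(X, V))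
  let ev : Γ(X, V) →ₐ[ℂ] ℂ := { ev₁ with commutes' := ev₁_map }
  have hev : ∀ a, ev a = ev₁ a := fun _ => rfl
  obtain ⟨x, y, hx, hy, b, hbx, hby⟩ := exists_basis_kaehler (A := Γ(X, V)) ev
  -- The coordinates may have other common zeros in `V`. Inverting `r`, which is nonzero at `z`,
  -- leaves a neighbourhood where they generate the ideal of `z`.
  obtain ⟨r, hr, hrm⟩ := exists_mul_mem_span_of_basis (A := Γ(X, V)) ev (x := x) (y := y)
    (fun w => ⟨b.repr w 0, b.repr w 1, by
      rw [← hbx, ← hby, ← Fin.sum_univ_two (fun i => b.repr w i • b i), b.sum_repr]⟩) hx hy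
  have hle : X.basicOpen r ≤ V := X.basicOpen_le r
  have hzr : z ∈ X.basicOpen r := by
    rw [X.mem_basicOpen r z hzV, hev₁, ← hev, hr]; exact one_ne_zero
  have hV₂ : IsAffineOpen (X.basicOpen r) := hV.basicOpen r
  obtain ⟨ev₂, ev₂_map, hev₂⟩ := exists_ev p hz hV₂ hzr
    (finiteType_of_isStandardSmooth (isStandardSmooth_basicOpen p hV h r))
  let : Algebra Γ(X, V) Γ(X, X.basicOpen r) := (X.presheaf.map (homOfLE hle).op).hom.toAlgebra
  have : IsLocalization.Away r Γ(X, X.basicOpen r) :=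
    hV.isLocalization_of_eq_basicOpen r (homOfLE hle) rfl
  have germ_eq : ∀ a : Γ(X, V), X.presheaf.germ (X.basicOpen r) z hzr
      (algebraMap Γ(X, V) Γ(X, X.basicOpen r) a) = X.presheaf.germ V z hzV a :=
    fun a => germ_res' hle hzr a
  -- Both evaluations detect whether a germ at `z` is a unit, so they vanish on the same functions.
  have ev_res : ∀ a : Γ(X, V), ev₂ (algebraMap _ Γ(X, X.basicOpen r) a) = 0 ↔ ev a = 0 := by
    intro a
    rw [← not_iff_not, ← ne_eq, ← ne_eq, ← hev₂, germ_eq, hev₁, hev]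
  have hr0 : r ≠ 0 := by rintro rfl; simp at hr
  let : Algebra Γ(X, V) X.functionField := (ratOf hzV).toAlgebra
  let := algebraFunctionField p
  have : IsScalarTower ℂ Γ(X, V) X.functionField :=
    IsScalarTower.of_algebraMap_eq fun c => algebraMap_complex_eq p hzV c
  have : IsFractionRing Γ(X, V) X.functionField := by
    have := functionField_isFractionRing_of_isAffineOpen X V hV
    convert this
    refine Algebra.algebra_ext _ _ fun a => ?_
    exact Scheme.algebraMap_germ_eq_germToFunctionField X hzV a
  obtain ⟨β, hβ₀, hβ₁, hβ⟩ : ∃ β : Module.Basis (Fin 2) X.functionField (RationalForms p),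
      β 0 = ratD p (ratOf hzV x) ∧ β 1 = ratD p (ratOf hzV y) ∧ ∀ a : Γ(X, V), ∃ c d : Γ(X, V),
        ratD p (ratOf hzV a) = ratOf hzV c • β 0 + ratOf hzV d • β 1 :=
    exists_basis_of_isFractionRing (K := X.functionField) b hbx hby
  -- Exchanging the basis elements gives regularity of the sequence in the other order, needed for
  -- the second chart.
  let b' := b.reindex (Equiv.swap 0 1)
  have hb'0 : b' 0 = KaehlerDifferential.D ℂ _ y := by simpa [b'] using hby
  have hb'1 : b' 1 = KaehlerDifferential.D ℂ _ x := by simpa [b'] using hbx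
  refine ⟨{
    V := ⟨X.basicOpen r, hV₂⟩
    mem := hzr
    x := algebraMap Γ(X, V) Γ(X, X.basicOpen r) x
    y := algebraMap Γ(X, V) Γ(X, X.basicOpen r) y
    ev := ev₂
    ev_structMap := ev₂_map
    ev_eq_zero_iff := ?_
    isUnit_germ_iff := hev₂
    dvd := dvd_of_isLocalization (r := r) (dvd_of_mul_eq_mul_of_basis b hbx hby) hr0
    dvd' := dvd_of_isLocalization (r := r) (dvd_of_mul_eq_mul_of_basis b' hb'0 hb'1) hr0
    β := β
    β_zero := ?_
    β_one := ?_
    logStalk_empty := ?_ }, hle.trans hVN⟩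
  · intro a
    constructor
    · intro ha
      obtain ⟨n, a', ha'⟩ := IsLocalization.Away.surj r a
      have h0 : ev a' = 0 := by rw [← ev_res, ← ha', map_mul, ha, zero_mul]
      have h1 := Ideal.mem_map_of_mem (algebraMap Γ(X, V) Γ(X, X.basicOpen r)) (hrm a' h0)
      rw [Ideal.map_span, Set.image_pair, map_mul, ← ha'] at h1
      have hu := IsLocalization.Away.algebraMap_isUnit (S := Γ(X, X.basicOpen r)) r
      rwa [Ideal.unit_mul_mem_iff_mem _ hu, mul_comm,
        Ideal.unit_mul_mem_iff_mem _ (hu.pow n)] at h1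
    · intro ha
      obtain ⟨c, d, rfl⟩ := Ideal.mem_span_pair.mp ha
      rw [map_add, map_mul, map_mul, (ev_res x).mpr hx, (ev_res y).mpr hy]
      simp
  · rw [hβ₀]; exact congrArg (ratD p) (ratOf_map hle hzr x).symm
  · rw [hβ₁]; exact congrArg (ratD p) (ratOf_map hle hzr y).symm
  · intro q hq
    have hqV : q ∈ V := hle hq
    have e0 : β 0 = ratD p (algebraMap _ _ (X.presheaf.germ V q hqV x)) := by
      rw [hβ₀, ← ratOf_apply hqV]; exact congrArg (ratD p) (ratOf_eq _ _ x)
    have e1 : β 1 = ratD p (algebraMap _ _ (X.presheaf.germ V q hqV y)) := by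
      rw [hβ₁, ← ratOf_apply hqV]; exact congrArg (ratD p) (ratOf_eq _ _ y)
    refine logStalk_empty_eq_span p hV hqV ?_ ?_ fun s => ?_
    · rw [e0]; exact ratD_mem_logStalk ∅ q _
    · rw [e1]; exact ratD_mem_logStalk ∅ q _
    · obtain ⟨c, d, h⟩ := hβ s
      rw [Submodule.mem_span_pair]
      refine ⟨X.presheaf.germ V q hqV c, X.presheaf.germ V q hqV d, ?_⟩
      rw [stalk_smul_def, stalk_smul_def, ← ratOf_apply, ← ratOf_apply, ratOf_eq hqV hzV,
        ratOf_eq hqV hzV, ratOf_eq hqV hzV]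
      exact h.symm

end StandardSmooth

/-! ### The chart of the blow-up over a coordinate neighbourhood -/

theorem exists_point_of_isPrime {X : Scheme.{0}} {U : X.Opens} (hU : IsAffineOpen U)
    (P : Ideal Γ(X, U)) [P.IsPrime] :
    ∃ (q : X) (hq : q ∈ U), ∀ s, IsUnit (X.presheaf.germ U q hq s) ↔ s ∉ P := by
  let q : PrimeSpectrum Γ(X, U) := ⟨P, inferInstance⟩
  have hx : hU.fromSpec q ∈ U := by
    rw [← SetLike.mem_coe, ← hU.range_fromSpec]; exact ⟨q, rfl⟩
  refine ⟨hU.fromSpec q, hx, fun s => ?_⟩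
  let : Algebra Γ(X, U) (X.presheaf.stalk (hU.fromSpec q)) := (X.presheaf.germ U _ hx).hom.toAlgebra
  have : IsLocalization.AtPrime (X.presheaf.stalk (hU.fromSpec q))
    (hU.primeIdealOf ⟨_, hx⟩).asIdeal := hU.isLocalization_stalk ⟨_, hx⟩
  have e : hU.primeIdealOf ⟨_, hx⟩ = q :=
    hU.fromSpec.isOpenEmbedding.injective (hU.fromSpec_primeIdealOf ⟨hU.fromSpec q, hx⟩)
  have h := IsLocalization.AtPrime.isUnit_to_map_iff (X.presheaf.stalk (hU.fromSpec q))
    (hU.primeIdealOf ⟨_, hx⟩).asIdeal s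
  rw [e] at h
  exact h

section Coord

variable {X X' : Scheme.{0}} [IsIntegral X] {p : X ⟶ SpecC} {z : X} (c : CoordNhd p z)

theorem ratD_zero : ratD p 0 = 0 := by
  have := ratD_add (p := p) 0 0
  simpa using this

theorem CoordNhd.x_ne_zero : c.x ≠ 0 := by
  intro h
  apply c.β.ne_zero 0
  rw [c.β_zero, h, map_zero, ratD_zero]

theorem CoordNhd.ev_x : c.ev c.x = 0 := (c.ev_eq_zero_iff _).mpr (Ideal.subset_span (by simp))

theorem CoordNhd.ev_y : c.ev c.y = 0 := (c.ev_eq_zero_iff _).mpr (Ideal.subset_span (by simp))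

theorem CoordNhd.ev_surjective : Function.Surjective c.ev := fun t => ⟨_, c.ev_structMap t⟩

theorem CoordNhd.vanishingIdeal_ideal {Z : Closeds X} (hZ : ∀ q ∈ c.V.1, q ∈ Z ↔ q = z) :
    (Scheme.IdealSheafData.vanishingIdeal Z).ideal c.V = Ideal.span {c.x, c.y} := by
  ext a
  rw [mem_vanishingIdeal_ideal_iff, ← c.ev_eq_zero_iff]
  constructor
  · intro h
    simpa [c.isUnit_germ_iff] using h z c.mem ((hZ z c.mem).mpr rfl)
  · intro h q hq hqZ
    obtain rfl := (hZ q hq).mp hqZ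
    simpa [c.isUnit_germ_iff] using h

variable (η : X' ⟶ X)

/-- The chart of the blow-up where the first coordinate generates the inverse image ideal. -/
abbrev CoordNhd.chart : X'.Opens := chartOpen η c.x c.y

/-- The pull-back of functions to the chart. -/
def CoordNhd.pull : Γ(X, c.V.1) →+* Γ(X', c.chart η) :=
  (η.appLE c.V.1 (c.chart η) (chartOpen_le η c.x c.y)).hom

theorem CoordNhd.mem_of_mem_chart {x' : X'} (hx : x' ∈ c.chart η) : η x' ∈ c.V.1 :=
  chartOpen_le η c.x c.y hx

theorem CoordNhd.germ_pull {x' : X'} (hx : x' ∈ c.chart η) (a : Γ(X, c.V.1)) :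
    X'.presheaf.germ (c.chart η) x' hx (c.pull η a) =
      η.stalkMap x' (X.presheaf.germ c.V.1 (η x') (c.mem_of_mem_chart η hx) a) :=
  germ_appLE η _ hx a

/-- The structure of the chart of the blow-up over a coordinate neighbourhood. -/
structure ChartData where
  affine : IsAffineOpen (c.chart η)
  τ : Γ(X', c.chart η)
  mul_τ : c.pull η c.x * τ = c.pull η c.y
  π : Γ(X', c.chart η) →+* Polynomial ℂ
  π_surjective : Function.Surjective π
  π_eq_zero_iff : ∀ b, π b = 0 ↔ b ∈ Ideal.span {c.pull η c.x}
  π_pull : ∀ a, π (c.pull η a) = Polynomial.C (c.ev a)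
  π_τ : π τ = Polynomial.X
  exists_eval₂ : ∀ b, ∃ g : Polynomial Γ(X, c.V.1), b = g.eval₂ (c.pull η) τ
  isUnit_germ_iff : ∀ x' (hx : x' ∈ c.chart η),
    IsUnit (X'.presheaf.germ (c.chart η) x' hx (c.pull η c.x)) ↔ η x' ≠ z

variable {η} {Z : Closeds X}

/-- Everything is transported through the isomorphism with `A[y/x]`. The reduction `π` is
restriction to the exceptional curve, with `τ` becoming the variable. The germ of `x` generates the
inverse image ideal, so it is a unit exactly off the fibre over `z`. -/
theorem CoordNhd.nonempty_chartData [IsIntegral X']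
    (hη : IsBlowUp η (Scheme.IdealSheafData.vanishingIdeal Z))
    (hZ : ∀ q ∈ c.V.1, q ∈ Z ↔ q = z) : Nonempty (ChartData c η) := by
  have hI := c.vanishingIdeal_ideal hZ
  have : Nonempty c.V.1 := ⟨⟨z, c.mem⟩⟩
  obtain ⟨τ, hτ⟩ := exists_mul_eq_on_chartOpen (x := c.x) (y := c.y) hη.isInvertible hI
  have hτ' : c.pull η c.x * τ = c.pull η c.y := hτ
  have hr : (Polynomial.C c.x * Polynomial.X - Polynomial.C c.y).eval₂ (c.pull η) τ = 0 := by
    simpa [sub_eq_zero] using hτ'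
  obtain ⟨hU, hbij⟩ : _ ∧ Function.Bijective (AdjoinRoot.lift (c.pull η) τ hr) :=
    hη.bijective_chart hI c.x_ne_zero c.dvd le_rfl _ τ hτ
  let e := RingEquiv.ofBijective _ hbij
  have he_of : ∀ a, e.symm (c.pull η a) = AdjoinRoot.of _ a := fun a => by
    rw [RingEquiv.symm_apply_eq]; exact (AdjoinRoot.lift_of hr).symm
  have he_root : e.symm τ = AdjoinRoot.root _ := by
    rw [RingEquiv.symm_apply_eq]; exact (AdjoinRoot.lift_root hr).symm
  let π₀ := BlowUpChart.toPoly c.ev c.ev_x c.ev_y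
  have hker : RingHom.ker c.ev = Ideal.span {c.x, c.y} := Ideal.ext c.ev_eq_zero_iff
  have hr₀ : (Polynomial.C c.x * Polynomial.X - Polynomial.C c.y).eval₂
      (Polynomial.C.comp c.ev) Polynomial.X = 0 := by simp [c.ev_x, c.ev_y]
  refine ⟨{
    affine := hU
    τ := τ
    mul_τ := hτ'
    π := π₀.comp e.symm.toRingHom
    π_surjective := (BlowUpChart.toPoly_surjective c.ev c.ev_x c.ev_y c.ev_surjective).comp
      e.symm.surjective
    π_eq_zero_iff := fun b => ?_
    π_pull := fun a => ?_
    π_τ := ?_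
    exists_eval₂ := fun b => ?_
    isUnit_germ_iff := fun x' hx => ?_ }⟩
  · have := SetLike.ext_iff.mp (BlowUpChart.ker_toPoly c.ev hker c.ev_x c.ev_y) (e.symm b)
    refine this.trans ?_
    rw [Ideal.mem_span_singleton, Ideal.mem_span_singleton, ← he_of]
    exact map_dvd_iff e.symm
  · change π₀ (e.symm (c.pull η a)) = _
    rw [he_of]
    exact AdjoinRoot.lift_of hr₀
  · change π₀ (e.symm τ) = _
    rw [he_root]
    exact AdjoinRoot.lift_root hr₀
  · obtain ⟨g, hg⟩ := AdjoinRoot.mk_surjective (e.symm b)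
    refine ⟨g, ?_⟩
    rw [← AdjoinRoot.lift_mk hr, hg]
    exact (e.apply_symm_apply b).symm
  · have h1 := stalkIdeal_comap_of_mem_chartOpen hI hx
    have h2 : X'.presheaf.germ (c.chart η) x' hx (c.pull η c.x) =
        X'.presheaf.germ (η ⁻¹ᵁ c.V.1) x' (chartOpen_le η _ _ hx) (η.app c.V.1 c.x) := by
      rw [c.germ_pull, germ_app]
    rw [h2, ← Ideal.span_singleton_eq_top, ← h1, stalkIdeal_eq_top_iff,
      support_comap_vanishingIdeal, hZ _ (c.mem_of_mem_chart η hx)]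

variable {c}

theorem ChartData.isPrime (K : ChartData c η) : (Ideal.span {c.pull η c.x}).IsPrime := by
  have : Ideal.span {c.pull η c.x} = RingHom.ker K.π := Ideal.ext fun b => (K.π_eq_zero_iff b).symm
  rw [this]
  exact RingHom.ker_isPrime _

/-- The generic point of the exceptional curve in the chart. -/
theorem ChartData.exists_point (K : ChartData c η) : ∃ (ξ : X') (hξ : ξ ∈ c.chart η), η ξ = z ∧
    ∀ s, IsUnit (X'.presheaf.germ _ ξ hξ s) ↔ K.π s ≠ 0 := by
  have := K.isPrime
  obtain ⟨ξ, hξ, h⟩ := exists_point_of_isPrime K.affine (Ideal.span {c.pull η c.x})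
  refine ⟨ξ, hξ, ?_, fun s => (h s).trans (K.π_eq_zero_iff s).symm.not⟩
  by_contra hne
  rw [← ne_eq, ← K.isUnit_germ_iff ξ hξ, h] at hne
  exact hne (Ideal.mem_span_singleton_self _)

theorem ChartData.not_isUnit (K : ChartData c η) {x' : X'} (hx : x' ∈ c.chart η) (hz : η x' = z) :
    ¬ IsUnit (X'.presheaf.germ _ x' hx (c.pull η c.x)) := by
  rw [K.isUnit_germ_iff]; exact not_not.mpr hz

/-- A function invertible at a point over `z` is not a multiple of `x`, so its reduction is nonzero
and it is invertible at `ξ`. Hence every neighbourhood of the point contains `ξ`. -/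
theorem ChartData.specializes (K : ChartData c η) {ξ : X'} {hξ : ξ ∈ c.chart η}
    (h : ∀ s, IsUnit (X'.presheaf.germ _ ξ hξ s) ↔ K.π s ≠ 0) {x' : X'} (hx : x' ∈ c.chart η)
    (hz : η x' = z) : ξ ⤳ x' := by
  rw [specializes_iff_forall_open]
  intro W hW hxW
  obtain ⟨s, hsW, hxs⟩ := K.affine.exists_basicOpen_le (V := ⟨W, hW⟩) ⟨x', hxW⟩ hx
  apply hsW
  rw [X'.mem_basicOpen s ξ hξ, h]
  intro h0
  rw [X'.mem_basicOpen s x' hx] at hxs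
  obtain ⟨b, rfl⟩ := Ideal.mem_span_singleton'.mp ((K.π_eq_zero_iff s).mp h0)
  rw [map_mul] at hxs
  exact K.not_isUnit hx hz (isUnit_of_mul_isUnit_right hxs)

/-- The pull-back of a function nonvanishing at the center of the blow-up. -/
theorem ChartData.isUnit_pull_iff (K : ChartData c η) {x' : X'} (hx : x' ∈ c.chart η)
    (hz : η x' = z) (a : Γ(X, c.V.1)) :
    IsUnit (X'.presheaf.germ _ x' hx (c.pull η a)) ↔ c.ev a ≠ 0 := by
  subst hz
  rw [c.germ_pull, isUnit_map_iff, ← c.isUnit_germ_iff]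

theorem ChartData.vanishingIdeal_ideal (K : ChartData c η) {E : Closeds X'}
    (hE : ∀ x', x' ∈ E ↔ η x' = z) :
    (Scheme.IdealSheafData.vanishingIdeal E).ideal ⟨c.chart η, K.affine⟩ =
      Ideal.span {c.pull η c.x} := by
  ext s
  rw [mem_vanishingIdeal_ideal_iff, ← K.π_eq_zero_iff]
  constructor
  · intro h
    obtain ⟨ξ, hξ, hz, hu⟩ := K.exists_point
    have := h ξ hξ ((hE ξ).mpr hz)
    rwa [hu, not_not] at this
  · intro h y hy hyE hu
    obtain ⟨b, rfl⟩ := Ideal.mem_span_singleton'.mp ((K.π_eq_zero_iff s).mp h)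
    rw [map_mul] at hu
    exact K.not_isUnit hy ((hE y).mp hyE) (isUnit_of_mul_isUnit_right hu)

theorem ChartData.isLocalEquation (K : ChartData c η) {E : Closeds X'}
    (hE : ∀ x', x' ∈ E ↔ η x' = z) {x' : X'} (hx : x' ∈ c.chart η) :
    IsLocalEquation E x' (X'.presheaf.germ _ x' hx (c.pull η c.x)) := by
  rw [IsLocalEquation, stalkIdeal_eq_map _ ⟨c.chart η, K.affine⟩ hx, K.vanishingIdeal_ideal hE,
    Ideal.map_span, Set.image_singleton]

end Coord

/-! ### The exceptional curves -/

section StandardSmoothPolynomial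

/-- One generator and no relations: the Jacobian is the determinant of an empty matrix, namely `1`.
-/
theorem isStandardSmooth_polynomial (R : Type) [CommRing R] :
    Algebra.IsStandardSmoothOfRelativeDimension 1 R (Polynomial R) := by
  let v : PEmpty.{1} → MvPolynomial PUnit.{1} R := PEmpty.elim
  let P := Algebra.PreSubmersivePresentation.naive (R := R) (v := v) PEmpty.elim
    (fun a => a.elim)
  have hP : Algebra.IsStandardSmoothOfRelativeDimension 1 R
      (MvPolynomial PUnit.{1} R ⧸ Ideal.span (Set.range v)) := by
    refine ⟨PUnit, PEmpty, inferInstance, inferInstance, { P with jacobian_isUnit := ?_ }, ?_⟩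
    · rw [Algebra.PreSubmersivePresentation.jacobian_eq_jacobiMatrix_det, Matrix.det_isEmpty,
        map_one]
      exact isUnit_one
    · simp [Algebra.Presentation.dimension]
  have hv : Ideal.span (Set.range v) = ⊥ := by simp [Set.range_eq_empty]
  let e : (MvPolynomial PUnit.{1} R ⧸ Ideal.span (Set.range v)) ≃ₐ[R] Polynomial R :=
    ((Ideal.quotientEquivAlgOfEq R hv).trans (AlgEquiv.quotientBot R _)).trans
      (MvPolynomial.uniqueAlgEquiv R PUnit)
  exact Algebra.IsStandardSmoothOfRelativeDimension.of_algEquiv 1 e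

theorem exists_ringEquiv_of_ker_eq {R A B : Type} [CommRing R] [CommRing A] [CommRing B]
    {f : R →+* A} {g : R →+* B} (hf : Function.Surjective f) (hg : Function.Surjective g)
    (h : RingHom.ker f = RingHom.ker g) : ∃ e : A ≃+* B, ∀ r, e (f r) = g r := by
  refine ⟨(RingHom.quotientKerEquivOfSurjective hf).symm.trans ((Ideal.quotEquivOfEq h).trans
    (RingHom.quotientKerEquivOfSurjective hg)), fun r => ?_⟩
  have : (RingHom.quotientKerEquivOfSurjective hf).symm (f r) = Ideal.Quotient.mk _ r := by
    rw [RingEquiv.symm_apply_eq]; simp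
  simp [this]

end StandardSmoothPolynomial

section Exceptional

variable {X X' : Scheme.{0}} [IsIntegral X] {p : X ⟶ SpecC} {η : X' ⟶ X} {z : X}

theorem mem_chart_or {c : CoordNhd p z} {Z : Closeds X}
    (hη : IsBlowUp η (Scheme.IdealSheafData.vanishingIdeal Z))
    (hZ : ∀ q ∈ c.V.1, q ∈ Z ↔ q = z) {x' : X'} (hx' : η x' ∈ c.V.1) :
    x' ∈ c.chart η ∨ x' ∈ c.swap.chart η :=
  mem_chartOpen_or hη.isInvertible (c.vanishingIdeal_ideal hZ) hx'

/-- The reduction of `τ` is the variable, which is nonzero. So `τ` is a unit at the generic point of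
the exceptional curve, and there `y = x τ` divides `x`. -/
theorem ChartData.mem_swap_chart {c : CoordNhd p z} (K : ChartData c η)
    {ξ : X'} (hξ : ξ ∈ c.chart η)
    (h : ∀ s, IsUnit (X'.presheaf.germ _ ξ hξ s) ↔ K.π s ≠ 0) : ξ ∈ c.swap.chart η := by
  have hV : ξ ∈ η ⁻¹ᵁ c.V.1 := c.mem_of_mem_chart η hξ
  have hτ : IsUnit (X'.presheaf.germ _ ξ hξ K.τ) := by
    rw [h, K.π_τ]; exact Polynomial.X_ne_zero
  have e := congrArg (X'.presheaf.germ _ ξ hξ) K.mul_τ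
  rw [map_mul, c.germ_pull, c.germ_pull, ← germ_app η hV, ← germ_app η hV] at e
  refine (mem_chartOpen (η := η) (V := c.V.1) (x := c.y) (y := c.x) hV).mpr ?_
  rw [← e, Ideal.mem_span_singleton, hτ.mul_right_dvd]

/-- The generic point of the exceptional curve lies in both charts. -/
theorem ChartData.exists_generic {c : CoordNhd p z} {Z : Closeds X}
    (K : ChartData c η) (K' : ChartData c.swap η)
    (hη : IsBlowUp η (Scheme.IdealSheafData.vanishingIdeal Z))
    (hZ : ∀ q ∈ c.V.1, q ∈ Z ↔ q = z) : ∃ (ξ : X') (hξ : ξ ∈ c.chart η), η ξ = z ∧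
      (∀ s, IsUnit (X'.presheaf.germ _ ξ hξ s) ↔ K.π s ≠ 0) ∧ ∀ x', η x' = z → ξ ⤳ x' := by
  obtain ⟨ξ, hξ, hz, h⟩ := K.exists_point
  obtain ⟨ξ', hξ', hz', h'⟩ := K'.exists_point
  refine ⟨ξ, hξ, hz, h, fun x' hx' => ?_⟩
  rcases mem_chart_or (c := c) hη hZ (x' := x') (by rw [hx']; exact c.mem) with hx | hx
  · exact K.specializes h hx hx'
  -- The generic point of the second chart also lies in the first, so specializations can be
  -- composed.
  · exact (K.specializes h (K'.mem_swap_chart hξ' h') hz').trans (K'.specializes h' hx hx')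

theorem pull_structMap {c : CoordNhd p z} (t : ℂ) :
    c.pull η (structMap p c.V.1 t) = structMap (η ≫ p) (c.chart η) t := by
  have e : p.appLE ⊤ c.V.1 le_top ≫ η.appLE c.V.1 (c.chart η) (chartOpen_le η c.x c.y) =
      (η ≫ p).appLE ⊤ (c.chart η) le_top := Scheme.Hom.appLE_comp_appLE _ _ _ _ _ _ _
  exact congrArg (fun f => f.hom ((Scheme.ΓSpecIso (CommRingCat.of ℂ)).inv.hom t)) e

/-- Restriction to `E` and `π` have the same kernel, so the coordinate ring of `E` in the chart is a
polynomial ring in one variable, as an algebra over `ℂ`. -/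
theorem isStandardSmooth_subscheme {c : CoordNhd p z} (K : ChartData c η) {E : Closeds X'}
    (hE : ∀ x', x' ∈ E ↔ η x' = z) :
    ((((Scheme.IdealSheafData.vanishingIdeal E).subschemeι ≫ η ≫ p).appLE ⊤
      ((Scheme.IdealSheafData.vanishingIdeal E).subschemeι ⁻¹ᵁ c.chart η) le_top).hom
        ).IsStandardSmoothOfRelativeDimension 1 := by
  let U : X'.affineOpens := ⟨c.chart η, K.affine⟩
  let I := Scheme.IdealSheafData.vanishingIdeal E
  have hker : RingHom.ker (I.subschemeι.app U).hom = RingHom.ker K.π := by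
    rw [Scheme.IdealSheafData.ker_subschemeι_app, K.vanishingIdeal_ideal hE]
    exact Ideal.ext fun b => (K.π_eq_zero_iff b).symm
  obtain ⟨e, he⟩ := exists_ringEquiv_of_ker_eq (I.subschemeι_app_surjective U) K.π_surjective hker
  have h1 : ∀ t, e (structMap (I.subschemeι ≫ η ≫ p) (I.subschemeι ⁻¹ᵁ c.chart η) t) =
      Polynomial.C t := by
    intro t
    have e1 : (η ≫ p).appLE ⊤ (c.chart η) le_top ≫ I.subschemeι.app (c.chart η) =
        (I.subschemeι ≫ η ≫ p).appLE ⊤ (I.subschemeι ⁻¹ᵁ c.chart η) le_top := by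
      rw [Scheme.Hom.app_eq_appLE]; exact Scheme.Hom.appLE_comp_appLE _ _ _ _ _ _ _
    have e2 := congrArg (fun f => f.hom ((Scheme.ΓSpecIso (CommRingCat.of ℂ)).inv.hom t)) e1
    have e3 : I.subschemeι.app (c.chart η) (structMap (η ≫ p) (c.chart η) t) =
      structMap (I.subschemeι ≫ η ≫ p) (I.subschemeι ⁻¹ᵁ c.chart η) t := e2
    rw [← e3, ← pull_structMap]
    refine (he _).trans ?_
    rw [K.π_pull, c.ev_structMap]
  have h2 : (structMap (I.subschemeι ≫ η ≫ p)
      (I.subschemeι ⁻¹ᵁ c.chart η)).IsStandardSmoothOfRelativeDimension 1 := by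
    have h3 : (algebraMap ℂ (Polynomial ℂ)).IsStandardSmoothOfRelativeDimension 1 := by
      rw [RingHom.isStandardSmoothOfRelativeDimension_algebraMap]
      exact isStandardSmooth_polynomial ℂ
    convert RingHom.isStandardSmoothOfRelativeDimension_respectsIso.1 _ e.symm h3
    refine RingHom.ext fun t => ?_
    exact (e.symm_apply_eq.mpr (h1 t).symm).symm
  have h4 := RingHom.isStandardSmoothOfRelativeDimension_respectsIso.2 _
    (Scheme.ΓSpecIso (CommRingCat.of ℂ)).commRingCatIsoToRingEquiv h2
  convert h4 using 1
  refine RingHom.ext fun t => ?_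
  change _ = ((I.subschemeι ≫ η ≫ p).appLE ⊤
      (I.subschemeι ⁻¹ᵁ c.chart η) le_top).hom ((Scheme.ΓSpecIso (CommRingCat.of ℂ)).inv.hom
        ((Scheme.ΓSpecIso (CommRingCat.of ℂ)).hom.hom t))
  simp; rfl

theorem isSmoothCurve_exceptional {c : CoordNhd p z} {Z : Closeds X}
    (K : ChartData c η) (K' : ChartData c.swap η)
    (hη : IsBlowUp η (Scheme.IdealSheafData.vanishingIdeal Z))
    (hZ : ∀ q ∈ c.V.1, q ∈ Z ↔ q = z) {E : Closeds X'} (hE : ∀ x', x' ∈ E ↔ η x' = z) :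
    IsSmoothCurve (η ≫ p) E := by
  constructor
  · obtain ⟨ξ, hξ, hz, -, hsp⟩ := K.exists_generic K' hη hZ
    have : (E : Set X') = closure {ξ} := by
      apply Set.Subset.antisymm
      · intro y hy
        exact specializes_iff_mem_closure.mp (hsp y ((hE y).mp hy))
      · exact closure_minimal (Set.singleton_subset_iff.mpr ((hE ξ).mpr hz)) E.isClosed
    rw [this]
    exact isIrreducible_singleton.closure
  · constructor
    intro s
    have hs : (Scheme.IdealSheafData.vanishingIdeal E).subschemeι s ∈ E := by
      have : (Scheme.IdealSheafData.vanishingIdeal E).subschemeι s ∈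
          Set.range (Scheme.IdealSheafData.vanishingIdeal E).subschemeι := ⟨s, rfl⟩
      rwa [Scheme.IdealSheafData.range_subschemeι,
        Scheme.IdealSheafData.coe_support_vanishingIdeal] at this
    have hV : η ((Scheme.IdealSheafData.vanishingIdeal E).subschemeι s) ∈ c.V.1 := by
      rw [(hE _).mp hs]; exact c.mem
    rcases mem_chart_or (c := c) hη hZ hV with h | h
    · exact ⟨⊤, isAffineOpen_top _, _, K.affine.preimage _, h, le_top,
        isStandardSmooth_subscheme K hE⟩
    · exact ⟨⊤, isAffineOpen_top _, _, K'.affine.preimage _, h, le_top,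
        isStandardSmooth_subscheme K' hE⟩

/-- The other points of `Z` form a finite union of closed points, which can be removed from the
neighbourhood. -/
theorem exists_coordNhd_of_mem [SmoothOfRelativeDimension 2 p] {Z : Closeds X}
    (hZ : (Z : Set X).Finite) (hZ' : ∀ z ∈ Z, IsClosed ({z} : Set X)) (hz : z ∈ Z) {N : X.Opens}
    (hN : z ∈ N) : ∃ c : CoordNhd p z, c.V.1 ≤ N ∧ ∀ q ∈ c.V.1, q ∈ Z ↔ q = z := by
  have hcl : IsClosed ((Z : Set X) \ {z}) := by
    rw [← Set.biUnion_of_singleton ((Z : Set X) \ {z})]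
    exact (hZ.subset Set.sdiff_subset).isClosed_biUnion fun q hq => hZ' q hq.1
  obtain ⟨c, hc⟩ := exists_coordNhd p (hZ' z hz)
    (N := N ⊓ ⟨((Z : Set X) \ {z})ᶜ, hcl.isOpen_compl⟩)
    (Opens.mem_inf.mpr ⟨hN, fun h => h.2 rfl⟩)
  refine ⟨c, hc.trans inf_le_left, fun q hq => ⟨fun hqZ => ?_, fun h => h ▸ hz⟩⟩
  by_contra hne
  exact (hc.trans inf_le_right) hq ⟨hqZ, hne⟩

end Exceptional

/-! ### The blow-up is locally of finite type, which supplies closed points and Noetherian stalks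
upstairs. -/

section FiniteType

variable {X X' : Scheme.{0}} [IsIntegral X] {p : X ⟶ SpecC} {η : X' ⟶ X}

theorem ChartData.locallyOfFiniteType {z : X} {c : CoordNhd p z} (K : ChartData c η) :
    LocallyOfFiniteType ((c.chart η).ι ≫ η) := by
  have hV : IsAffineOpen c.V.1 := c.V.2
  have hft : (c.pull η).FiniteType := by
    have h1 : (Polynomial.eval₂RingHom (c.pull η) K.τ).FiniteType :=
      RingHom.FiniteType.of_surjective _ fun b => (K.exists_eval₂ b).imp fun g hg => hg.symm
    have h2 : (algebraMap Γ(X, c.V.1) (Polynomial Γ(X, c.V.1))).FiniteType :=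
      RingHom.finiteType_algebraMap.mpr inferInstance
    convert h1.comp h2
    ext; simp
  have : LocallyOfFiniteType (Spec.map (η.appLE c.V.1 (c.chart η) (chartOpen_le η c.x c.y))) :=
    (HasRingHomProperty.Spec_iff (P := @LocallyOfFiniteType)).mpr hft
  rw [← K.affine.toSpecΓ_fromSpec, Category.assoc, ← hV.SpecMap_appLE_fromSpec η K.affine
    (chartOpen_le η c.x c.y)]
  have : IsIso (c.chart η).toSpecΓ := by
    rw [← K.affine.isoSpec_hom]; infer_instance
  infer_instance

theorem IsBlowUp.locallyOfFiniteType [IsIntegral X'] [SmoothOfRelativeDimension 2 p] {Z : Closeds X}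
    (hZ : (Z : Set X).Finite) (hZ' : ∀ z ∈ Z, IsClosed ({z} : Set X))
    (hη : IsBlowUp η (Scheme.IdealSheafData.vanishingIdeal Z)) : LocallyOfFiniteType η := by
  have key : ∀ x' : X', ∃ W : X'.Opens, x' ∈ W ∧ LocallyOfFiniteType (W.ι ≫ η) := by
    intro x'
    by_cases h : η x' ∈ Z
    · obtain ⟨c, -, hc⟩ := exists_coordNhd_of_mem (p := p) hZ hZ' h (N := ⊤) trivial
      have hc' : ∀ q ∈ c.swap.V.1, q ∈ Z ↔ q = η x' := hc
      obtain ⟨K⟩ := c.nonempty_chartData hη hc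
      obtain ⟨K'⟩ := c.swap.nonempty_chartData hη hc'
      rcases mem_chart_or (c := c) hη hc c.mem with h | h
      exacts [⟨_, h, K.locallyOfFiniteType⟩, ⟨_, h, K'.locallyOfFiniteType⟩]
    · have := hη.isIso_restrict
      have := isOpenImmersion_ι_comp η (complOpens Z)
      exact ⟨η ⁻¹ᵁ complOpens Z, h, inferInstance⟩
  choose W hW hft using key
  rw [IsZariskiLocalAtSource.iff_of_iSup_eq_top
    (P := show MorphismProperty Scheme.{0} from @LocallyOfFiniteType) W]
  · exact hft
  · exact top_unique fun x' _ => Opens.mem_iSup.mpr ⟨x', hW x'⟩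

end FiniteType

/-! ### Generators of logarithmic forms -/

section LogGenerators

variable {X : Scheme.{0}} [IsIntegral X] {p : X ⟶ SpecC} {D : Set (Closeds X)} {q : X}

theorem ratD_one : ratD p 1 = 0 := by
  have := ratD_mul (p := p) 1 1
  simpa using this

theorem logStalk_eq_empty (h : ∀ C ∈ D, q ∉ C) : logStalk p D q = logStalk p ∅ q := by
  refine congrArg (Submodule.span _) (congrArg₂ _ rfl ?_)
  ext ω
  constructor
  · rintro ⟨C, hC, hq, -⟩; exact absurd hq (h C hC)
  · rintro ⟨C, hC, -⟩; exact absurd hC (Set.notMem_empty C)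

theorem logStalk_empty_le : logStalk p ∅ q ≤ logStalk p D q :=
  Submodule.span_mono (Set.union_subset_union_right _ fun _ ⟨_, hC, _⟩ =>
    absurd hC (Set.notMem_empty _))

/-- The logarithmic derivative is additive on products. Changing a local equation by a unit changes
`df / f` by a regular form. -/
theorem logForm_mul_unit {f : X.presheaf.stalk q} (hf : f ≠ 0) (u : (X.presheaf.stalk q)ˣ) :
    (algebraMap _ X.functionField (f * u))⁻¹ • ratD p (algebraMap _ X.functionField (f * u)) =
      (algebraMap _ X.functionField f)⁻¹ • ratD p (algebraMap _ X.functionField f) +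
        (↑u⁻¹ : X.presheaf.stalk q) •
          ratD p (algebraMap _ X.functionField (u : X.presheaf.stalk q)) := by
  have hf' : algebraMap _ X.functionField f ≠ 0 := by
    simpa using (algebraMap_stalk_injective q).ne hf
  have hu : algebraMap (X.presheaf.stalk q) X.functionField u ≠ 0 :=
    (u.isUnit.map (algebraMap _ X.functionField)).ne_zero
  have hinv : algebraMap (X.presheaf.stalk q) X.functionField (↑u⁻¹ : X.presheaf.stalk q) =
      (algebraMap (X.presheaf.stalk q) X.functionField u)⁻¹ := by
    refine eq_inv_of_mul_eq_one_left ?_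
    rw [← map_mul, Units.inv_mul, map_one]
  rw [map_mul, ratD_mul, stalk_smul_def, hinv, smul_add, smul_smul, smul_smul, add_comm]
  congr 2
  all_goals field_simp

theorem logForm_mem {C : Closeds X} (hC : C ∈ D) (hq : q ∈ C) {f : X.presheaf.stalk q}
    (hf : IsLocalEquation C q f) :
    (algebraMap _ X.functionField f)⁻¹ • ratD p (algebraMap _ X.functionField f) ∈ logStalk p D q :=
  Submodule.subset_span (Or.inr ⟨C, hC, hq, f, hf, rfl⟩)

/-- When the equation `f` of the only member through the point is part of a coordinate frame, `df`
may be replaced by `df / f`. Other equations of that member give the same form up to a regular one.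
-/
theorem logStalk_eq_span_of_unique {E : Closeds X} (hE : E ∈ D) (hq : q ∈ E)
    (h : ∀ C ∈ D, q ∈ C → C = E) {f : X.presheaf.stalk q} (hf : IsLocalEquation E q f) (hf0 : f ≠ 0)
    {w : RationalForms p} (hw : logStalk p ∅ q =
      Submodule.span (X.presheaf.stalk q) {ratD p (algebraMap _ X.functionField f), w}) :
    logStalk p D q = Submodule.span (X.presheaf.stalk q)
      {(algebraMap _ X.functionField f)⁻¹ • ratD p (algebraMap _ X.functionField f), w} := by
  have hf' : algebraMap _ X.functionField f ≠ 0 := by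
    simpa using (algebraMap_stalk_injective q).ne hf0
  have hle : logStalk p ∅ q ≤ Submodule.span (X.presheaf.stalk q)
      {(algebraMap _ X.functionField f)⁻¹ • ratD p (algebraMap _ X.functionField f), w} := by
    rw [hw, Submodule.span_le]
    rintro _ (rfl | rfl)
    · have := Submodule.smul_mem (Submodule.span (X.presheaf.stalk q)
        {(algebraMap _ X.functionField f)⁻¹ • ratD p (algebraMap _ X.functionField f), w}) f
          (Submodule.subset_span (Set.mem_insert _ _))
      rwa [stalk_smul_def, smul_smul, mul_inv_cancel₀ hf', one_smul] at this
    · exact Submodule.subset_span (by simp)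
  apply le_antisymm
  · refine Submodule.span_le.mpr ?_
    rintro _ (⟨a, rfl⟩ | ⟨C, hC, hqC, g, hg, rfl⟩)
    · exact hle (ratD_mem_logStalk ∅ q a)
    · obtain rfl := h C hC hqC
      obtain ⟨u, rfl⟩ := hf.mul_unit hg
      rw [SetLike.mem_coe, logForm_mul_unit hf0]
      exact add_mem (Submodule.subset_span (by simp))
        (Submodule.smul_mem _ _ (hle (ratD_mem_logStalk ∅ q _)))
  · rw [Submodule.span_le]
    rintro _ (rfl | rfl)
    · exact logForm_mem hE hq hf
    · exact logStalk_empty_le (hw ▸ Submodule.subset_span (by simp))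

/-- The differentials of generators of the maximal ideal generate the regular forms. -/
theorem logStalk_empty_eq_span_of_generators {z : Fin 2 → X.presheaf.stalk q}
    (hz : Ideal.span (Set.range z) = IsLocalRing.maximalIdeal (X.presheaf.stalk q))
    (hres : ∀ a : X.presheaf.stalk q, ∃ b ∈ IsLocalRing.maximalIdeal (X.presheaf.stalk q),
      ratD p (algebraMap _ X.functionField a) = ratD p (algebraMap _ X.functionField b))
    (hfg : (logStalk p ∅ q).FG) : logStalk p ∅ q = Submodule.span (X.presheaf.stalk q)
      {ratD p (algebraMap _ X.functionField (z 0)),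
        ratD p (algebraMap _ X.functionField (z 1))} := by
  apply le_antisymm
  · refine Submodule.le_of_le_smul_of_le_jacobson_bot hfg
      (IsLocalRing.maximalIdeal_le_jacobson (R := X.presheaf.stalk q) ⊥) ?_
    refine Submodule.span_le.mpr ?_
    rintro _ (⟨a, rfl⟩ | ⟨C, hC, -⟩)
    · obtain ⟨b, hb, e⟩ := hres a
      change ratD p (algebraMap _ X.functionField a) ∈ _
      rw [e]
      have hz' : Set.range z = {z 0, z 1} := by
        ext; simp [Fin.exists_fin_two, eq_comm]
      have hb' := hb
      rw [← hz, hz'] at hb'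
      obtain ⟨s, t, rfl⟩ := Ideal.mem_span_pair.mp hb'
      have hzm : ∀ i, z i ∈ IsLocalRing.maximalIdeal (X.presheaf.stalk q) := fun i =>
        hz ▸ Ideal.subset_span ⟨i, rfl⟩
      simp only [map_add, map_mul, ratD_add, ratD_mul]
      simp only [← stalk_smul_def]
      refine add_mem (add_mem ?_ ?_) (add_mem ?_ ?_)
      · exact Submodule.mem_sup_left (Submodule.smul_mem _ _ (Submodule.subset_span (by simp)))
      · exact Submodule.mem_sup_right (Submodule.smul_mem_smul (hzm 0) (ratD_mem_logStalk ∅ q s))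
      · exact Submodule.mem_sup_left (Submodule.smul_mem _ _ (Submodule.subset_span (by simp)))
      · exact Submodule.mem_sup_right (Submodule.smul_mem_smul (hzm 1) (ratD_mem_logStalk ∅ q t))
    · exact absurd hC (Set.notMem_empty C)
  · rw [Submodule.span_le]
    rintro _ (rfl | rfl)
    exacts [ratD_mem_logStalk ∅ q _, ratD_mem_logStalk ∅ q _]

/-- At a closed point, the logarithmic forms are free, and the determinant of generators is
given by the product of the local equations. -/
theorem exists_logStalk_eq_span (hirr : ∀ C ∈ D, IsIrreducible (C : Set X))
    (hsnc : ∃ z : Fin 2 → X.presheaf.stalk q,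
      Ideal.span (Set.range z) = IsLocalRing.maximalIdeal (X.presheaf.stalk q) ∧
      ∀ C ∈ D, q ∈ C → ∃ j, IsLocalEquation C q (z j))
    (hres : ∀ a : X.presheaf.stalk q, ∃ b ∈ IsLocalRing.maximalIdeal (X.presheaf.stalk q),
      ratD p (algebraMap _ X.functionField a) = ratD p (algebraMap _ X.functionField b))
    (β : Module.Basis (Fin 2) X.functionField (RationalForms p)) {w₀ w₁ : RationalForms p}
    (hw : logStalk p ∅ q = Submodule.span (X.presheaf.stalk q) {w₀, w₁})
    (hw0 : wedge β w₀ w₁ ≠ 0) :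
    ∃ (v₀ v₁ : RationalForms p) (e : X.presheaf.stalk q) (u : (X.presheaf.stalk q)ˣ),
      logStalk p D q = Submodule.span (X.presheaf.stalk q) {v₀, v₁} ∧
      algebraMap _ X.functionField e * wedge β v₀ v₁ =
        algebraMap (X.presheaf.stalk q) X.functionField u * wedge β w₀ w₁ ∧ e ≠ 0 ∧
      (algebraMap _ X.functionField e)⁻¹ • ratD p (algebraMap _ X.functionField e) ∈
        logStalk p D q ∧
      (∀ C ∈ D, q ∈ C → ∀ f, IsLocalEquation C q f → f ∣ e) ∧
      ∀ C ∈ D, q ∈ C → ∀ f, IsLocalEquation C q f → ∀ C' ∈ D, q ∈ C' → ∀ f',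
        IsLocalEquation C' q f' → C ≠ C' → f * f' ∣ e := by
  obtain ⟨z, hz, hzD⟩ := hsnc
  have hΩ := logStalk_empty_eq_span_of_generators hz hres (by
    rw [hw]; exact Submodule.fg_span (by simp))
  obtain ⟨u, hu⟩ := exists_wedge_eq_unit β (hΩ.symm.trans hw) hw0
  have hwz : wedge β (ratD p (algebraMap _ X.functionField (z 0)))
      (ratD p (algebraMap _ X.functionField (z 1))) ≠ 0 := by
    rw [hu]
    exact mul_ne_zero (u.isUnit.map (algebraMap _ X.functionField)).ne_zero hw0
  have hz0 : ∀ j, z j ≠ 0 := by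
    intro j hj
    apply hwz
    fin_cases j
    · change z 0 = 0 at hj
      simp [hj, ratD_zero, wedge]
    · change z 1 = 0 at hj
      simp [hj, ratD_zero, wedge]
  classical
  -- `J j` says that the `j`-th coordinate cuts out a member through the point. Then `g j` is that
  -- coordinate, and `1` otherwise, so the frame is `dz_j / g_j` and `e` is `g 0 * g 1`.
  let J : Fin 2 → Prop := fun j => ∃ C ∈ D, q ∈ C ∧ IsLocalEquation C q (z j)
  let g : Fin 2 → X.presheaf.stalk q := fun j => if J j then z j else 1
  have hgJ : ∀ j, J j → g j = z j := fun j h => if_pos h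
  have hgJ' : ∀ j, ¬ J j → g j = 1 := fun j h => if_neg h
  have hg0 : ∀ j, g j ≠ 0 := fun j => by
    by_cases h : J j
    · rw [hgJ j h]; exact hz0 j
    · rw [hgJ' j h]; exact one_ne_zero
  have hg0' : ∀ j, algebraMap _ X.functionField (g j) ≠ 0 := fun j => by
    simpa using (algebraMap_stalk_injective q).ne (hg0 j)
  let v : Fin 2 → RationalForms p := fun j =>
    (algebraMap _ X.functionField (g j))⁻¹ • ratD p (algebraMap _ X.functionField (z j))
  have hgv : ∀ j, g j • v j = ratD p (algebraMap _ X.functionField (z j)) := fun j => by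
    rw [stalk_smul_def, smul_smul, mul_inv_cancel₀ (hg0' j), one_smul]
  have hvmem : ∀ j, v j ∈ logStalk p D q := fun j => by
    by_cases h : J j
    · obtain ⟨C, hC, hq, hf⟩ := h
      have := logForm_mem (p := p) hC hq hf
      simp only [v]
      rwa [hgJ j ⟨C, hC, hq, hf⟩]
    · simp only [v, hgJ' j h, map_one, inv_one, one_smul]
      exact ratD_mem_logStalk D q _
  have hvspan : ∀ j, v j ∈ Submodule.span (X.presheaf.stalk q) {v 0, v 1} := fun j => by
    apply Submodule.subset_span
    fin_cases j <;> simp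
  have hle : logStalk p ∅ q ≤ Submodule.span (X.presheaf.stalk q) {v 0, v 1} := by
    rw [hΩ, Submodule.span_le]
    rintro _ (rfl | rfl)
    · rw [← hgv]; exact Submodule.smul_mem _ _ (hvspan 0)
    · rw [← hgv]; exact Submodule.smul_mem _ _ (hvspan 1)
  have hdvd : ∀ j, J j → z j ∣ g 0 * g 1 := fun j h => by
    rw [← hgJ j h]
    fin_cases j
    · exact dvd_mul_right _ _
    · exact dvd_mul_left _ _
  refine ⟨v 0, v 1, g 0 * g 1, u, le_antisymm ?_ ?_, ?_, mul_ne_zero (hg0 0) (hg0 1), ?_, ?_, ?_⟩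
  · refine Submodule.span_le.mpr ?_
    rintro _ (⟨a, rfl⟩ | ⟨C, hC, hqC, f, hf, rfl⟩)
    · exact hle (ratD_mem_logStalk ∅ q a)
    · obtain ⟨j, hj⟩ := hzD C hC hqC
      obtain ⟨w, rfl⟩ := hj.mul_unit hf
      rw [SetLike.mem_coe, logForm_mul_unit (hz0 j)]
      refine add_mem ?_ (Submodule.smul_mem _ _ (hle (ratD_mem_logStalk ∅ q _)))
      have := hvspan j
      simp only [v] at this
      rwa [hgJ j ⟨C, hC, hqC, hj⟩] at this
  · rw [Submodule.span_le]
    rintro _ (rfl | rfl)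
    exacts [hvmem 0, hvmem 1]
  · rw [← hu, map_mul]
    conv_rhs => rw [← hgv, ← hgv, stalk_smul_def, stalk_smul_def, wedge_smul_smul]
  · have key : ∀ j, (algebraMap _ X.functionField (g j))⁻¹ •
        ratD p (algebraMap _ X.functionField (g j)) ∈ logStalk p D q := fun j => by
      by_cases h : J j
      · have := hvmem j
        simp only [v] at this
        rw [hgJ j h] at this ⊢
        exact this
      · rw [hgJ' j h, map_one, ratD_one, smul_zero]; exact zero_mem _
    have := add_mem (key 0) (key 1)
    convert this using 1
    rw [map_mul, ratD_mul, smul_add, smul_smul, smul_smul, add_comm]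
    have h0 := hg0' 0
    have h1 := hg0' 1
    congr 2 <;> field_simp
  · intro C hC hqC f hf
    obtain ⟨j, hj⟩ := hzD C hC hqC
    obtain ⟨w, hw⟩ := hf.mul_unit hj
    exact (hw ▸ dvd_mul_right f _ : f ∣ z j).trans (hdvd j ⟨C, hC, hqC, hj⟩)
  · intro C hC hqC f hf C' hC' hqC' f' hf' hne
    obtain ⟨j, hj⟩ := hzD C hC hqC
    obtain ⟨j', hj'⟩ := hzD C' hC' hqC'
    -- Irreducible members with the same ideal at a common point coincide, so distinct members use
    -- both coordinates and `e` is their product.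
    have hjj : j ≠ j' := by
      rintro rfl
      exact hne (le_antisymm (le_of_stalkIdeal_le (hirr C hC) hqC (hj'.trans hj.symm).le)
        (le_of_stalkIdeal_le (hirr C' hC') hqC' (hj.trans hj'.symm).le))
    have hJ : ∀ i, J i := by
      intro i
      have : i = j ∨ i = j' := by omega
      rcases this with rfl | rfl
      exacts [⟨C, hC, hqC, hj⟩, ⟨C', hC', hqC', hj'⟩]
    obtain ⟨w, rfl⟩ := hj.mul_unit hf
    obtain ⟨w', rfl⟩ := hj'.mul_unit hf'
    have : g 0 * g 1 = z j * z j' := by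
      rw [hgJ 0 (hJ 0), hgJ 1 (hJ 1)]
      fin_cases j <;> fin_cases j' <;> simp_all [mul_comm]
    rw [this]
    refine ⟨↑w⁻¹ * ↑w'⁻¹, ?_⟩
    have h1 := w.mul_inv
    have h2 := w'.mul_inv
    linear_combination (-(z j * z j') * ↑w' * ↑w'⁻¹) * h1 - (z j * z j') * h2

end LogGenerators

/-! ### Extension of functions over points -/

section Extension

variable {X : Scheme.{0}}

theorem exists_isClosed_specializes [JacobsonSpace X] {V : X.Opens} {q : X} (hq : q ∈ V) :
    ∃ q₀ ∈ V, IsClosed ({q₀} : Set X) ∧ q ⤳ q₀ := by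
  obtain ⟨q₀, ⟨hV, hcl⟩, h⟩ := nonempty_inter_closedPoints (Z := (V : Set X) ∩ closure {q})
    ⟨q, hq, subset_closure rfl⟩ (V.isOpen.isLocallyClosed.inter isClosed_closure.isLocallyClosed)
  exact ⟨q₀, hV, h, specializes_iff_mem_closure.mpr hcl⟩

theorem finiteType_structMap (p : X ⟶ SpecC) [LocallyOfFiniteType p] {V : X.Opens}
    (hV : IsAffineOpen V) : (structMap p V).FiniteType := by
  have h1 : (p.appLE ⊤ V le_top).hom.FiniteType :=
    HasRingHomProperty.appLE (P := @LocallyOfFiniteType) p inferInstance ⟨⊤, isAffineOpen_top _⟩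
      ⟨V, hV⟩ le_top
  exact h1.comp (RingHom.FiniteType.of_surjective _
    (Scheme.ΓSpecIso (CommRingCat.of ℂ)).symm.commRingCatIsoToRingEquiv.surjective)

variable [IsIntegral X]

theorem exists_algebraMap_eq_of_specializes {q q₀ : X} (h : q ⤳ q₀) {k : X.functionField}
    (hk : ∃ a : X.presheaf.stalk q₀, k = algebraMap _ X.functionField a) :
    ∃ a : X.presheaf.stalk q, k = algebraMap _ X.functionField a := by
  obtain ⟨a, rfl⟩ := hk
  obtain ⟨U, hU, s, rfl⟩ := X.presheaf.exists_germ_eq a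
  have hq : q ∈ U := h.mem_open U.isOpen hU
  exact ⟨X.presheaf.germ U q hq s, algebraMap_germ_eq hU hq s⟩

variable {p : X ⟶ SpecC}

/-- The residue field at a closed point is `ℂ`, so every germ differs from an element of the maximal
ideal by a constant, whose differential is zero. -/
theorem exists_ratD_eq [LocallyOfFiniteType p] {q : X} (hq : IsClosed ({q} : Set X))
    (a : X.presheaf.stalk q) : ∃ b ∈ IsLocalRing.maximalIdeal (X.presheaf.stalk q),
      ratD p (algebraMap _ X.functionField a) = ratD p (algebraMap _ X.functionField b) := by
  obtain ⟨⟨V, hV⟩, hqV, -⟩ := exists_affineOpen_le (U := (⊤ : X.Opens)) (x := q) trivial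
  have hV : IsAffineOpen V := hV
  change q ∈ V at hqV
  obtain ⟨ev, hev, hu⟩ := exists_ev p hq hV hqV (finiteType_structMap p hV)
  let : Algebra Γ(X, V) (X.presheaf.stalk q) := (X.presheaf.germ V q hqV).hom.toAlgebra
  have : IsLocalization.AtPrime (X.presheaf.stalk q) (hV.primeIdealOf ⟨q, hqV⟩).asIdeal :=
    hV.isLocalization_stalk ⟨q, hqV⟩
  obtain ⟨⟨s, t⟩, hst⟩ := IsLocalization.surj (hV.primeIdealOf ⟨q, hqV⟩).asIdeal.primeCompl a
  have ht : IsUnit (X.presheaf.germ V q hqV t.1) := IsLocalization.map_units (X.presheaf.stalk q) t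
  have hst : a * X.presheaf.germ V q hqV t.1 = X.presheaf.germ V q hqV s := hst
  have hev0 : ev t.1 ≠ 0 := (hu _).mp ht
  let r := structMap p V (ev s / ev t.1)
  refine ⟨a - X.presheaf.germ V q hqV r, ?_, ?_⟩
  · rw [IsLocalRing.mem_maximalIdeal, mem_nonunits_iff]
    intro h
    have h1 := h.mul ht
    rw [sub_mul, hst, ← map_mul, ← map_sub, hu, map_sub, map_mul, hev, div_mul_cancel₀ _ hev0,
      sub_self] at h1
    exact h1 rfl
  · have h0 : ratD p (algebraMap _ X.functionField (X.presheaf.germ V q hqV r)) = 0 := by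
      rw [← ratOf_apply, ← algebraMap_complex_eq]
      let := algebraFunctionField p
      exact (KaehlerDifferential.D ℂ X.functionField).map_algebraMap _
    have h1 := ratD_add (p := p) (algebraMap _ X.functionField (a - X.presheaf.germ V q hqV r))
      (algebraMap _ X.functionField (X.presheaf.germ V q hqV r))
    rw [← map_add, sub_add_cancel, h0, add_zero] at h1
    exact h1

variable {z : X}

/-- A rational function that is regular on a punctured coordinate neighbourhood is regular. -/
theorem CoordNhd.exists_ratOf_eq (c : CoordNhd p z) (k : X.functionField)
    (h : ∀ q ∈ c.V.1, q ≠ z → ∃ a : X.presheaf.stalk q, k = algebraMap _ X.functionField a) :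
    ∃ a, k = ratOf c.mem a := by
  have hV : IsAffineOpen c.V.1 := c.V.2
  have : Nonempty c.V.1 := ⟨⟨z, c.mem⟩⟩
  -- Where a coordinate `f` is invertible the point `z` is absent, so `k` is a section there and `f
  -- ^ n * k` extends. Taking `f` to be `x` and then `y` leaves the statement about regular
  -- sequences.
  have key : ∀ f : Γ(X, c.V.1), f ≠ 0 → c.ev f = 0 →
      ∃ n, ∃ a, ratOf c.mem f ^ n * k = ratOf c.mem a := by
    intro f hf0 hf
    have hle : X.basicOpen f ≤ c.V.1 := X.basicOpen_le f
    obtain ⟨s, hs⟩ := exists_section_of_forall_mem_range (X.basicOpen f) k (by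
      intro q hq
      refine h q (hle hq) ?_
      rintro rfl
      rw [X.mem_basicOpen f _ c.mem, c.isUnit_germ_iff] at hq
      exact hq hf)
    let : Algebra Γ(X, c.V.1) Γ(X, X.basicOpen f) := (X.presheaf.map (homOfLE hle).op).hom.toAlgebra
    have : IsLocalization.Away f Γ(X, X.basicOpen f) :=
      hV.isLocalization_of_eq_basicOpen f (homOfLE hle) rfl
    obtain ⟨n, a, ha⟩ := IsLocalization.Away.surj f s
    have hg : genericPoint X ∈ X.basicOpen f := by
      rw [X.mem_basicOpen f _ (genericPoint_mem ⟨z, c.mem⟩)]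
      refine IsUnit.mk0 (G₀ := X.functionField) _ fun h0 => hf0 (ratOf_injective c.mem ?_)
      rw [map_zero, ratOf_eq c.mem (genericPoint_mem ⟨z, c.mem⟩), ratOf_apply, h0, map_zero]
    refine ⟨n, a, ?_⟩
    have e := congrArg (ratOf hg) ha
    rw [map_mul, map_pow] at e
    have e1 : ∀ b, ratOf hg (algebraMap Γ(X, c.V.1) Γ(X, X.basicOpen f) b) = ratOf c.mem b :=
      fun b => (ratOf_map hle hg b).trans (ratOf_eq _ _ b)
    rw [e1, e1, ratOf_apply, hs] at e
    rw [← e, mul_comm]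
  let : Algebra Γ(X, c.V.1) X.functionField := (ratOf c.mem).toAlgebra
  have : FaithfulSMul Γ(X, c.V.1) X.functionField :=
    (faithfulSMul_iff_algebraMap_injective _ _).mpr (ratOf_injective c.mem)
  obtain ⟨n, hn⟩ := key c.x c.x_ne_zero c.ev_x
  obtain ⟨m, hm⟩ := key c.y c.swap.x_ne_zero c.ev_y
  exact mem_range_of_regular_sequence c.x_ne_zero c.dvd k m hm n hn

end Extension

theorem ratOf_smul_mem {X : Scheme.{0}} [IsIntegral X] {p : X ⟶ SpecC} {y : X} {U : X.Opens}
    (hy : y ∈ U) (s : Γ(X, U))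
    {S : Submodule (X.presheaf.stalk y) (RationalForms (p))} {ω : RationalForms (p)}
    (h : ω ∈ S) : ratOf hy s • ω ∈ S :=
  Submodule.smul_mem S (X.presheaf.germ U y hy s) h

/-! ### Frames of regular forms upstairs and their relation to the pulled-back coordinates. -/

section Frames

variable {X X' : Scheme.{0}} [IsIntegral X] [IsIntegral X'] (η : X' ⟶ X) {p : X ⟶ SpecC}

/-- A rational function regular at the closed points over a punctured coordinate neighbourhood
is regular. -/
theorem CoordNhd.exists_fieldEquiv_ratOf_eq [JacobsonSpace X'] {U : X.Opens} [IsIso (η ∣_ U)]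
    [IsIso (η.stalkMap (genericPoint X'))] {z : X} (c : CoordNhd p z)
    (hU : ∀ q ∈ c.V.1, q ≠ z → q ∈ U) (k : X'.functionField)
    (h : ∀ y : X', IsClosed ({y} : Set X') → η y ∈ c.V.1 → η y ∈ U →
      ∃ a : X'.presheaf.stalk y, k = algebraMap _ X'.functionField a) :
    ∃ a, k = fieldEquiv η (ratOf c.mem a) := by
  obtain ⟨a, ha⟩ := c.exists_ratOf_eq ((fieldEquiv η).symm k) (by
    intro q hq hqz
    obtain ⟨y, rfl⟩ := exists_eq_of_mem (η := η) (hU q hq hqz)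
    -- Regularity is known only at closed points. Every point of the open set specializes to a
    -- closed point in it, and regularity passes to generizations.
    obtain ⟨y₀, hy₀, hcl, hsp⟩ := exists_isClosed_specializes (V := η ⁻¹ᵁ (c.V.1 ⊓ U)) (q := y)
      (Opens.mem_inf.mpr ⟨hq, hU _ hq hqz⟩)
    obtain ⟨a, ha⟩ := exists_algebraMap_eq_of_specializes hsp
      (h y₀ hcl (Opens.mem_inf.mp hy₀).1 (Opens.mem_inf.mp hy₀).2)
    have := isIso_stalkMap_of_restrict (η := η) U (hU _ hq hqz)
    obtain ⟨b, rfl⟩ := (ConcreteCategory.bijective_of_isIso (η.stalkMap y)).2 a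
    refine ⟨b, ?_⟩
    rw [RingEquiv.symm_apply_eq, fieldEquiv_algebraMap, ha])
  exact ⟨a, by rw [← ha, RingEquiv.apply_symm_apply]⟩

variable {η} in
theorem ChartData.ratOf_mul {z : X} {c : CoordNhd p z} (K : ChartData c η) {y : X'}
    (hy : y ∈ c.chart η) :
    ratOf hy (c.pull η c.x) * ratOf hy K.τ = ratOf hy (c.pull η c.y) := by
  rw [← map_mul, K.mul_τ]

variable [IsIso (η.stalkMap (genericPoint X'))]

theorem exists_formsBasis (β : Module.Basis (Fin 2) X.functionField (RationalForms p)) :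
    ∃ β' : Module.Basis (Fin 2) X'.functionField (RationalForms (η ≫ p)),
      ∀ i, β' i = formsEquiv η p (β i) := by
  have hli : LinearIndependent X'.functionField fun i => formsEquiv η p (β i) := by
    rw [Fintype.linearIndependent_iff]
    intro g hg i
    have h1 : ∑ i, (fieldEquiv η).symm (g i) • β i = 0 := by
      apply (formsEquiv η p).injective
      rw [map_sum, map_zero, ← hg]
      refine Finset.sum_congr rfl fun i _ => ?_
      rw [formsEquiv_smul, RingEquiv.apply_symm_apply]
    have := Fintype.linearIndependent_iff.mp β.linearIndependent _ h1 i
    simpa using this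
  have hsp : ⊤ ≤ Submodule.span X'.functionField (Set.range fun i => formsEquiv η p (β i)) := by
    intro ω _
    obtain ⟨ω, rfl⟩ := (formsEquiv η p).surjective ω
    rw [← β.sum_repr ω, map_sum]
    refine sum_mem fun i _ => ?_
    rw [formsEquiv_smul]
    exact Submodule.smul_mem _ _ (Submodule.subset_span ⟨i, rfl⟩)
  exact ⟨Module.Basis.mk hli hsp, fun i => Module.Basis.mk_apply hli hsp i⟩

theorem formsEquiv_mem_of_mem_span {y : X'} {u v ω : RationalForms p}
    {S : Submodule (X'.presheaf.stalk y) (RationalForms (η ≫ p))}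
    (hu : formsEquiv η p u ∈ S) (hv : formsEquiv η p v ∈ S)
    (h : ω ∈ Submodule.span (X.presheaf.stalk (η y)) {u, v}) : formsEquiv η p ω ∈ S := by
  obtain ⟨a, b, rfl⟩ := Submodule.mem_span_pair.mp h
  rw [map_add, stalk_smul_def, stalk_smul_def, formsEquiv_smul, formsEquiv_smul,
    fieldEquiv_algebraMap, fieldEquiv_algebraMap, ← stalk_smul_def, ← stalk_smul_def]
  exact add_mem (Submodule.smul_mem _ _ hu) (Submodule.smul_mem _ _ hv)

theorem logStalk_empty_eq_of_restrict {U : X.Opens} [IsIso (η ∣_ U)]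
    {u v : RationalForms p} {y : X'}
    (hy : η y ∈ U) (h : logStalk p ∅ (η y) = Submodule.span (X.presheaf.stalk (η y)) {u, v}) :
    logStalk (η ≫ p) ∅ y =
      Submodule.span (X'.presheaf.stalk y) {formsEquiv η p u, formsEquiv η p v} := by
  have key : ∀ ω, formsEquiv η p ω ∈ logStalk (η ≫ p) ∅ y ↔ ω ∈ logStalk p ∅ (η y) :=
    mem_logStalk_iff_of_restrict hy (fun C hC => absurd hC (Set.notMem_empty _))
      (fun C hC => absurd hC (Set.notMem_empty _))
  apply le_antisymm
  · intro ω hω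
    obtain ⟨ω, rfl⟩ := (formsEquiv η p).surjective ω
    rw [key, h] at hω
    exact formsEquiv_mem_of_mem_span η (Submodule.subset_span (by simp))
      (Submodule.subset_span (by simp)) hω
  · rw [Submodule.span_le]
    rintro _ (rfl | rfl) <;> refine (key _).mpr ?_ <;> rw [h] <;>
      exact Submodule.subset_span (by simp)

variable {z : X} {c : CoordNhd p z} {η}

theorem fieldEquiv_ratOf_pull {y : X'} (hy : y ∈ c.chart η) (a : Γ(X, c.V.1)) :
    fieldEquiv η (ratOf c.mem a) = ratOf hy (c.pull η a) := by
  rw [ratOf_eq c.mem (c.mem_of_mem_chart η hy), ratOf_apply, fieldEquiv_algebraMap, ratOf_apply,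
    c.germ_pull]

theorem CoordNhd.formsEquiv_β_zero {y : X'} (hy : y ∈ c.chart η) :
    formsEquiv η p (c.β 0) = ratD (η ≫ p) (ratOf hy (c.pull η c.x)) := by
  rw [c.β_zero, formsEquiv_ratD, fieldEquiv_ratOf_pull hy]

theorem ChartData.formsEquiv_β_one (K : ChartData c η) {y : X'} (hy : y ∈ c.chart η) :
    formsEquiv η p (c.β 1) = ratOf hy K.τ • ratD (η ≫ p) (ratOf hy (c.pull η c.x)) +
      ratOf hy (c.pull η c.x) • ratD (η ≫ p) (ratOf hy K.τ) := by
  rw [c.β_one, formsEquiv_ratD, fieldEquiv_ratOf_pull hy, ← K.ratOf_mul hy, ratD_mul, add_comm]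

/-- The frame of regular forms in the chart. -/
theorem ChartData.logStalk_empty (K : ChartData c η) {y : X'} (hy : y ∈ c.chart η) :
    logStalk (η ≫ p) ∅ y = Submodule.span (X'.presheaf.stalk y)
      {ratD (η ≫ p) (ratOf hy (c.pull η c.x)), ratD (η ≫ p) (ratOf hy K.τ)} := by
  refine logStalk_empty_eq_span (η ≫ p) K.affine hy (ratD_mem_logStalk ∅ y _)
    (ratD_mem_logStalk ∅ y _) fun s => ?_
  set S := Submodule.span (X'.presheaf.stalk y)
      {ratD (η ≫ p) (ratOf hy (c.pull η c.x)), ratD (η ≫ p) (ratOf hy K.τ)} with hS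
  have h0 : formsEquiv η p (c.β 0) ∈ S := by
    rw [c.formsEquiv_β_zero hy]; exact Submodule.subset_span (by simp)
  have hτ : ratD (η ≫ p) (ratOf hy K.τ) ∈ S := Submodule.subset_span (by simp)
  have h1 : formsEquiv η p (c.β 1) ∈ S := by
    rw [K.formsEquiv_β_one hy, ← c.formsEquiv_β_zero hy]
    exact add_mem (ratOf_smul_mem hy _ h0) (ratOf_smul_mem hy _ hτ)
  have hC : ∀ a, ratD (η ≫ p) (ratOf hy (c.pull η a)) ∈ S := by
    intro a
    rw [← fieldEquiv_ratOf_pull hy, ← formsEquiv_ratD]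
    refine formsEquiv_mem_of_mem_span η (y := y) h0 h1 ?_
    rw [← c.logStalk_empty _ (c.mem_of_mem_chart η hy), ratOf_eq c.mem (c.mem_of_mem_chart η hy)]
    exact ratD_mem_logStalk ∅ _ _
  obtain ⟨g, rfl⟩ := K.exists_eval₂ s
  induction g using Polynomial.induction_on with
  | C a => simpa using hC a
  | add f g hf hg =>
    rw [Polynomial.eval₂_add, map_add, ratD_add]; exact add_mem hf hg
  | monomial n a h =>
    rw [pow_succ, ← mul_assoc, Polynomial.eval₂_mul, Polynomial.eval₂_X, map_mul, ratD_mul]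
    exact add_mem (ratOf_smul_mem hy _ hτ) (ratOf_smul_mem hy _ h)

/-- With `y = x τ` one has `dx ∧ dy = x (dx ∧ dτ)`. The extra factor `x` is what separates frames on
the chart from frames pulled back from `X`. -/
theorem ChartData.wedge_frame (K : ChartData c η) {y : X'} (hy : y ∈ c.chart η)
    {β' : Module.Basis (Fin 2) X'.functionField (RationalForms (η ≫ p))}
    (hβ' : ∀ i, β' i = formsEquiv η p (c.β i)) :
    ratOf hy (c.pull η c.x) * wedge β' (ratD (η ≫ p) (ratOf hy (c.pull η c.x)))
      (ratD (η ≫ p) (ratOf hy K.τ)) = 1 := by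
  have := wedge_basis β'
  rw [hβ', hβ', K.formsEquiv_β_one hy, c.formsEquiv_β_zero hy, wedge_add_right, wedge_smul_right,
    wedge_self, mul_zero, zero_add, wedge_smul_right] at this
  exact this

end Frames

/-! ### Logarithmic forms near an exceptional curve -/

section Determinant

theorem stalkIdeal_vanishingIdeal_anti {X : Scheme.{0}} {C E : Closeds X} (h : E ≤ C) (x : X) :
    stalkIdeal (Scheme.IdealSheafData.vanishingIdeal C) x ≤
      stalkIdeal (Scheme.IdealSheafData.vanishingIdeal E) x := by
  intro f hf
  rw [mem_stalkIdeal_vanishingIdeal_iff] at hf ⊢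
  obtain ⟨U, hU, s, hs, h'⟩ := hf
  exact ⟨U, hU, s, hs, fun y hy hyE => h' y hy (h hyE)⟩

variable {X : Scheme.{0}} [IsIntegral X] {p : X ⟶ SpecC} {D T : Set (Closeds X)} {q : X}

/-- `G` sends generators of one stalk to generators of the other, so the two determinants differ by
a unit. The first factor on the left is the determinant of `G`. -/
theorem exists_det_unit {G : RationalForms p ≃ₗ[X.functionField] RationalForms p}
    (hG : ∀ ω, ω ∈ logStalk p D q ↔ G ω ∈ logStalk p T q)
    (β : Module.Basis (Fin 2) X.functionField (RationalForms p)) {v₀ v₁ t₀ t₁ : RationalForms p}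
    (hv : logStalk p D q = Submodule.span (X.presheaf.stalk q) {v₀, v₁})
    (ht : logStalk p T q = Submodule.span (X.presheaf.stalk q) {t₀, t₁})
    (hw : wedge β t₀ t₁ ≠ 0) : ∃ u : (X.presheaf.stalk q)ˣ,
      wedge β (G (β 0)) (G (β 1)) * wedge β v₀ v₁ =
        algebraMap (X.presheaf.stalk q) X.functionField u * wedge β t₀ t₁ := by
  have hspan : Submodule.span (X.presheaf.stalk q) {G v₀, G v₁} =
      Submodule.span (X.presheaf.stalk q) {t₀, t₁} := by
    apply le_antisymm
    · rw [← ht, Submodule.span_le]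
      rintro _ (rfl | rfl) <;> refine (hG _).mp ?_ <;> rw [hv] <;>
        exact Submodule.subset_span (by simp)
    · have key : ∀ t ∈ logStalk p T q, t ∈ Submodule.span (X.presheaf.stalk q) {G v₀, G v₁} := by
        intro t ht
        obtain ⟨ω, rfl⟩ := G.surjective t
        rw [← hG, hv] at ht
        obtain ⟨a, b, rfl⟩ := Submodule.mem_span_pair.mp ht
        rw [map_add, stalk_smul_def, stalk_smul_def, map_smul, map_smul]
        exact Submodule.mem_span_pair.mpr ⟨a, b, rfl⟩
      rw [Submodule.span_le]
      rintro _ (rfl | rfl) <;> refine key _ ?_ <;> rw [ht] <;>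
        exact Submodule.subset_span (by simp)
  obtain ⟨u, hu⟩ := exists_wedge_eq_unit β hspan hw
  exact ⟨u, by rw [← hu]; exact (wedge_map β G.toLinearMap v₀ v₁).symm⟩

theorem wedge_reindex_swap {K W : Type*} [Field K] [AddCommGroup W] [Module K W]
    (β : Module.Basis (Fin 2) K W) (u v : W) :
    wedge (β.reindex (Equiv.swap 0 1)) u v = - wedge β u v := by
  simp [wedge]

/-- An irreducible closed subset with a local equation containing a closed subset with a prime
local equation agrees with it. -/
theorem eq_of_le_of_isLocalEquation {C E : Closeds X} (hC : IsIrreducible (C : Set X))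
    (h : E ≤ C) {x : X} (hx : x ∈ E) {f g : X.presheaf.stalk x}
    (hf : IsLocalEquation C x f) (hg : IsLocalEquation E x g) (hf0 : f ≠ 0) : C = E := by
  have hle := stalkIdeal_vanishingIdeal_anti h x
  have hp := isPrime_stalkIdeal hC (h hx)
  have hgm := stalkIdeal_le_maximalIdeal hx
  rw [hf] at hp hle
  rw [hg, Ideal.span_singleton_le_span_singleton] at hle
  rw [hg] at hgm
  obtain ⟨w, hw⟩ := hle
  have hmem : g * w ∈ Ideal.span {f} := hw ▸ Ideal.mem_span_singleton_self f
  rcases hp.mem_or_mem hmem with h1 | h1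
  · refine le_antisymm (le_of_stalkIdeal_le hC (h hx) ?_) h
    rw [hf, hg, Ideal.span_singleton_le_span_singleton]
    exact Ideal.mem_span_singleton.mp h1
  · exfalso
    obtain ⟨v, rfl⟩ := Ideal.mem_span_singleton.mp h1
    have h2 : f * (1 - g * v) = 0 := by linear_combination hw
    rcases mul_eq_zero.mp h2 with h3 | h3
    · exact hf0 h3
    · have : IsUnit g := IsUnit.of_mul_eq_one v (by linear_combination -h3)
      exact (hgm (Ideal.mem_span_singleton_self g)) this

end Determinant

/-! ### The determinant of a comparison of logarithmic sheaves near an exceptional curve. -/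

section Comparison

variable {X X' : Scheme.{0}} [IsIntegral X] [IsIntegral X'] {η : X' ⟶ X} {p : X ⟶ SpecC}

/-- An isomorphism of logarithmic sheaves over a coordinate neighbourhood of a point that is
blown up, where the members of the target arrangement over the neighbourhood are exceptional. -/
structure LogComparison {z : X} (c : CoordNhd p z) (U : X.Opens) (E : Closeds X')
    (D T : Set (Closeds X'))
    (G : RationalForms (η ≫ p) ≃ₗ[X'.functionField] RationalForms (η ≫ p)) : Prop where
  mem_iff : ∀ y, y ∈ E ↔ η y = z
  mem_opens_iff : ∀ q ∈ c.V.1, q ∈ U ↔ q ≠ z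
  irreducible : ∀ C ∈ D, IsIrreducible (C : Set X')
  snc : HasSimpleNormalCrossings D
  eq_of_mem : ∀ C ∈ T, ∀ y ∈ C, η y ∈ c.V.1 → C = E
  mem_logStalk_iff : ∀ y ω, ω ∈ logStalk (η ≫ p) D y ↔ G ω ∈ logStalk (η ≫ p) T y

variable {z : X} {c : CoordNhd p z} {U : X.Opens} {E : Closeds X'} {D T : Set (Closeds X')}
  {G : RationalForms (η ≫ p) ≃ₗ[X'.functionField] RationalForms (η ≫ p)}

theorem LogComparison.swap (h : LogComparison c U E D T G) : LogComparison c.swap U E D T G :=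
  ⟨h.mem_iff, h.mem_opens_iff, h.irreducible, h.snc, h.eq_of_mem, h.mem_logStalk_iff⟩

theorem LogComparison.logStalk_target (h : LogComparison c U E D T G) {y : X'}
    (hyV : η y ∈ c.V.1) (hy : y ∉ E ∨ E ∉ T) :
    logStalk (η ≫ p) T y = logStalk (η ≫ p) ∅ y :=
  logStalk_eq_empty fun C hC hyC => by
    obtain rfl := h.eq_of_mem C hC y hyC hyV
    exact hy.elim (fun h => h hyC) fun h => h hC

variable [IsIso (η.stalkMap (genericPoint X'))]
  {β : Module.Basis (Fin 2) X'.functionField (RationalForms (η ≫ p))}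

theorem frame_of_mem [IsIso (η ∣_ U)] (hβ : ∀ i, β i = formsEquiv η p (c.β i)) {y : X'}
    (hyV : η y ∈ c.V.1) (hyU : η y ∈ U) :
    logStalk (η ≫ p) ∅ y = Submodule.span (X'.presheaf.stalk y) {β 0, β 1} := by
  rw [hβ, hβ]
  exact logStalk_empty_eq_of_restrict η hyU (c.logStalk_empty _ hyV)

/-- The determinant of the comparison away from the exceptional curve. -/
theorem LogComparison.exists_det_eq [IsIso (η ∣_ U)] [LocallyOfFiniteType (η ≫ p)]
    (h : LogComparison c U E D T G) (hβ : ∀ i, β i = formsEquiv η p (c.β i)) {y : X'}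
    (hy : IsClosed ({y} : Set X')) (hyV : η y ∈ c.V.1) (hyU : η y ∈ U) :
    ∃ a : X'.presheaf.stalk y, a ≠ 0 ∧
      wedge β (G (β 0)) (G (β 1)) = algebraMap _ X'.functionField a ∧
      (∀ C ∈ D, y ∈ C → ¬ IsUnit a) ∧
      (wedge β (G (β 0)) (G (β 1)))⁻¹ • ratD (η ≫ p) (wedge β (G (β 0)) (G (β 1))) ∈
        logStalk (η ≫ p) D y := by
  have hframe := frame_of_mem hβ hyV hyU
  have hyE : y ∉ E := fun hE => (h.mem_opens_iff _ hyV).mp hyU ((h.mem_iff y).mp hE)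
  have h1 : wedge β (β 0) (β 1) ≠ 0 := by rw [wedge_basis]; exact one_ne_zero
  obtain ⟨z, hz, hzD⟩ := h.snc y hy
  obtain ⟨v₀, v₁, e, u, hv, he, he0, hde, hdvd, -⟩ := exists_logStalk_eq_span h.irreducible
    ⟨z, hz, hzD⟩ (exists_ratD_eq hy) β hframe h1
  obtain ⟨u', hu'⟩ := exists_det_unit (h.mem_logStalk_iff y) β hv
    ((h.logStalk_target hyV (Or.inl hyE)).trans hframe) h1
  rw [wedge_basis, mul_one] at he hu'
  have hu0 : algebraMap (X'.presheaf.stalk y) X'.functionField u ≠ 0 :=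
    (u.isUnit.map (algebraMap _ X'.functionField)).ne_zero
  -- Off `E` the target forms are regular, so the determinant is the product `e` of the local
  -- equations of the source, up to a unit. Thus it is regular, vanishes on the source members, and
  -- has a logarithmic derivative with poles only along them.
  have hδ : wedge β (G (β 0)) (G (β 1)) =
      algebraMap _ X'.functionField (e * ↑(u' * u⁻¹ : (X'.presheaf.stalk y)ˣ)) := by
    have h2 : algebraMap (X'.presheaf.stalk y) X'.functionField u *
        algebraMap (X'.presheaf.stalk y) X'.functionField (↑u⁻¹ : X'.presheaf.stalk y) = 1 := by
      rw [← map_mul, Units.mul_inv, map_one]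
    rw [map_mul, Units.val_mul, map_mul, ← hu']
    linear_combination (-wedge β (G (β 0)) (G (β 1)) *
      algebraMap (X'.presheaf.stalk y) X'.functionField (↑u⁻¹ : X'.presheaf.stalk y)) * he -
        wedge β (G (β 0)) (G (β 1)) * h2
  refine ⟨e * ↑(u' * u⁻¹), mul_ne_zero he0 (Units.ne_zero _), hδ, fun C hC hyC hunit => ?_, ?_⟩
  · obtain ⟨j, hj⟩ := hzD C hC hyC
    have h3 : z j ∈ IsLocalRing.maximalIdeal (X'.presheaf.stalk y) :=
      hz ▸ Ideal.subset_span ⟨j, rfl⟩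
    exact h3 (isUnit_of_dvd_unit (hdvd C hC hyC _ hj) (isUnit_of_mul_isUnit_left hunit))
  · rw [hδ, logForm_mul_unit he0]
    exact add_mem hde (Submodule.smul_mem _ _ (ratD_mem_logStalk D y _))

/-- Forms regular over the punctured neighbourhood have regular coefficients. -/
theorem exists_coeff [IsIso (η ∣_ U)] [JacobsonSpace X'] (hU : ∀ q ∈ c.V.1, q ∈ U ↔ q ≠ z)
    (hβ : ∀ i, β i = formsEquiv η p (c.β i)) {ω : RationalForms (η ≫ p)}
    (hω : ∀ y : X', IsClosed ({y} : Set X') → η y ∈ c.V.1 → η y ∈ U → ω ∈ logStalk (η ≫ p) ∅ y) :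
    ∃ a b, ω = fieldEquiv η (ratOf c.mem a) • β 0 + fieldEquiv η (ratOf c.mem b) • β 1 := by
  have key : ∀ i, ∃ a, β.repr ω i = fieldEquiv η (ratOf c.mem a) := by
    intro i
    refine c.exists_fieldEquiv_ratOf_eq η (U := U) (fun q hq hqz => (hU q hq).mpr hqz) _
      fun y hcl hyV hyU => ?_
    have h1 := hω y hcl hyV hyU
    rw [frame_of_mem hβ hyV hyU] at h1
    obtain ⟨s, t, rfl⟩ := Submodule.mem_span_pair.mp h1
    rw [stalk_smul_def, stalk_smul_def]
    fin_cases i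
    · exact ⟨s, by simp [-algebraMap_smul]⟩
    · exact ⟨t, by simp [-algebraMap_smul]⟩
  obtain ⟨a, ha⟩ := key 0
  obtain ⟨b, hb⟩ := key 1
  exact ⟨a, b, by rw [← ha, ← hb]; exact basis_expand β ω⟩

/-- The coefficients of a form divisible by the equation of the exceptional curve vanish at the
center of the blow-up. -/
theorem ChartData.ev_eq_zero_of_smul_mem (K : ChartData c η)
    (hβ : ∀ i, β i = formsEquiv η p (c.β i))
    {ξ : X'} (hξ : ξ ∈ c.chart η) (hz : η ξ = z)
    (hu : ∀ s, IsUnit (X'.presheaf.germ _ ξ hξ s) ↔ K.π s ≠ 0)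
    {a b : Γ(X, c.V.1)} {ω : RationalForms (η ≫ p)} (hω : ω ∈ logStalk (η ≫ p) ∅ ξ)
    (e : fieldEquiv η (ratOf c.mem a) • β 0 + fieldEquiv η (ratOf c.mem b) • β 1 =
      ratOf hξ (c.pull η c.x) • ω) : c.ev a = 0 ∧ c.ev b = 0 := by
  rw [K.logStalk_empty hξ] at hω
  obtain ⟨f, g, rfl⟩ := Submodule.mem_span_pair.mp hω
  have hw := K.wedge_frame hξ hβ
  have hw0 : wedge β (ratD (η ≫ p) (ratOf hξ (c.pull η c.x))) (ratD (η ≫ p) (ratOf hξ K.τ)) ≠ 0 :=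
    right_ne_zero_of_mul_eq_one hw
  rw [hβ, hβ, K.formsEquiv_β_one hξ, c.formsEquiv_β_zero hξ, fieldEquiv_ratOf_pull hξ,
    fieldEquiv_ratOf_pull hξ, stalk_smul_def, stalk_smul_def, smul_add, smul_add, ← add_assoc,
    smul_smul, ← add_smul, smul_smul, smul_smul, smul_smul] at e
  -- Comparing coefficients of `dx` gives `a + b τ = x f`, since the second basis form is `τ dx + x
  -- dτ`. Reduction modulo `x` is then the polynomial `a(z) + b(z) X`, which must be zero.
  have h1 := (eq_of_wedge_ne_zero β hw0 e).1
  rw [← map_mul, ← map_add, ratOf_apply, ratOf_apply, ← map_mul] at h1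
  have h2 := algebraMap_stalk_injective ξ h1
  have h3 : K.π (c.pull η a + c.pull η b * K.τ) = 0 := by
    by_contra hne
    rw [← ne_eq, ← hu, h2] at hne
    exact K.not_isUnit hξ hz (isUnit_of_mul_isUnit_left hne)
  rw [map_add, map_mul, K.π_pull, K.π_pull, K.π_τ] at h3
  constructor
  · simpa using congrArg (Polynomial.coeff · 0) h3
  · simpa using congrArg (Polynomial.coeff · 1) h3

/-- A closed point of the exceptional curve in a chart. -/
theorem LogComparison.exists_data_of_mem_chart [LocallyOfFiniteType (η ≫ p)]
    (h : LogComparison c U E D T G) (K : ChartData c η) (hβ : ∀ i, β i = formsEquiv η p (c.β i))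
    {y : X'} (hy : y ∈ c.chart η) (hcl : IsClosed ({y} : Set X')) :
    ∃ (v₀ v₁ : RationalForms (η ≫ p)) (e : X'.presheaf.stalk y) (u : (X'.presheaf.stalk y)ˣ),
      logStalk (η ≫ p) D y = Submodule.span (X'.presheaf.stalk y) {v₀, v₁} ∧
      algebraMap _ X'.functionField e * wedge β v₀ v₁ =
        algebraMap (X'.presheaf.stalk y) X'.functionField u *
          wedge β (ratD (η ≫ p) (ratOf hy (c.pull η c.x))) (ratD (η ≫ p) (ratOf hy K.τ)) ∧
      e ≠ 0 ∧ (∀ C ∈ D, y ∈ C → ∀ f, IsLocalEquation C y f → f ∣ e) ∧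
      ∀ C ∈ D, y ∈ C → ∀ f, IsLocalEquation C y f → ∀ C' ∈ D, y ∈ C' → ∀ f',
        IsLocalEquation C' y f' → C ≠ C' → f * f' ∣ e := by
  obtain ⟨v₀, v₁, e, u, h1, h2, h3, -, h4⟩ := exists_logStalk_eq_span h.irreducible (h.snc y hcl)
    (exists_ratD_eq hcl) β (K.logStalk_empty hy)
    (right_ne_zero_of_mul_eq_one (K.wedge_frame hy hβ))
  exact ⟨v₀, v₁, e, u, h1, h2, h3, h4⟩

/-- Both sets have local equations at the point. That of `C` generates a prime ideal and is nonzero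
because it divides `e`, so containment forces equality. -/
theorem LogComparison.eq_of_exceptional_le [LocallyOfFiniteType (η ≫ p)]
    (h : LogComparison c U E D T G) (K : ChartData c η) (hβ : ∀ i, β i = formsEquiv η p (c.β i))
    {y : X'} (hy : y ∈ c.chart η) (hcl : IsClosed ({y} : Set X')) (hyE : y ∈ E) {C : Closeds X'}
    (hC : C ∈ D) (hle : E ≤ C) : C = E := by
  obtain ⟨-, -, e, -, -, -, he, hdvd, -⟩ := h.exists_data_of_mem_chart K hβ hy hcl
  obtain ⟨z, -, hzD⟩ := h.snc y hcl
  obtain ⟨j, hj⟩ := hzD C hC (hle hyE)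
  refine eq_of_le_of_isLocalEquation (h.irreducible C hC) hle hyE hj
    (K.isLocalEquation h.mem_iff hy) fun h0 => he ?_
  exact zero_dvd_iff.mp (h0 ▸ hdvd C hC (hle hyE) _ hj)

/-- Forms with poles along the exceptional curve only. -/
theorem ChartData.logStalk_eq_span (K : ChartData c η) (hE : ∀ y, y ∈ E ↔ η y = z) {y : X'}
    (hy : y ∈ c.chart η) (hz : η y = z) (hED : E ∈ D) (hD : ∀ C ∈ D, y ∈ C → C = E) :
    logStalk (η ≫ p) D y = Submodule.span (X'.presheaf.stalk y)
      {(ratOf hy (c.pull η c.x))⁻¹ • ratD (η ≫ p) (ratOf hy (c.pull η c.x)),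
        ratD (η ≫ p) (ratOf hy K.τ)} := by
  refine logStalk_eq_span_of_unique hED ((hE y).mpr hz) hD (K.isLocalEquation hE hy) ?_
    (K.logStalk_empty hy)
  intro h0
  have hβ := exists_formsBasis η c.β
  obtain ⟨β, hβ⟩ := hβ
  have := K.wedge_frame hy hβ
  rw [ratOf_apply, h0, map_zero, zero_mul] at this
  exact zero_ne_one this

/-- Near a point where the determinant is a unit, the only member of the source arrangement is
the exceptional curve. -/
theorem LogComparison.eq_of_isUnit [LocallyOfFiniteType (η ≫ p)]
    (h : LogComparison c U E D T G) (K : ChartData c η) (hβ : ∀ i, β i = formsEquiv η p (c.β i))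
    (hED : E ∈ T → E ∈ D) {δ : X'.functionField}
    (hδ : ∀ v w, wedge β (G v) (G w) = δ * wedge β v w) {y : X'} (hy : y ∈ c.chart η)
    (hcl : IsClosed ({y} : Set X')) (hyE : y ∈ E)
    (hu : ∃ u : (X'.presheaf.stalk y)ˣ, δ = algebraMap (X'.presheaf.stalk y) X'.functionField u)
    {C : Closeds X'} (hC : C ∈ D) (hyC : y ∈ C) : C = E := by
  obtain ⟨w, rfl⟩ := hu
  obtain ⟨v₀, v₁, e, u, hv, he, he0, hdvd, hdvd'⟩ := h.exists_data_of_mem_chart K hβ hy hcl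
  have hz : η y = z := (h.mem_iff y).mp hyE
  have hwf := K.wedge_frame hy hβ
  have hx0 := left_ne_zero_of_mul_eq_one hwf
  have hw0 := right_ne_zero_of_mul_eq_one hwf
  have hδ' : wedge β (G (β 0)) (G (β 1)) = algebraMap (X'.presheaf.stalk y) X'.functionField w := by
    rw [hδ, wedge_basis, mul_one]
  obtain ⟨j, hj⟩ : ∃ f, IsLocalEquation C y f := by
    obtain ⟨z, -, hzD⟩ := h.snc y hcl
    obtain ⟨j, hj⟩ := hzD C hC hyC
    exact ⟨_, hj⟩
  have hjm : ¬ IsUnit j := stalkIdeal_le_maximalIdeal hyC (hj ▸ Ideal.mem_span_singleton_self j)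
  by_contra hne
  by_cases hT : E ∈ T
  · obtain ⟨u', hu'⟩ := exists_det_unit (h.mem_logStalk_iff y) β hv
      (K.logStalk_eq_span h.mem_iff hy hz hT fun C hC hyC => h.eq_of_mem C hC y hyC
        (c.mem_of_mem_chart η hy))
      (by rw [wedge_smul_left]; exact mul_ne_zero (inv_ne_zero hx0) hw0)
    rw [hδ', wedge_smul_left] at hu'
    -- With `E` on both sides the target frame `dx/x, dτ` contributes a factor `x`, so `e` equals
    -- `x` up to a unit. A second member with equation `j` would make `x j` divide `e`, hence `j` a
    -- unit.
    have h1 : algebraMap (X'.presheaf.stalk y) X'.functionField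
        (w * u * X'.presheaf.germ _ y hy (c.pull η c.x)) =
          algebraMap (X'.presheaf.stalk y) X'.functionField (u' * e) := by
      rw [map_mul, map_mul, map_mul, ← ratOf_apply]
      apply mul_right_cancel₀ hw0
      have h2 := mul_inv_cancel₀ hx0
      linear_combination (ratOf hy (c.pull η c.x) * algebraMap _ X'.functionField e) * hu' -
        (algebraMap (X'.presheaf.stalk y) X'.functionField w * ratOf hy (c.pull η c.x)) * he +
        (algebraMap (X'.presheaf.stalk y) X'.functionField u' * algebraMap _ X'.functionField e *
          wedge β (ratD (η ≫ p) (ratOf hy (c.pull η c.x))) (ratD (η ≫ p) (ratOf hy K.τ))) * h2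
    have h2 := algebraMap_stalk_injective y h1
    obtain ⟨t, ht⟩ := hdvd' E (hED hT) hyE _ (K.isLocalEquation h.mem_iff hy) C hC hyC j hj
      (Ne.symm hne)
    have hg0 : X'.presheaf.germ _ y hy (c.pull η c.x) ≠ 0 := fun h0 => hx0 (by
      rw [ratOf_apply, h0, map_zero])
    have h3 : (w : X'.presheaf.stalk y) * u = j * (u' * t) := by
      apply mul_right_cancel₀ hg0
      rw [h2, ht]; ring
    exact hjm (isUnit_of_mul_isUnit_left (h3 ▸ (w.isUnit.mul u.isUnit)))
  · obtain ⟨u', hu'⟩ := exists_det_unit (h.mem_logStalk_iff y) β hv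
      ((h.logStalk_target (c.mem_of_mem_chart η hy) (Or.inr hT)).trans (K.logStalk_empty hy)) hw0
    rw [hδ'] at hu'
    -- With `E` absent from the target, `e` itself is a unit although the equation `j` of `C`
    -- divides it.
    have h1 : algebraMap (X'.presheaf.stalk y) X'.functionField (w * u) =
          algebraMap (X'.presheaf.stalk y) X'.functionField (u' * e) := by
      rw [map_mul, map_mul]
      apply mul_right_cancel₀ hw0
      linear_combination (algebraMap _ X'.functionField e) * hu' -
        (algebraMap (X'.presheaf.stalk y) X'.functionField w) * he
    have h2 := algebraMap_stalk_injective y h1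
    exact hjm (isUnit_of_dvd_unit (hdvd C hC hyC j hj)
      (isUnit_of_mul_isUnit_right (h2 ▸ (w.isUnit.mul u.isUnit))))

end Comparison

/-! ### The exceptional curve is detected by the logarithmic sheaf -/

section Detect

variable {X X' : Scheme.{0}} [IsIntegral X] [IsIntegral X'] {η : X' ⟶ X} {p : X ⟶ SpecC}
  {z : X} {c : CoordNhd p z} {U : X.Opens} {E : Closeds X'} {D T : Set (Closeds X')}
  {G : RationalForms (η ≫ p) ≃ₗ[X'.functionField] RationalForms (η ≫ p)}
  [IsIso (η.stalkMap (genericPoint X'))]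
  {β : Module.Basis (Fin 2) X'.functionField (RationalForms (η ≫ p))}

theorem ChartData.fieldEquiv_ratOf_eq_mul (K : ChartData c η) {ξ : X'} (hξ : ξ ∈ c.chart η)
    {a : Γ(X, c.V.1)} (ha : c.ev a = 0) : ∃ s : Γ(X', c.chart η),
      fieldEquiv η (ratOf c.mem a) = ratOf hξ (c.pull η c.x) * ratOf hξ s := by
  obtain ⟨s, hs⟩ := Ideal.mem_span_singleton.mp ((K.π_eq_zero_iff (c.pull η a)).mp (by
    rw [K.π_pull, ha, map_zero]))
  exact ⟨s, by rw [fieldEquiv_ratOf_pull hξ, hs, map_mul]⟩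

/-- If the exceptional curve belongs to the source arrangement but not to the target, the
determinant is not a regular function times a unit. -/
theorem LogComparison.false_of_pole [IsIso (η ∣_ U)] [LocallyOfFiniteType (η ≫ p)]
    [JacobsonSpace X'] (h : LogComparison c U E D T G) (K : ChartData c η)
    (hβ : ∀ i, β i = formsEquiv η p (c.β i)) {ξ : X'} (hξ : ξ ∈ c.chart η) (hz : η ξ = z)
    (hu : ∀ s, IsUnit (X'.presheaf.germ _ ξ hξ s) ↔ K.π s ≠ 0) (hED : E ∈ D) (hET : E ∉ T)
    (hD : ∀ C ∈ D, ξ ∈ C → C = E) (w : (X'.presheaf.stalk ξ)ˣ)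
    (hw : wedge β (G (β 0)) (G (β 1)) =
      algebraMap (X'.presheaf.stalk ξ) X'.functionField w * ratOf hξ (c.pull η c.x)) : False := by
  have hwf := K.wedge_frame hξ hβ
  have hx0 := left_ne_zero_of_mul_eq_one hwf
  have hw0 := right_ne_zero_of_mul_eq_one hwf
  have hsrc := K.logStalk_eq_span h.mem_iff hξ hz hED hD
  have htgt := h.logStalk_target (c.mem_of_mem_chart η hξ) (Or.inr hET)
  set δ := wedge β (G (β 0)) (G (β 1)) with hδ
  have hG : ∀ u v, wedge β (G u) (G v) = δ * wedge β u v := wedge_map β G.toLinearMap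
  -- Off `E` the target forms are regular. Thus `G` sends forms that are logarithmic there to forms
  -- with coefficients pulled back from functions near `z`, by Hartogs.
  have hreg : ∀ ω : RationalForms (η ≫ p), (∀ y : X', IsClosed ({y} : Set X') → η y ∈ c.V.1 →
      η y ∈ U → ω ∈ logStalk (η ≫ p) D y) → ∃ a b, G ω =
        fieldEquiv η (ratOf c.mem a) • β 0 + fieldEquiv η (ratOf c.mem b) • β 1 := by
    intro ω hω
    refine exists_coeff h.mem_opens_iff hβ fun y hcl hyV hyU => ?_
    rw [← h.logStalk_target hyV (Or.inl fun hE =>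
      (h.mem_opens_iff _ hyV).mp hyU ((h.mem_iff y).mp hE)), ← h.mem_logStalk_iff]
    exact hω y hcl hyV hyU
  have hreg_β : ∀ i, ∀ y : X', IsClosed ({y} : Set X') → η y ∈ c.V.1 →
      η y ∈ U → β i ∈ logStalk (η ≫ p) D y := by
    intro i y hcl hyV hyU
    apply logStalk_empty_le
    rw [frame_of_mem hβ hyV hyU]
    apply Submodule.subset_span
    fin_cases i <;> simp
  have hG0 : G ((ratOf hξ (c.pull η c.x))⁻¹ • ratD (η ≫ p) (ratOf hξ (c.pull η c.x))) ∈
      logStalk (η ≫ p) ∅ ξ := by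
    rw [← htgt, ← h.mem_logStalk_iff, hsrc]; exact Submodule.subset_span (by simp)
  have hG1 : G (ratD (η ≫ p) (ratOf hξ K.τ)) ∈ logStalk (η ≫ p) ∅ ξ := by
    rw [← htgt, ← h.mem_logStalk_iff, hsrc]; exact Submodule.subset_span (by simp)
  have hβ0 : β 0 = ratD (η ≫ p) (ratOf hξ (c.pull η c.x)) := by
    rw [hβ, c.formsEquiv_β_zero hξ]
  have hβ1 : β 1 = ratOf hξ K.τ • β 0 +
      ratOf hξ (c.pull η c.x) • ratD (η ≫ p) (ratOf hξ K.τ) := by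
    rw [hβ0, hβ, K.formsEquiv_β_one hξ]
  have hGβ0 : G (β 0) = ratOf hξ (c.pull η c.x) • G ((ratOf hξ (c.pull η c.x))⁻¹ • β 0) := by
    rw [← map_smul, smul_smul, mul_inv_cancel₀ hx0, one_smul]
  rw [← hβ0] at hG0
  have hGβ1 : G (β 1) = ratOf hξ (c.pull η c.x) •
      (ratOf hξ K.τ • G ((ratOf hξ (c.pull η c.x))⁻¹ • β 0) +
        G (ratD (η ≫ p) (ratOf hξ K.τ))) := by
    rw [hβ1, map_add, map_smul, map_smul, hGβ0, smul_add, smul_smul, smul_smul, mul_comm]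
  -- Both basis forms are `x` times source logarithmic forms at `ξ`: `dx = x (dx/x)` and `dy = x (τ
  -- dx/x + dτ)`. Their images are `x` times regular forms, so the matrix of `G` vanishes at `z`.
  have hGβ : ∀ i, ∃ a b, c.ev a = 0 ∧ c.ev b = 0 ∧ G (β i) =
      fieldEquiv η (ratOf c.mem a) • β 0 + fieldEquiv η (ratOf c.mem b) • β 1 := by
    intro i
    obtain ⟨a, b, hab⟩ := hreg (β i) (hreg_β i)
    obtain ⟨ω, hω, hGω⟩ : ∃ ω ∈ logStalk (η ≫ p) ∅ ξ, G (β i) = ratOf hξ (c.pull η c.x) • ω := by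
      fin_cases i
      · exact ⟨_, hG0, hGβ0⟩
      · exact ⟨_, add_mem (ratOf_smul_mem hξ _ hG0) hG1, hGβ1⟩
    obtain ⟨h1, h2⟩ := K.ev_eq_zero_of_smul_mem hβ hξ hz hu hω (hab.symm.trans hGω)
    exact ⟨a, b, h1, h2, hab⟩
  -- The form `dδ/δ` is logarithmic for the source off `E`, so its image under `G` also has regular
  -- coefficients.
  obtain ⟨b₀, b₁, hb⟩ := hreg (δ⁻¹ • ratD (η ≫ p) δ) fun y hcl hyV hyU => by
    obtain ⟨-, -, -, -, h1⟩ := h.exists_det_eq hβ hcl hyV hyU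
    exact h1
  have hδ0 : δ ≠ 0 := by
    rw [hw]
    exact mul_ne_zero (w.isUnit.map (algebraMap _ X'.functionField)).ne_zero hx0
  -- Since `δ (β_i ∧ dδ/δ) = G β_i ∧ G (dδ/δ)`, the function `β_i ∧ dδ` inherits the vanishing at
  -- `z` of the coefficients of `G β_i`.
  have hwedge : ∀ i, ∃ r, c.ev r = 0 ∧ wedge β (β i) (ratD (η ≫ p) δ) =
      fieldEquiv η (ratOf c.mem r) := by
    intro i
    obtain ⟨a₀, a₁, h0, h1, ha⟩ := hGβ i
    refine ⟨a₀ * b₁ - a₁ * b₀, by simp [h0, h1], ?_⟩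
    have h2 := hG (β i) (δ⁻¹ • ratD (η ≫ p) δ)
    rw [ha, hb, wedge_add_smul, wedge_basis, wedge_smul_right, ← mul_assoc, mul_inv_cancel₀ hδ0,
      one_mul, mul_one] at h2
    rw [← h2]
    simp only [map_sub, map_mul]
  obtain ⟨r₀, hr₀, e₀⟩ := hwedge 0
  obtain ⟨r₁, hr₁, e₁⟩ := hwedge 1
  obtain ⟨s₀, hs₀⟩ := K.fieldEquiv_ratOf_eq_mul hξ hr₀
  obtain ⟨s₁, hs₁⟩ := K.fieldEquiv_ratOf_eq_mul hξ hr₁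
  -- Functions vanishing at `z` become divisible by `x` on the chart, so `dδ` is `x` times a regular
  -- form.
  have hdδ : ratD (η ≫ p) δ =
      ratOf hξ (c.pull η c.x) • (ratOf hξ s₀ • β 1 - ratOf hξ s₁ • β 0) := by
    have h0 : wedge β (β 0) (ratD (η ≫ p) δ) = β.repr (ratD (η ≫ p) δ) 1 := by simp [wedge]
    have h1 : wedge β (β 1) (ratD (η ≫ p) δ) = -β.repr (ratD (η ≫ p) δ) 0 := by simp [wedge]
    rw [e₀, hs₀] at h0
    rw [e₁, hs₁] at h1
    rw [basis_expand β (ratD (η ≫ p) δ), ← h0, ← neg_eq_iff_eq_neg.mpr h1, smul_sub, smul_smul,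
      smul_smul, neg_smul]
    abel
  -- On the other hand `δ = w x` gives `dδ = w dx + x dw`, so `w dx` would be `x` times a regular
  -- form.
  have hdδ' : algebraMap (X'.presheaf.stalk ξ) X'.functionField w • β 0 =
      ratOf hξ (c.pull η c.x) • (ratOf hξ s₀ • β 1 - ratOf hξ s₁ • β 0 -
        ratD (η ≫ p) (algebraMap (X'.presheaf.stalk ξ) X'.functionField w)) := by
    rw [smul_sub, ← hdδ, hw, ratD_mul, hβ0]
    abel
  have hmem : ratOf hξ s₀ • β 1 - ratOf hξ s₁ • β 0 -
      ratD (η ≫ p) (algebraMap (X'.presheaf.stalk ξ) X'.functionField w) ∈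
        logStalk (η ≫ p) ∅ ξ := by
    have hm0 : β 0 ∈ logStalk (η ≫ p) ∅ ξ := hβ0 ▸ ratD_mem_logStalk ∅ ξ _
    have hm1 : β 1 ∈ logStalk (η ≫ p) ∅ ξ := hβ1 ▸ add_mem (ratOf_smul_mem hξ _ hm0)
      (ratOf_smul_mem hξ _ (ratD_mem_logStalk ∅ ξ _))
    exact sub_mem (sub_mem (ratOf_smul_mem hξ _ hm1) (ratOf_smul_mem hξ _ hm0))
      (ratD_mem_logStalk ∅ ξ _)
  rw [K.logStalk_empty hξ] at hmem
  obtain ⟨f, g, hfg⟩ := Submodule.mem_span_pair.mp hmem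
  rw [← hfg, hβ0, stalk_smul_def, stalk_smul_def, smul_add, smul_smul, smul_smul] at hdδ'
  have hadd : algebraMap (X'.presheaf.stalk ξ) X'.functionField w •
      ratD (η ≫ p) (ratOf hξ (c.pull η c.x)) + (0 : X'.functionField) •
        ratD (η ≫ p) (ratOf hξ K.τ) = algebraMap (X'.presheaf.stalk ξ) X'.functionField w •
      ratD (η ≫ p) (ratOf hξ (c.pull η c.x)) := by rw [zero_smul, add_zero]
  -- The coefficient of `dx` makes the unit `w` a multiple of `x`, which is not a unit at `ξ`.
  have h1 := (eq_of_wedge_ne_zero β hw0 (hadd.trans hdδ')).1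
  rw [ratOf_apply, ← map_mul] at h1
  have h2 := algebraMap_stalk_injective ξ h1
  exact K.not_isUnit hξ hz (isUnit_of_mul_isUnit_left (h2 ▸ w.isUnit))

/-- The exceptional curve belongs to the source arrangement if and only if it belongs to the
target, and the other members of the source do not meet it. -/
theorem LogComparison.mem_iff_mem_and_exists [IsIso (η ∣_ U)] [LocallyOfFiniteType (η ≫ p)]
    [JacobsonSpace X'] {Z : Closeds X} (h : LogComparison c U E D T G)
    (hη : IsBlowUp η (Scheme.IdealSheafData.vanishingIdeal Z))
    (hZ : ∀ q ∈ c.V.1, q ∈ Z ↔ q = z) : (E ∈ D ↔ E ∈ T) ∧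
      ∃ N : X.Opens, z ∈ N ∧ ∀ C ∈ D, C ≠ E → ∀ y ∈ C, η y ∉ N := by
  obtain ⟨K⟩ := c.nonempty_chartData hη hZ
  obtain ⟨K'⟩ := c.swap.nonempty_chartData hη hZ
  obtain ⟨ξ, hξ, hz, hu, hsp⟩ := K.exists_generic K' hη hZ
  obtain ⟨β, hβ⟩ := exists_formsBasis η c.β
  have hβ' : ∀ i, β.reindex (Equiv.swap 0 1) i = formsEquiv η p (c.swap.β i) := by
    intro i
    change β.reindex _ i = formsEquiv η p (c.β.reindex _ i)
    rw [Module.Basis.reindex_apply, Module.Basis.reindex_apply, hβ]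
  set δ := wedge β (G (β 0)) (G (β 1)) with hδ
  have hG : ∀ u v, wedge β (G u) (G v) = δ * wedge β u v := wedge_map β G.toLinearMap
  have hG' : ∀ u v, wedge (β.reindex (Equiv.swap 0 1)) (G u) (G v) =
      δ * wedge (β.reindex (Equiv.swap 0 1)) u v := by
    intro u v; rw [wedge_reindex_swap, wedge_reindex_swap, hG, mul_neg]
  have hξV := c.mem_of_mem_chart η hξ
  have hwf := K.wedge_frame hξ hβ
  have hx0 := left_ne_zero_of_mul_eq_one hwf
  have hw0 := right_ne_zero_of_mul_eq_one hwf
  -- A member through the generic point of `E` contains `E`; equality is checked at a closed point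
  -- of `E`.
  have hD : ∀ C ∈ D, ξ ∈ C → C = E := by
    intro C hC hξC
    obtain ⟨y, hyV, hcl, hξy⟩ := exists_isClosed_specializes (V := η ⁻¹ᵁ c.V.1) (q := ξ) hξV
    have hyE : y ∈ E := hξy.mem_closed E.isClosed ((h.mem_iff ξ).mpr hz)
    have hle : E ≤ C := fun y hy => (hsp y ((h.mem_iff y).mp hy)).mem_closed C.isClosed hξC
    rcases mem_chart_or (c := c) hη hZ hyV with hy | hy
    · exact h.eq_of_exceptional_le K hβ hy hcl hyE hC hle
    · exact h.swap.eq_of_exceptional_le K' hβ' hy hcl hyE hC hle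
  -- The determinant is regular off `E`, so it is the pull-back of a function `a` on the coordinate
  -- neighbourhood.
  obtain ⟨a, ha⟩ := c.exists_fieldEquiv_ratOf_eq η (U := U)
    (fun q hq hqz => (h.mem_opens_iff q hq).mpr hqz) δ fun y hcl hyV hyU => by
      obtain ⟨a, -, ha, -⟩ := h.exists_det_eq hβ hcl hyV hyU
      exact ⟨a, ha⟩
  have hE_not : E ∉ D → logStalk (η ≫ p) D ξ = logStalk (η ≫ p) ∅ ξ := fun hED =>
    logStalk_eq_empty fun C hC hξC => hED (hD C hC hξC ▸ hC)
  have hT : ∀ C ∈ T, ξ ∈ C → C = E := fun C hC hξC => h.eq_of_mem C hC ξ hξC hξV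
  have hnu := K.not_isUnit hξ hz
  have hwf' : wedge β ((ratOf hξ (c.pull η c.x))⁻¹ • ratD (η ≫ p) (ratOf hξ (c.pull η c.x)))
      (ratD (η ≫ p) (ratOf hξ K.τ)) ≠ 0 := by
    rw [wedge_smul_left]; exact mul_ne_zero (inv_ne_zero hx0) hw0
  have hcore : (E ∈ D ↔ E ∈ T) ∧
      ∃ u : (X'.presheaf.stalk ξ)ˣ, δ = algebraMap (X'.presheaf.stalk ξ) X'.functionField u := by
    by_cases hED : E ∈ D <;> by_cases hET : E ∈ T
    · refine ⟨iff_of_true hED hET, ?_⟩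
      obtain ⟨u, hu⟩ := exists_det_unit (h.mem_logStalk_iff ξ) β
        (K.logStalk_eq_span h.mem_iff hξ hz hED hD) (K.logStalk_eq_span h.mem_iff hξ hz hET hT) hwf'
      exact ⟨u, mul_right_cancel₀ hwf' hu⟩
    · exfalso
      obtain ⟨u, hu'⟩ := exists_det_unit (h.mem_logStalk_iff ξ) β
        (K.logStalk_eq_span h.mem_iff hξ hz hED hD)
        ((h.logStalk_target hξV (Or.inr hET)).trans (K.logStalk_empty hξ)) hw0
      -- Here `δ` is `x` times a unit at `ξ`.
      refine h.false_of_pole K hβ hξ hz hu hED hET hD u ?_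
      rw [wedge_smul_left, ← mul_assoc] at hu'
      have := mul_right_cancel₀ hw0 hu'
      rwa [← div_eq_mul_inv, div_eq_iff hx0] at this
    · exfalso
      obtain ⟨u, hu'⟩ := exists_det_unit (h.mem_logStalk_iff ξ) β
        ((hE_not hED).trans (K.logStalk_empty hξ)) (K.logStalk_eq_span h.mem_iff hξ hz hET hT) hwf'
      -- Here `δ x` is a unit at `ξ`, which cannot happen with `δ` regular and `x` a nonunit.
      rw [wedge_smul_left, ← mul_assoc, ← hδ, ha, fieldEquiv_ratOf_pull hξ] at hu'
      have := mul_right_cancel₀ hw0 hu'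
      rw [← div_eq_mul_inv, eq_div_iff hx0, ← map_mul, ratOf_apply] at this
      have h1 := algebraMap_stalk_injective ξ this
      rw [map_mul] at h1
      exact hnu (isUnit_of_mul_isUnit_right (h1 ▸ u.isUnit))
    · refine ⟨iff_of_false hED hET, ?_⟩
      obtain ⟨u, hu⟩ := exists_det_unit (h.mem_logStalk_iff ξ) β
        ((hE_not hED).trans (K.logStalk_empty hξ))
        ((h.logStalk_target hξV (Or.inr hET)).trans (K.logStalk_empty hξ)) hw0
      exact ⟨u, mul_right_cancel₀ hw0 hu⟩
  obtain ⟨hiff, u, hδu⟩ := hcore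
  refine ⟨hiff, X.basicOpen a, ?_, ?_⟩
  · rw [X.mem_basicOpen a z c.mem, c.isUnit_germ_iff, ← K.isUnit_pull_iff hξ hz]
    rw [ha, fieldEquiv_ratOf_pull hξ, ratOf_apply] at hδu
    exact algebraMap_stalk_injective ξ hδu ▸ u.isUnit
  · intro C hC hne y' hyC' hyN'
    -- Another member meeting this neighbourhood would do so at a closed point, where `δ` is a unit.
    -- On `E` this contradicts simple normal crossings, and off `E` the determinant vanishes on
    -- every member.
    obtain ⟨y, hyN, hcl, hsp'⟩ := exists_isClosed_specializes (V := η ⁻¹ᵁ X.basicOpen a) hyN'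
    have hyC : y ∈ C := hsp'.mem_closed C.isClosed hyC'
    have hyV : η y ∈ c.V.1 := X.basicOpen_le a hyN
    have hyN : η y ∈ X.basicOpen a := hyN
    have hunit : IsUnit (η.stalkMap y (X.presheaf.germ _ (η y) hyV a)) :=
      ((X.mem_basicOpen a _ hyV).mp hyN).map (η.stalkMap y).hom
    have hδy : δ =
        algebraMap _ X'.functionField (η.stalkMap y (X.presheaf.germ _ (η y) hyV a)) := by
      rw [ha, ratOf_eq c.mem hyV, ratOf_apply, fieldEquiv_algebraMap]
    by_cases hyE : y ∈ E
    · have hu' : ∃ u : (X'.presheaf.stalk y)ˣ,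
          δ = algebraMap (X'.presheaf.stalk y) X'.functionField u := ⟨hunit.unit, hδy⟩
      rcases mem_chart_or (c := c) hη hZ hyV with hy | hy
      · exact hne (h.eq_of_isUnit K hβ hiff.mpr hG hy hcl hyE hu' hC hyC)
      · exact hne (h.swap.eq_of_isUnit K' hβ' hiff.mpr hG' hy hcl hyE hu' hC hyC)
    · have hyU : η y ∈ U := (h.mem_opens_iff _ hyV).mpr fun hz => hyE ((h.mem_iff y).mpr hz)
      obtain ⟨b, -, hb, hnu, -⟩ := h.exists_det_eq hβ hcl hyV hyU
      refine hnu C hC hyC ?_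
      rw [← algebraMap_stalk_injective y (hδy.symm.trans hb)]
      exact hunit

end Detect

/-! ### Arrangements on the blow-up -/

section MaximalIdeal

variable {X : Scheme.{0}}

theorem map_germ_eq_maximalIdeal {V : X.Opens} (hV : IsAffineOpen V) {q : X} (hq : q ∈ V)
    {I : Ideal Γ(X, V)} (h : ∀ s, ¬ IsUnit (X.presheaf.germ V q hq s) ↔ s ∈ I) :
    I.map (X.presheaf.germ V q hq).hom = IsLocalRing.maximalIdeal (X.presheaf.stalk q) := by
  apply le_antisymm
  · rw [Ideal.map_le_iff_le_comap]
    exact fun s hs => (h s).mpr hs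
  · intro a ha
    let : Algebra Γ(X, V) (X.presheaf.stalk q) := (X.presheaf.germ V q hq).hom.toAlgebra
    have : IsLocalization.AtPrime (X.presheaf.stalk q) (hV.primeIdealOf ⟨q, hq⟩).asIdeal :=
      hV.isLocalization_stalk ⟨q, hq⟩
    obtain ⟨⟨s, t⟩, hst⟩ := IsLocalization.surj (hV.primeIdealOf ⟨q, hq⟩).asIdeal.primeCompl a
    have ht : IsUnit (X.presheaf.germ V q hq t.1) :=
      IsLocalization.map_units (X.presheaf.stalk q) t
    have hst : a * X.presheaf.germ V q hq t.1 = X.presheaf.germ V q hq s := hst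
    have hs : s ∈ I := by
      rw [← h, ← hst]
      exact fun hu => ha (isUnit_of_mul_isUnit_left hu)
    rw [← Ideal.mul_unit_mem_iff_mem _ ht, hst]
    exact Ideal.mem_map_of_mem _ hs

theorem span_range_pair {R : Type*} [CommRing R] (a b : R) :
    Ideal.span (Set.range ![a, b]) = Ideal.span {a, b} := by
  rw [Matrix.range_cons, Matrix.range_cons, Matrix.range_empty, Set.union_empty,
    Set.singleton_union]

variable [IsIntegral X] {p : X ⟶ SpecC} {z : X} (c : CoordNhd p z)

theorem CoordNhd.span_eq_maximalIdeal :
    Ideal.span (Set.range ![X.presheaf.germ _ z c.mem c.x, X.presheaf.germ _ z c.mem c.y]) =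
      IsLocalRing.maximalIdeal (X.presheaf.stalk z) := by
  rw [span_range_pair, ← map_germ_eq_maximalIdeal c.V.2 c.mem (I := Ideal.span {c.x, c.y}),
    Ideal.map_span, Set.image_pair]
  intro s
  rw [c.isUnit_germ_iff, not_not, c.ev_eq_zero_iff]

/-- Linear maps preserving regular forms on a punctured coordinate neighbourhood preserve regular
forms at the point. -/
theorem CoordNhd.map_mem_logStalk
    (G : RationalForms p →ₗ[X.functionField] RationalForms p)
    (h : ∀ q ∈ c.V.1, q ≠ z → ∀ ω ∈ logStalk p ∅ q, G ω ∈ logStalk p ∅ q) :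
    ∀ ω ∈ logStalk p ∅ z, G ω ∈ logStalk p ∅ z := by
  have key : ∀ i, G (c.β i) ∈ logStalk p ∅ z := by
    intro i
    have hcoef : ∀ j, ∃ a, c.β.repr (G (c.β i)) j = ratOf c.mem a := by
      intro j
      refine c.exists_ratOf_eq _ fun q hq hqz => ?_
      have h1 := h q hq hqz (c.β i) (by
        rw [c.logStalk_empty q hq]
        apply Submodule.subset_span
        fin_cases i <;> simp)
      rw [c.logStalk_empty q hq] at h1
      obtain ⟨s, t, hst⟩ := Submodule.mem_span_pair.mp h1
      rw [← hst, stalk_smul_def, stalk_smul_def]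
      fin_cases j
      · exact ⟨s, by simp [-algebraMap_smul]⟩
      · exact ⟨t, by simp [-algebraMap_smul]⟩
    obtain ⟨a, ha⟩ := hcoef 0
    obtain ⟨b, hb⟩ := hcoef 1
    rw [basis_expand c.β (G (c.β i)), ha, hb, c.logStalk_empty z c.mem]
    exact Submodule.mem_span_pair.mpr ⟨_, _, rfl⟩
  intro ω hω
  rw [c.logStalk_empty z c.mem] at hω
  obtain ⟨a, b, rfl⟩ := Submodule.mem_span_pair.mp hω
  rw [map_add, stalk_smul_def, stalk_smul_def, map_smul, map_smul]
  exact add_mem (Submodule.smul_mem _ a (key 0)) (Submodule.smul_mem _ b (key 1))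

variable {c} {X' : Scheme.{0}} {η : X' ⟶ X}

/-- The equation of the exceptional curve is part of a system of coordinates. -/
theorem ChartData.exists_span_eq_maximalIdeal [LocallyOfFiniteType (η ≫ p)] (K : ChartData c η)
    {y : X'} (hy : y ∈ c.chart η) (hz : η y = z) (hcl : IsClosed ({y} : Set X')) :
    ∃ t, Ideal.span (Set.range ![X'.presheaf.germ _ y hy (c.pull η c.x), t]) =
      IsLocalRing.maximalIdeal (X'.presheaf.stalk y) := by
  obtain ⟨ev, hev, hu⟩ := exists_ev (η ≫ p) hcl K.affine hy (finiteType_structMap (η ≫ p) K.affine)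
  have hx : ev (c.pull η c.x) = 0 := by
    by_contra hne
    exact K.not_isUnit hy hz ((hu _).mpr hne)
  let κ := structMap (η ≫ p) (c.chart η)
  -- The second coordinate is `τ` minus its value at the point. Modulo `x` every pulled-back
  -- function is constant, so modulo `I` every function is constant.
  let I : Ideal Γ(X', c.chart η) := Ideal.span {c.pull η c.x, K.τ - κ (ev K.τ)}
  have hev_pull : ∀ a, ev (c.pull η a) = c.ev a := by
    intro a
    have h0 : K.π (c.pull η (a - structMap p _ (c.ev a))) = 0 := by
      rw [K.π_pull, map_sub, c.ev_structMap, sub_self, map_zero]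
    obtain ⟨s, hs⟩ := Ideal.mem_span_singleton.mp ((K.π_eq_zero_iff _).mp h0)
    have h1 := congrArg ev hs
    rw [map_mul, hx, zero_mul, map_sub, map_sub, pull_structMap, hev, sub_eq_zero] at h1
    exact h1
  have hI : ∀ b, b - κ (ev b) ∈ I := by
    intro b
    obtain ⟨g, rfl⟩ := K.exists_eval₂ b
    induction g using Polynomial.induction_on with
    | C a =>
      rw [Polynomial.eval₂_C, hev_pull]
      have h0 : K.π (c.pull η (a - structMap p _ (c.ev a))) = 0 := by
        rw [K.π_pull, map_sub, c.ev_structMap, sub_self, map_zero]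
      have h1 := (K.π_eq_zero_iff _).mp h0
      rw [map_sub, pull_structMap] at h1
      exact Ideal.span_mono (by simp) h1
    | add f g hf hg =>
      rw [Polynomial.eval₂_add, map_add, map_add, add_sub_add_comm]
      exact add_mem hf hg
    | monomial n a h =>
      rw [pow_succ, ← mul_assoc, Polynomial.eval₂_mul, Polynomial.eval₂_X, map_mul, map_mul]
      set b := Polynomial.eval₂ (c.pull η) K.τ (Polynomial.C a * Polynomial.X ^ n)
      have e : b * K.τ - κ (ev b) * κ (ev K.τ) =
          (b - κ (ev b)) * K.τ + κ (ev b) * (K.τ - κ (ev K.τ)) := by ring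
      rw [e]
      exact add_mem (Ideal.mul_mem_right _ _ h)
        (Ideal.mul_mem_left _ _ (Ideal.subset_span (by simp)))
  refine ⟨X'.presheaf.germ _ y hy (K.τ - κ (ev K.τ)), ?_⟩
  rw [span_range_pair, ← map_germ_eq_maximalIdeal K.affine hy (I := I), Ideal.map_span,
    Set.image_pair]
  intro s
  rw [hu, not_not]
  constructor
  · intro hs
    have := hI s
    rwa [hs, map_zero, sub_zero] at this
  · intro hs
    obtain ⟨a, b, rfl⟩ := Ideal.mem_span_pair.mp hs
    rw [map_add, map_mul, map_mul, hx, map_sub, hev, sub_self, mul_zero, mul_zero, add_zero]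

end MaximalIdeal

/-! ### Transport of simple normal crossings across the isomorphism off the center. -/

section Transport

variable {X X' : Scheme.{0}} {η : X' ⟶ X} {U : X.Opens} [IsIso (η ∣_ U)]

theorem map_maximalIdeal_of_restrict {y : X'} (hy : η y ∈ U) (z : Fin 2 → X.presheaf.stalk (η y)) :
    Ideal.span (Set.range fun i => η.stalkMap y (z i)) =
      IsLocalRing.maximalIdeal (X'.presheaf.stalk y) ↔
    Ideal.span (Set.range z) = IsLocalRing.maximalIdeal (X.presheaf.stalk (η y)) := by
  have := isIso_stalkMap_of_restrict (η := η) U hy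
  let e := (asIso (η.stalkMap y)).commRingCatIsoToRingEquiv
  have he : ∀ a, e a = η.stalkMap y a := fun _ => rfl
  have h1 : (Ideal.span (Set.range z)).map e =
      Ideal.span (Set.range fun i => η.stalkMap y (z i)) := by
    rw [Ideal.map_span, ← Set.range_comp]; rfl
  have h2 : (IsLocalRing.maximalIdeal (X.presheaf.stalk (η y))).map e =
      IsLocalRing.maximalIdeal (X'.presheaf.stalk y) := by
    ext a
    obtain ⟨a, rfl⟩ := e.surjective a
    rw [Ideal.mem_map_of_equiv]
    constructor
    · rintro ⟨b, hb, h⟩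
      rw [e.injective h] at hb
      exact fun hu => hb ((MulEquiv.isUnit_map e).mp hu)
    · intro h
      exact ⟨a, fun hu => h (hu.map e), rfl⟩
  rw [← h1, ← h2]
  refine ⟨fun h => ?_, fun h => by rw [h]⟩
  have := congrArg (Ideal.comap e) h
  rwa [Ideal.comap_map_of_bijective _ e.bijective,
    Ideal.comap_map_of_bijective _ e.bijective] at this

/-- Simple normal crossings where the morphism is an isomorphism. -/
theorem snc_of_restrict {D : Set (Closeds X)} {D' : Set (Closeds X')} {y : X'} (hy : η y ∈ U)
    (h : ∀ C' ∈ D', y ∈ C' → ∃ C ∈ D, ∀ y, η y ∈ U → (y ∈ C' ↔ η y ∈ C))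
    (hD : ∃ z : Fin 2 → X.presheaf.stalk (η y),
      Ideal.span (Set.range z) = IsLocalRing.maximalIdeal (X.presheaf.stalk (η y)) ∧
      ∀ C ∈ D, η y ∈ C → ∃ j, IsLocalEquation C (η y) (z j)) :
    ∃ z : Fin 2 → X'.presheaf.stalk y,
      Ideal.span (Set.range z) = IsLocalRing.maximalIdeal (X'.presheaf.stalk y) ∧
      ∀ C ∈ D', y ∈ C → ∃ j, IsLocalEquation C y (z j) := by
  obtain ⟨z, hz, hzD⟩ := hD
  refine ⟨fun i => η.stalkMap y (z i), (map_maximalIdeal_of_restrict hy z).mpr hz, ?_⟩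
  intro C' hC' hyC'
  obtain ⟨C, hC, hCC⟩ := h C' hC' hyC'
  obtain ⟨j, hj⟩ := hzD C hC ((hCC y hy).mp hyC')
  exact ⟨j, (isLocalEquation_stalkMap_iff hCC hy _).mpr hj⟩

theorem snc_restrict {D : Set (Closeds X)} {D' : Set (Closeds X')} {y : X'} (hy : η y ∈ U)
    (h : ∀ C ∈ D, η y ∈ C → ∃ C' ∈ D', ∀ y, η y ∈ U → (y ∈ C' ↔ η y ∈ C))
    (hD : ∃ z : Fin 2 → X'.presheaf.stalk y,
      Ideal.span (Set.range z) = IsLocalRing.maximalIdeal (X'.presheaf.stalk y) ∧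
      ∀ C ∈ D', y ∈ C → ∃ j, IsLocalEquation C y (z j)) :
    ∃ z : Fin 2 → X.presheaf.stalk (η y),
      Ideal.span (Set.range z) = IsLocalRing.maximalIdeal (X.presheaf.stalk (η y)) ∧
      ∀ C ∈ D, η y ∈ C → ∃ j, IsLocalEquation C (η y) (z j) := by
  obtain ⟨z', hz, hzD⟩ := hD
  have := isIso_stalkMap_of_restrict (η := η) U hy
  choose z hzz using fun i => (ConcreteCategory.bijective_of_isIso (η.stalkMap y)).2 (z' i)
  obtain rfl : (fun i => η.stalkMap y (z i)) = z' := funext hzz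
  refine ⟨z, (map_maximalIdeal_of_restrict hy z).mp hz, fun C hC hyC => ?_⟩
  obtain ⟨C', hC', hCC⟩ := h C hC hyC
  obtain ⟨j, hj⟩ := hzD C' hC' ((hCC y hy).mpr hyC)
  exact ⟨j, (isLocalEquation_stalkMap_iff hCC hy _).mp hj⟩

end Transport

/-! ### Torelli arrangements on the blow-up -/

section Main

variable {X X' : Scheme.{0}} {η : X' ⟶ X} {Z : Closeds X} {p : X ⟶ SpecC}

/-- The preimage of a closed subset. -/
def preimageCloseds (η : X' ⟶ X) (C : Closeds X) : Closeds X' :=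
  ⟨η ⁻¹' C, C.isClosed.preimage η.continuous⟩

theorem mem_preimageCloseds {C : Closeds X} {y : X'} : y ∈ preimageCloseds η C ↔ η y ∈ C := Iff.rfl

theorem strictTransform_eq {C : Closeds X} (h : Disjoint (C : Set X) Z) :
    strictTransform η Z C = preimageCloseds η C := by
  apply SetLike.coe_injective
  rw [strictTransform, Closeds.coe_closure, h.sdiff_eq_left]
  exact (preimageCloseds η C).isClosed.closure_eq

/-- The exceptional curve over a closed point. -/
def fiberCloseds (η : X' ⟶ X) {z : X} (hz : IsClosed ({z} : Set X)) : Closeds X' :=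
  preimageCloseds η ⟨{z}, hz⟩

theorem mem_fiberCloseds {z : X} {hz : IsClosed ({z} : Set X)} {y : X'} :
    y ∈ fiberCloseds η hz ↔ η y = z := Iff.rfl

theorem mem_exceptionalCurves_iff (hZ' : ∀ z ∈ Z, IsClosed ({z} : Set X)) {E : Closeds X'} :
    E ∈ exceptionalCurves η Z ↔ ∃ (z : X) (hz : z ∈ Z), E = fiberCloseds η (hZ' z hz) := by
  constructor
  · rintro ⟨z, hz, h⟩; exact ⟨z, hz, SetLike.coe_injective h⟩
  · rintro ⟨z, hz, rfl⟩; exact ⟨z, hz, rfl⟩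

theorem mem_strictTransforms_iff {D : Set (Closeds X)}
    (hDZ : ∀ C ∈ D, Disjoint (C : Set X) (Z : Set X)) {C' : Closeds X'} :
    C' ∈ strictTransforms η Z D ↔ ∃ C ∈ D, C' = preimageCloseds η C := by
  constructor
  · rintro ⟨C, hC, rfl⟩; exact ⟨C, hC, strictTransform_eq (hDZ C hC)⟩
  · rintro ⟨C, hC, rfl⟩; exact ⟨C, hC, strictTransform_eq (hDZ C hC)⟩

theorem finite_exceptionalCurves (hZ : (Z : Set X).Finite)
    (hZ' : ∀ z ∈ Z, IsClosed ({z} : Set X)) : (exceptionalCurves η Z).Finite := by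
  have : Finite Z := hZ
  refine (Set.finite_range fun z : Z => fiberCloseds η (hZ' z.1 z.2)).subset ?_
  intro E hE
  obtain ⟨z, hz, rfl⟩ := (mem_exceptionalCurves_iff hZ').mp hE
  exact ⟨⟨z, hz⟩, rfl⟩

theorem IsArrangement.mono {D D' : Set (Closeds X)} (h : IsArrangement p D) (hle : D' ⊆ D) :
    IsArrangement p D' := by
  refine ⟨h.finite.subset hle, fun C hC => h.isSmoothCurve C (hle hC), fun x hx => ?_⟩
  obtain ⟨z, hz, hzD⟩ := h.snc x hx
  exact ⟨z, hz, fun C hC => hzD C (hle hC)⟩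

theorem isClosed_sUnion_closeds {D : Set (Closeds X)} (hD : D.Finite) :
    IsClosed {x | ∃ C ∈ D, x ∈ C} := by
  have : {x | ∃ C ∈ D, x ∈ C} = ⋃ C ∈ D, (C : Set X) := by ext; simp
  rw [this]
  exact hD.isClosed_biUnion fun C _ => C.isClosed

variable [IsIntegral X]

/-- At a point of `Z` the coordinate `x` is a nonzero nonunit, whereas the local ring at the generic
point is a field. -/
theorem genericPoint_notMem [SmoothOfRelativeDimension 2 p] (hZ : (Z : Set X).Finite)
    (hZ' : ∀ z ∈ Z, IsClosed ({z} : Set X)) : genericPoint X ∉ Z := by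
  intro h
  obtain ⟨c, -, -⟩ := exists_coordNhd_of_mem (p := p) hZ hZ' h (N := ⊤) trivial
  have hx : ¬ IsUnit (X.presheaf.germ _ _ c.mem c.x) := by
    rw [c.isUnit_germ_iff, not_not, c.ev_x]
  refine hx (IsUnit.mk0 (G₀ := X.functionField) _ fun h0 => c.x_ne_zero ?_)
  apply ratOf_injective c.mem
  rw [map_zero, ratOf_apply, h0, map_zero]

/-- Strict transforms stay off the fibres over `Z`, so over `Z` only the exceptional curve is to be
checked, and its equation is part of a coordinate system. Off `Z` everything is copied from `X`. -/
theorem isArrangement_strictTransforms_union [IsIntegral X'] [SmoothOfRelativeDimension 2 p]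
    [LocallyOfFiniteType (η ≫ p)] [JacobsonSpace X] [LocallyOfFiniteType η]
    (hη : IsBlowUp η (Scheme.IdealSheafData.vanishingIdeal Z))
    (hZ : (Z : Set X).Finite) (hZ' : ∀ z ∈ Z, IsClosed ({z} : Set X)) {D : Set (Closeds X)}
    (hD : IsArrangement p D) (hDZ : ∀ C ∈ D, Disjoint (C : Set X) (Z : Set X)) :
    IsArrangement (η ≫ p) (strictTransforms η Z D ∪ exceptionalCurves η Z) := by
  have := hη.isIso_restrict
  refine ⟨(hD.finite.image _).union (finite_exceptionalCurves hZ hZ'), ?_, ?_⟩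
  · rintro C' (hC' | hC')
    · obtain ⟨C, hC, rfl⟩ := (mem_strictTransforms_iff hDZ).mp hC'
      refine (isSmoothCurve_iff_of_restrict (U := complOpens Z) p (fun x hx =>
        Set.disjoint_left.mp (hDZ C hC) hx) fun y => mem_preimageCloseds).mpr
          (hD.isSmoothCurve C hC)
    · obtain ⟨z, hz, rfl⟩ := (mem_exceptionalCurves_iff hZ').mp hC'
      obtain ⟨c, -, hc⟩ := exists_coordNhd_of_mem (p := p) hZ hZ' hz (N := ⊤) trivial
      obtain ⟨K⟩ := c.nonempty_chartData hη hc
      obtain ⟨K'⟩ := c.swap.nonempty_chartData hη hc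
      exact isSmoothCurve_exceptional K K' hη hc fun y => mem_fiberCloseds
  · intro y hy
    by_cases hyZ : η y ∈ Z
    · obtain ⟨c, -, hc⟩ := exists_coordNhd_of_mem (p := p) hZ hZ' hyZ (N := ⊤) trivial
      have key : ∀ c : CoordNhd p (η y), ChartData c η → y ∈ c.chart η →
          ∃ z : Fin 2 → X'.presheaf.stalk y,
            Ideal.span (Set.range z) = IsLocalRing.maximalIdeal (X'.presheaf.stalk y) ∧
            ∀ C ∈ strictTransforms η Z D ∪ exceptionalCurves η Z, y ∈ C →
              ∃ j, IsLocalEquation C y (z j) := by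
        intro c K hyc
        obtain ⟨t, ht⟩ := K.exists_span_eq_maximalIdeal hyc rfl hy
        refine ⟨_, ht, ?_⟩
        rintro C' (hC' | hC') hyC
        · obtain ⟨C, hC, rfl⟩ := (mem_strictTransforms_iff hDZ).mp hC'
          exact absurd hyZ (Set.disjoint_left.mp (hDZ C hC) hyC)
        · obtain ⟨z, hz, rfl⟩ := (mem_exceptionalCurves_iff hZ').mp hC'
          have hyz : η y = z := hyC
          exact ⟨0, K.isLocalEquation (fun y' => by rw [mem_fiberCloseds, hyz]) hyc⟩
      obtain ⟨K⟩ := c.nonempty_chartData hη hc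
      obtain ⟨K'⟩ := c.swap.nonempty_chartData hη hc
      rcases mem_chart_or (c := c) hη hc c.mem with h | h
      exacts [key c K h, key c.swap K' h]
    · refine snc_of_restrict (U := complOpens Z) hyZ ?_
        (hD.snc (η y) (η.closePoints_subset_preimage_closedPoints hy))
      rintro C' (hC' | hC') hyC
      · obtain ⟨C, hC, rfl⟩ := (mem_strictTransforms_iff hDZ).mp hC'
        exact ⟨C, hC, fun y _ => mem_preimageCloseds⟩
      · obtain ⟨z, hz, rfl⟩ := (mem_exceptionalCurves_iff hZ').mp hC'
        have hyz : η y = z := hyC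
        exact absurd (hyz ▸ hz) hyZ

/-- The linear equivalence of rational forms transported to the base. -/
def transportEquiv [IsIntegral X'] [IsIso (η.stalkMap (genericPoint X'))]
    (G : RationalForms (η ≫ p) ≃ₗ[X'.functionField] RationalForms (η ≫ p)) :
    RationalForms p ≃ₗ[X.functionField] RationalForms p :=
  { ((formsEquiv η p).trans G.toAddEquiv).trans (formsEquiv η p).symm with
    map_smul' := fun a ω => by
      apply (formsEquiv η p).injective
      simp [formsEquiv_smul] }

theorem formsEquiv_transportEquiv [IsIntegral X'] [IsIso (η.stalkMap (genericPoint X'))]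
    (G : RationalForms (η ≫ p) ≃ₗ[X'.functionField] RationalForms (η ≫ p)) (ω : RationalForms p) :
    formsEquiv η p (transportEquiv G ω) = G (formsEquiv η p ω) :=
  (formsEquiv η p).apply_symm_apply _

/-- An arrangement on the blow-up whose logarithmic sheaf is isomorphic to that of the strict
transforms of `D`, possibly together with exceptional curves, agrees with it. -/
theorem eq_of_iso [IsIntegral X'] [SmoothOfRelativeDimension 2 p]
    [LocallyOfFiniteType (η ≫ p)] [LocallyOfFiniteType p] [JacobsonSpace X] [JacobsonSpace X']
    [IsIso (η.stalkMap (genericPoint X'))] [IsLocallyNoetherian X'] [IsLocallyNoetherian X]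
    (hη : IsBlowUp η (Scheme.IdealSheafData.vanishingIdeal Z))
    (hZ : (Z : Set X).Finite) (hZ' : ∀ z ∈ Z, IsClosed ({z} : Set X)) {D : Set (Closeds X)}
    (hD : IsTorelliArrangement p D) (hDZ : ∀ C ∈ D, Disjoint (C : Set X) (Z : Set X))
    {T D' : Set (Closeds X')} (hST : strictTransforms η Z D ⊆ T)
    (hTS : T ⊆ strictTransforms η Z D ∪ exceptionalCurves η Z) (hD' : IsArrangement (η ≫ p) D')
    (e : Nonempty (logSheaf (η ≫ p) D' ≅ logSheaf (η ≫ p) T)) : D' = T := by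
  have := hη.isIso_restrict
  obtain ⟨e⟩ := e
  obtain ⟨G, hG⟩ := exists_linearEquiv_of_iso e
  have hDz : ∀ z ∈ Z, z ∈ (⟨{x | ∃ C ∈ D, x ∈ C}ᶜ,
      (isClosed_sUnion_closeds hD.1.finite).isOpen_compl⟩ : X.Opens) := by
    rintro z hz ⟨C, hC, hzC⟩
    exact Set.disjoint_left.mp (hDZ C hC) hzC hz
  -- Coordinate neighbourhoods avoiding the members of `D` meet only the exceptional part of `T`, so
  -- the determinant argument applies over each point of `Z`.
  have local_at : ∀ z (hz : z ∈ Z),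
      (fiberCloseds η (hZ' z hz) ∈ D' ↔ fiberCloseds η (hZ' z hz) ∈ T) ∧
      ∃ N : X.Opens, z ∈ N ∧ ∀ C ∈ D', C ≠ fiberCloseds η (hZ' z hz) → ∀ y ∈ C, η y ∉ N := by
    intro z hz
    obtain ⟨c, hcN, hc⟩ := exists_coordNhd_of_mem (p := p) hZ hZ' hz (hDz z hz)
    have hcomp : LogComparison c (complOpens Z) (fiberCloseds η (hZ' z hz)) D' T G :=
      { mem_iff := fun y => mem_fiberCloseds
        mem_opens_iff := fun q hq => (hc q hq).not
        irreducible := fun C hC => (hD'.isSmoothCurve C hC).irreducible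
        snc := hD'.snc
        eq_of_mem := by
          intro C hC y hyC hyV
          rcases hTS hC with h | h
          · obtain ⟨C₀, hC₀, rfl⟩ := (mem_strictTransforms_iff hDZ).mp h
            exact absurd ⟨C₀, hC₀, hyC⟩ (hcN hyV)
          · obtain ⟨z', hz', rfl⟩ := (mem_exceptionalCurves_iff hZ').mp h
            have hyz : η y = z' := hyC
            obtain rfl : z' = z := (hc z' (hyz ▸ hyV)).mp hz'
            rfl
        mem_logStalk_iff := hG }
    exact hcomp.mem_iff_mem_and_exists hη hc
  have not_exc : ∀ C : Closeds X', ∀ y ∈ C, η y ∉ Z → ∀ z (hz : z ∈ Z),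
      C ≠ fiberCloseds η (hZ' z hz) := by
    rintro C y hyC hyZ z hz rfl
    have hyz : η y = z := hyC
    exact hyZ (hyz ▸ hz)
  have descend : ∀ C' ∈ D', (∀ z (hz : z ∈ Z), C' ≠ fiberCloseds η (hZ' z hz)) →
      ∃ C : Closeds X, Disjoint (C : Set X) Z ∧ preimageCloseds η C = C' := by
    intro C' hC' hne
    -- The image is closed: near `Z` it is empty by the determinant argument, and off `Z` the
    -- morphism is a homeomorphism.
    have hcl : IsClosed (η '' (C' : Set X')) := by
      rw [← isOpen_compl_iff, isOpen_iff_forall_mem_open]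
      intro q hq
      by_cases hqZ : q ∈ Z
      · obtain ⟨-, N, hzN, hN⟩ := local_at q hqZ
        refine ⟨N, ?_, N.isOpen, hzN⟩
        rintro _ hqN ⟨y, hy, rfl⟩
        exact hN C' hC' (hne q hqZ) y hy hqN
      · obtain ⟨y, rfl⟩ := exists_eq_of_mem (η := η) (U := complOpens Z) hqZ
        have hy : y ∉ C' := fun hy => hq ⟨y, hy, rfl⟩
        obtain ⟨N, hyN, -, hN⟩ := exists_open_preimage (η := η) (U := complOpens Z)
          (W := complOpens C') hy hqZ
        refine ⟨N, ?_, N.isOpen, hyN⟩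
        rintro _ hqN ⟨y', hy', rfl⟩
        exact hN hqN hy'
    have hdisj : ∀ y ∈ C', η y ∉ Z := by
      intro y hy hyZ
      obtain ⟨-, N, hzN, hN⟩ := local_at _ hyZ
      exact hN C' hC' (hne _ hyZ) y hy hzN
    refine ⟨⟨_, hcl⟩, Set.disjoint_left.mpr ?_, ?_⟩
    · rintro _ ⟨y, hy, rfl⟩; exact hdisj y hy
    · apply SetLike.coe_injective
      apply Set.Subset.antisymm
      · rintro y ⟨y', hy', h⟩
        rwa [← eq_of_map_eq (η := η) (U := complOpens Z) (hdisj y' hy') h]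
      · exact fun y hy => ⟨y, hy, rfl⟩
  -- The curves on `X` whose preimages are the nonexceptional members of `D'`.
  let D'' : Set (Closeds X) := {C | Disjoint (C : Set X) Z ∧ preimageCloseds η C ∈ D'}
  have hD''arr : IsArrangement p D'' := by
    refine ⟨?_, ?_, ?_⟩
    · refine Set.Finite.of_injOn (f := preimageCloseds η) (t := D') (fun C hC => hC.2) ?_ hD'.finite
      have hle : ∀ C₁ ∈ D'', ∀ C₂, preimageCloseds η C₁ = preimageCloseds η C₂ → C₁ ≤ C₂ := by
        intro C₁ h₁ C₂ h x hx
        obtain ⟨y, rfl⟩ := exists_eq_of_mem (η := η) (U := complOpens Z)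
          (Set.disjoint_left.mp h₁.1 hx)
        have : y ∈ preimageCloseds η C₁ := hx
        rw [h] at this
        exact this
      exact fun C₁ h₁ C₂ h₂ h => le_antisymm (hle C₁ h₁ C₂ h) (hle C₂ h₂ C₁ h.symm)
    · intro C hC
      exact (isSmoothCurve_iff_of_restrict (U := complOpens Z) p (fun x hx =>
        Set.disjoint_left.mp hC.1 hx) fun y => mem_preimageCloseds).mp
          (hD'.isSmoothCurve _ hC.2)
    · intro q hq
      by_cases hqZ : q ∈ Z
      · obtain ⟨c, -, -⟩ := exists_coordNhd_of_mem (p := p) hZ hZ' hqZ (N := ⊤) trivial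
        -- No member passes through a point of `Z`, so any coordinates there will do.
        exact ⟨_, c.span_eq_maximalIdeal, fun C hC hqC =>
          absurd hqZ (Set.disjoint_left.mp hC.1 hqC)⟩
      · obtain ⟨y, rfl⟩ := exists_eq_of_mem (η := η) (U := complOpens Z) hqZ
        have hy : IsClosed ({y} : Set X') := by
          have : ({y} : Set X') = η ⁻¹' {η y} := by
            ext y'
            exact ⟨fun h => congrArg η h,
              fun h => (eq_of_map_eq (η := η) (U := complOpens Z) hqZ (Eq.symm h)).symm⟩
          rw [this]
          exact hq.preimage η.continuous
        exact snc_restrict (U := complOpens Z) hqZ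
          (fun C hC _ => ⟨_, hC.2, fun y _ => mem_preimageCloseds⟩) (hD'.snc y hy)
  have hD''z : ∀ z ∈ Z, z ∈ (⟨{x | ∃ C ∈ D'', x ∈ C}ᶜ,
      (isClosed_sUnion_closeds hD''arr.finite).isOpen_compl⟩ : X.Opens) := by
    rintro z hz ⟨C, hC, hzC⟩
    exact Set.disjoint_left.mp hC.1 hzC hz
  have hoff : ∀ q, q ∉ Z → ∀ ω, ω ∈ logStalk p D'' q ↔ transportEquiv G ω ∈ logStalk p D q := by
    intro q hqZ ω
    obtain ⟨y, rfl⟩ := exists_eq_of_mem (η := η) (U := complOpens Z) hqZ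
    have h1 := mem_logStalk_iff_of_restrict (p := p) (D := D'') (D' := D') (U := complOpens Z) hqZ
      (fun C hC _ => ⟨_, hC.2, fun y _ => mem_preimageCloseds⟩) (by
        intro C' hC' hyC'
        obtain ⟨C, hdisj, rfl⟩ := descend C' hC' (not_exc C' y hyC' hqZ)
        exact ⟨C, ⟨hdisj, hC'⟩, fun y _ => mem_preimageCloseds⟩) ω
    have h2 := mem_logStalk_iff_of_restrict (p := p) (D := D) (D' := T) (U := complOpens Z) hqZ
      (fun C hC _ => ⟨_, hST ((mem_strictTransforms_iff hDZ).mpr ⟨C, hC, rfl⟩),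
        fun y _ => mem_preimageCloseds⟩) (by
        intro C' hC' hyC'
        rcases hTS hC' with h | h
        · obtain ⟨C, hC, rfl⟩ := (mem_strictTransforms_iff hDZ).mp h
          exact ⟨C, hC, fun y _ => mem_preimageCloseds⟩
        · obtain ⟨z, hz, rfl⟩ := (mem_exceptionalCurves_iff hZ').mp h
          exact absurd rfl (not_exc _ y hyC' hqZ z hz)) (transportEquiv G ω)
    rw [← h1, hG, ← h2, formsEquiv_transportEquiv]
  -- Near a point of `Z` neither `D''` nor `D` has members, so the forms are regular there. Both the
  -- automorphism and its inverse preserve regular forms off the point, hence at the point by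
  -- Hartogs.
  have hall : ∀ q ω, ω ∈ logStalk p D'' q ↔ transportEquiv G ω ∈ logStalk p D q := by
    intro q
    by_cases hqZ : q ∈ Z
    · obtain ⟨c, hcN, hc⟩ := exists_coordNhd_of_mem (p := p) hZ hZ' hqZ
        (Opens.mem_inf.mpr ⟨hDz q hqZ, hD''z q hqZ⟩)
      have e1 : ∀ x ∈ c.V.1, logStalk p D x = logStalk p ∅ x := fun x hx =>
        logStalk_eq_empty fun C hC hxC => (Opens.mem_inf.mp (hcN hx)).1 ⟨C, hC, hxC⟩
      have e2 : ∀ x ∈ c.V.1, logStalk p D'' x = logStalk p ∅ x := fun x hx =>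
        logStalk_eq_empty fun C hC hxC => (Opens.mem_inf.mp (hcN hx)).2 ⟨C, hC, hxC⟩
      rw [e1 q c.mem, e2 q c.mem]
      intro ω
      constructor
      · refine c.map_mem_logStalk (transportEquiv G).toLinearMap (fun x hx hxq ω hω => ?_) ω
        rw [← e1 x hx]
        exact (hoff x (fun h => hxq ((hc x hx).mp h)) ω).mp (by rwa [e2 x hx])
      · intro hω
        have := c.map_mem_logStalk (transportEquiv G).symm.toLinearMap (fun x hx hxq ω hω => by
          rw [← e2 x hx]
          refine (hoff x (fun h => hxq ((hc x hx).mp h)) _).mpr ?_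
          rw [e1 x hx]
          simpa using hω) _ hω
        simpa using this
    · exact hoff q hqZ
  have hDD : D'' = D := hD.2 D'' hD''arr (nonempty_iso_of_linearEquiv (transportEquiv G) hall)
  apply Set.Subset.antisymm
  · intro C' hC'
    by_cases hne : ∀ z (hz : z ∈ Z), C' ≠ fiberCloseds η (hZ' z hz)
    · obtain ⟨C, hdisj, rfl⟩ := descend C' hC' hne
      have hC : C ∈ D := hDD ▸ ⟨hdisj, hC'⟩
      exact hST ((mem_strictTransforms_iff hDZ).mpr ⟨C, hC, rfl⟩)
    · push Not at hne
      obtain ⟨z, hz, rfl⟩ := hne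
      exact (local_at z hz).1.mp hC'
  · intro C' hC'
    rcases hTS hC' with h | h
    · obtain ⟨C, hC, rfl⟩ := (mem_strictTransforms_iff hDZ).mp h
      rw [← hDD] at hC
      exact hC.2
    · obtain ⟨z, hz, rfl⟩ := (mem_exceptionalCurves_iff hZ').mp h
      exact (local_at z hz).1.mpr hC'

end Main

end LogTorelli

end

theorem corollary2p3
    {X X' : Scheme.{0}} [IsIntegral X] (p : X ⟶ LogTorelli.SpecC)
    (hX : LogTorelli.IsSmoothProjectiveSurface p)
    (Z : Closeds X) (hZ : (Z : Set X).Finite) (hZ' : ∀ z ∈ Z, IsClosed ({z} : Set X))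
    (η : X' ⟶ X)
    (hη : LogTorelli.IsBlowUp η (Scheme.IdealSheafData.vanishingIdeal Z))
    (D : Set (Closeds X)) (hD : LogTorelli.IsTorelliArrangement p D)
    (hDZ : ∀ C ∈ D, Disjoint (C : Set X) (Z : Set X)) :
    ∃ _ : IsIntegral X',
      LogTorelli.IsTorelliArrangement (η ≫ p) (LogTorelli.strictTransforms η Z D) ∧
      LogTorelli.IsTorelliArrangement (η ≫ p)
        (LogTorelli.strictTransforms η Z D ∪ LogTorelli.exceptionalCurves η Z) := by
  have hp : SmoothOfRelativeDimension 2 p := hX.smooth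
  have hp' : Smooth p := SmoothOfRelativeDimension.smooth 2 p
  have hgen := LogTorelli.genericPoint_notMem (p := p) hZ hZ'
  have hint : IsIntegral X' := hη.isIntegral ⟨_, hgen⟩
  have := hη.isIso_restrict
  have hlft : LocallyOfFiniteType η := hη.locallyOfFiniteType (p := p) hZ hZ'
  have : JacobsonSpace X := LocallyOfFiniteType.jacobsonSpace p
  have : JacobsonSpace X' := LocallyOfFiniteType.jacobsonSpace η
  have : IsLocallyNoetherian X := LocallyOfFiniteType.isLocallyNoetherian p
  have : IsLocallyNoetherian X' := LocallyOfFiniteType.isLocallyNoetherian η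
  have hgen' : η (genericPoint X') ∈ LogTorelli.complOpens Z := by
    obtain ⟨y, hy⟩ := LogTorelli.exists_eq_of_mem (η := η) (U := LogTorelli.complOpens Z) hgen
    exact LogTorelli.genericPoint_mem (U := η ⁻¹ᵁ LogTorelli.complOpens Z)
      ⟨y, show η y ∈ LogTorelli.complOpens Z from hy ▸ hgen⟩
  have := LogTorelli.isIso_stalkMap_of_restrict (η := η) _ hgen'
  have harr := LogTorelli.isArrangement_strictTransforms_union hη hZ hZ' hD.1 hDZ
  -- The two claims are the extreme choices of `T`: the strict transforms alone, and all exceptional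
  -- curves added.
  exact ⟨hint,
    ⟨harr.mono Set.subset_union_left, fun D' hD' e => LogTorelli.eq_of_iso hη hZ hZ' hD hDZ
      subset_rfl Set.subset_union_left hD' e⟩,
    ⟨harr, fun D' hD' e => LogTorelli.eq_of_iso hη hZ hZ' hD hDZ
      Set.subset_union_left subset_rfl hD' e⟩⟩
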